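/- Let $M$ and $\widehat M$ be connected, oriented Riemannian manifolds of the same dimension $n\ge 2$, let $\tau>0$, and write $\frac{D}{dt}$ for the covariant derivative along a curve given by the Levi-Civita connection. **Rolling.** Let $x\colon[0,\tau]\to M$ and $\widehat x\colon[0,\tau]\to\widehat M$ be curves. A rolling (without slipping or twisting) of $M$ on $\widehat M$ along $x$ and $\widehat x$ is an absolutely continuous family of orientation-preserving linear isometries $q(t)\colon T_{x(t)}M\to T_{\widehat x(t)}\widehat M$ with $\dot{\widehat x}(t)=q(t)\dot x(t)$ for almost every $t$ and, for each absolutely continuous vector field $Z$ along $x$, $q(t)\frac{D}{dt}Z(t)=\frac{D}{dt}\big(q(t)Z(t)\big)$ for almost every $t$. **Regularity.** A curve $x$ is $C^k$-regular if the $k$ vectors $\dot x(t),\frac{D}{dt}\dot x(t),\dots,\frac{D^{k-1}}{dt^{k-1}}\dot x(t)$ are linearly independent for every $t\in[0,\tau]$. **Geodesic curvatures.** For a curve $x$ parametrized by arc length put $v_0=0$, $\kappa_0=0$, $v_1=\dot x$ and, as long as $\kappa_j$ does not vanish, $$\kappa_j=\Big|\tfrac{D}{dt}v_j+\kappa_{j-1}v_{j-1}\Big|,\qquad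 \kappa_j v_{j+1}=\tfrac{D}{dt}v_j+\kappa_{j-1}v_{j-1}\qquad(1\le j\le n-2).$$ Moreover $v_n$ is the unit vector field for which $v_1,\dots,v_n$ is a positively oriented orthonormal basis, and the last geodesic curvature is the signed function $\kappa_{n-1}=\big\langle v_n,\frac{D}{dt}v_{n-1}+\kappa_{n-2}v_{n-2}\big\rangle$. The function $\kappa_j$, $1\le j\le n-1$, is the $j$-th geodesic curvature of $x$. **Parallel distributions.** A distribution along $x$, i.e. a family of subspaces $V(t)\subseteq T_{x(t)}M$ of constant dimension $\operatorname{rank}V$, is parallel if it is closed under parallel transport along $x$. **Proposition.** Let $k$ be a positive integer, and let $x\colon[0,\tau]\to M$ and $\widehat x\colon[0,\tau]\to\widehat M$ be $C^{k+1}$ curves, parametrized by arc length, both $C^k$-regular. Let $V$ be the smallest parallel distribution along $x$ with $\dot x(t)\in V(t)$ for all $t$, and define $\widehat V$ in the same way for $\widehat x$. Suppose that $\operatorname{rank}V=k$. Then there exists a rolling of $M$ on $\widehat M$ along $x$ and $\widehat x$ if and only if $\operatorname{rank}\widehat V=k$ and the first $k-1$ geodesic curvatures of $x$ and $\widehat x$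 coincide, i.e. $\kappa_j(t)=\widehat\kappa_j(t)$ for all $t\in[0,\tau]$ and $1\le j\le k-1$. -/

import Mathlib

open Set MeasureTheory Bundle Manifold Module Filter
open scoped ContDiff Topology InnerProductSpace

noncomputable section

section Connection

theorem mvfderiv_congr {n : ℕ} {M : Type*} [TopologicalSpace M]
    [ChartedSpace (EuclideanSpace ℝ (Fin n)) M] {F : Type*} [NormedAddCommGroup F]
    [NormedSpace ℝ F] {f g : M → F} {p : M}
    (h : f =ᶠ[𝓝 p] g) : mvfderiv (𝓡 n) f p = mvfderiv (𝓡 n) g p := by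
  ext1 u
  change (mfderiv (𝓡 n) 𝓘(ℝ, F) f p u : F) = mfderiv (𝓡 n) 𝓘(ℝ, F) g p u
  rw [h.mfderiv_eq]
  rfl

/-- The trivialization of the tangent bundle of `M` induced by the preferred chart at `p`. It reads
a tangent vector at `q` as the tuple of its components in that chart. -/
abbrev chartTriv (n : ℕ) {M : Type*} [TopologicalSpace M]
    [ChartedSpace (EuclideanSpace ℝ (Fin n)) M] [IsManifold (𝓡 n) ∞ M] (p : M) :
    Trivialization (EuclideanSpace ℝ (Fin n))
      (TotalSpace.proj : TangentBundle (𝓡 n) M → M) :=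
  trivializationAt (EuclideanSpace ℝ (Fin n)) (TangentSpace (𝓡 n)) p

variable {n : ℕ} {M : Type*} [TopologicalSpace M] [ChartedSpace (EuclideanSpace ℝ (Fin n)) M]
  [IsManifold (𝓡 n) ∞ M]

/-- The vector field near `p` that has constant components in the preferred chart at `p` and takes
the value `u` at `p`. -/
def constField (p : M) (u : TangentSpace (𝓡 n) p) (q : M) : TangentSpace (𝓡 n) q :=
  (chartTriv n p).symmL ℝ q ((chartTriv n p).continuousLinearMapAt ℝ p u)

theorem constField_add (p q : M) (u v : TangentSpace (𝓡 n) p) :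
    constField p (u + v) q = constField p u q + constField p v q := by
  simp only [constField, map_add]

theorem constField_smul (p q : M) (c : ℝ) (u : TangentSpace (𝓡 n) p) :
    constField p (c • u) q = c • constField p u q := by
  simp only [constField, map_smul]

theorem mem_baseSet_chartTriv (p : M) : p ∈ (chartTriv n p).baseSet :=
  FiberBundle.mem_baseSet_trivializationAt' p

theorem constField_self (p : M) (u : TangentSpace (𝓡 n) p) : constField p u p = u :=
  Trivialization.symmL_continuousLinearMapAt _ (mem_baseSet_chartTriv p) u

theorem snd_chartTriv (p : M) {q : M} (hq : q ∈ (chartTriv n p).baseSet)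
    (u : TangentSpace (𝓡 n) q) :
    (chartTriv n p ⟨q, u⟩).2 = (chartTriv n p).continuousLinearMapAt ℝ q u := by
  rw [Trivialization.continuousLinearMapAt_apply, Trivialization.linearMapAt_apply, if_pos hq]

theorem snd_chartTriv_constField (p : M) {q : M} (hq : q ∈ (chartTriv n p).baseSet)
    (u : TangentSpace (𝓡 n) p) :
    (chartTriv n p ⟨q, constField p u q⟩).2 = (chartTriv n p).continuousLinearMapAt ℝ p u := by
  rw [snd_chartTriv p hq]
  exact Trivialization.continuousLinearMapAt_symmL _ hq _

theorem mdifferentiableAt_constField (p : M) (u : TangentSpace (𝓡 n) p) :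
    MDifferentiableAt (𝓡 n) (𝓡 n).tangent
      (fun q : M => (⟨q, constField p u q⟩ : TangentBundle (𝓡 n) M)) p := by
  rw [mdifferentiableAt_section]
  refine MDifferentiableAt.congr_of_eventuallyEq
    (f := fun _ => (chartTriv n p).continuousLinearMapAt ℝ p u) mdifferentiableAt_const ?_
  filter_upwards [(chartTriv n p).open_baseSet.mem_nhds (mem_baseSet_chartTriv p)] with q hq
  exact snd_chartTriv_constField p hq u

theorem mlieBracket_constField (p : M) (u v : TangentSpace (𝓡 n) p) :
    VectorField.mlieBracket (𝓡 n) (constField p u) (constField p v) p = 0 := by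
  have key : ∀ w : TangentSpace (𝓡 n) p,
      VectorField.mpullbackWithin 𝓘(ℝ, EuclideanSpace ℝ (Fin n)) (𝓡 n)
        (extChartAt (𝓡 n) p).symm (constField p w) (range (𝓡 n))
      =ᶠ[𝓝 (extChartAt (𝓡 n) p p)] fun _ => (chartTriv n p).continuousLinearMapAt ℝ p w := by
    intro w
    filter_upwards [extChartAt_target_mem_nhds (I := 𝓡 n) p] with y hy
    have hq : (extChartAt (𝓡 n) p).symm y ∈ (chartAt (EuclideanSpace ℝ (Fin n)) p).source := by
      simpa using (extChartAt (𝓡 n) p).map_target hy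
    rw [VectorField.mpullbackWithin_apply]
    unfold constField
    rw [TangentBundle.symmL_trivializationAt hq, (extChartAt (𝓡 n) p).right_inv hy]
    exact (isInvertible_mfderivWithin_extChartAt_symm hy).inverse_apply_self _
  have h0 : VectorField.lieBracketWithin ℝ
      (VectorField.mpullbackWithin 𝓘(ℝ, EuclideanSpace ℝ (Fin n)) (𝓡 n)
        (extChartAt (𝓡 n) p).symm (constField p u) (range (𝓡 n)))
      (VectorField.mpullbackWithin 𝓘(ℝ, EuclideanSpace ℝ (Fin n)) (𝓡 n)
        (extChartAt (𝓡 n) p).symm (constField p v) (range (𝓡 n)))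
      ((extChartAt (𝓡 n) p).symm ⁻¹' univ ∩ range (𝓡 n)) (extChartAt (𝓡 n) p p) = 0 := by
    rw [Filter.EventuallyEq.lieBracketWithin_vectorField_eq
      ((key u).filter_mono nhdsWithin_le_nhds) (key u).eq_of_nhds
      ((key v).filter_mono nhdsWithin_le_nhds) (key v).eq_of_nhds]
    rw [VectorField.lieBracketWithin_eq, fderivWithin_fun_const, fderivWithin_fun_const]
    simp
  rw [← VectorField.mlieBracketWithin_univ, VectorField.mlieBracketWithin_apply, h0]
  exact map_zero _

variable [RiemannianBundle (fun p : M => TangentSpace (𝓡 n) p)]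

/-- The Christoffel symbols of the first kind `Γ(u, v; w)` at `p`, in the preferred chart at `p`. -/
def christoffelLower (p : M) (u v w : TangentSpace (𝓡 n) p) : ℝ :=
  (1 / 2) * (mvfderiv (𝓡 n) (fun q : M => ⟪constField p v q, constField p w q⟫_ℝ) p u
    + mvfderiv (𝓡 n) (fun q : M => ⟪constField p u q, constField p w q⟫_ℝ) p v
    - mvfderiv (𝓡 n) (fun q : M => ⟪constField p u q, constField p v q⟫_ℝ) p w)

instance tangentSpace_finiteDimensional (p : M) : FiniteDimensional ℝ (TangentSpace (𝓡 n) p) :=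
  inferInstanceAs (FiniteDimensional ℝ (EuclideanSpace ℝ (Fin n)))

/-- The Christoffel symbols `Γ(u, v)` at `p`: the index of `christoffelLower` is raised with the
metric, so that `⟪Γ(u, v), w⟫ = Γ(u, v; w)` for all `w` (see `inner_christoffel`). -/
def christoffel (p : M) (u v : TangentSpace (𝓡 n) p) : TangentSpace (𝓡 n) p :=
  ∑ i, christoffelLower p u v (stdOrthonormalBasis ℝ (TangentSpace (𝓡 n) p) i) •
    stdOrthonormalBasis ℝ (TangentSpace (𝓡 n) p) i

theorem mvfderiv_inner_constField_comm (p : M) (u v : TangentSpace (𝓡 n) p) :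
    mvfderiv (𝓡 n) (fun q : M => ⟪constField p u q, constField p v q⟫_ℝ) p
    = mvfderiv (𝓡 n) (fun q : M => ⟪constField p v q, constField p u q⟫_ℝ) p := by
  congr 1
  funext q
  exact real_inner_comm _ _

theorem christoffelLower_comm (p : M) (u v w : TangentSpace (𝓡 n) p) :
    christoffelLower p u v w = christoffelLower p v u w := by
  simp only [christoffelLower, mvfderiv_inner_constField_comm p u v]
  ring

theorem christoffel_comm (p : M) (u v : TangentSpace (𝓡 n) p) :
    christoffel p u v = christoffel p v u := by
  simp only [christoffel, christoffelLower_comm p u v]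

variable [IsContMDiffRiemannianBundle (𝓡 n) ∞ (EuclideanSpace ℝ (Fin n))
    (fun p : M => TangentSpace (𝓡 n) p)]

instance isContMDiffRiemannianBundle_one :
    IsContMDiffRiemannianBundle (𝓡 n) 1 (EuclideanSpace ℝ (Fin n))
      (fun p : M => TangentSpace (𝓡 n) p) :=
  IsContMDiffRiemannianBundle.of_le (n := ∞) (by exact_mod_cast le_top)

theorem mdifferentiableAt_inner_constField (p : M) (u v : TangentSpace (𝓡 n) p) :
    MDifferentiableAt (𝓡 n) 𝓘(ℝ, ℝ)
      (fun q : M => ⟪constField p u q, constField p v q⟫_ℝ) p :=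
  MDifferentiableAt.inner_bundle (IB := 𝓡 n) (F := EuclideanSpace ℝ (Fin n))
    (E := fun p : M => TangentSpace (𝓡 n) p)
    (mdifferentiableAt_constField p u) (mdifferentiableAt_constField p v)

theorem mvfderiv_inner_constField_add (p : M) (u v w : TangentSpace (𝓡 n) p) :
    mvfderiv (𝓡 n) (fun q : M => ⟪constField p (u + v) q, constField p w q⟫_ℝ) p
    = mvfderiv (𝓡 n) (fun q : M => ⟪constField p u q, constField p w q⟫_ℝ) p
     + mvfderiv (𝓡 n) (fun q : M => ⟪constField p v q, constField p w q⟫_ℝ) p := by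
  rw [← mvfderiv_add (mdifferentiableAt_inner_constField p u w)
    (mdifferentiableAt_inner_constField p v w)]
  congr 1
  funext q
  simp only [constField_add, inner_add_left, Pi.add_apply]

theorem mvfderiv_inner_constField_smul (p : M) (c : ℝ) (u w : TangentSpace (𝓡 n) p) :
    mvfderiv (𝓡 n) (fun q : M => ⟪constField p (c • u) q, constField p w q⟫_ℝ) p
    = c • mvfderiv (𝓡 n) (fun q : M => ⟪constField p u q, constField p w q⟫_ℝ) p := by
  have h := mvfderiv_mul (I := 𝓡 n) (f := fun _ : M => c) (x := p) mdifferentiableAt_const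
    (mdifferentiableAt_inner_constField p u w)
  rw [mvfderiv_const, smul_zero, add_zero] at h
  rw [← h]
  congr 1
  funext q
  simp only [constField_smul, real_inner_smul_left, Pi.mul_apply]

theorem christoffelLower_add_left (p : M) (u u' v w : TangentSpace (𝓡 n) p) :
    christoffelLower p (u + u') v w = christoffelLower p u v w + christoffelLower p u' v w := by
  simp only [christoffelLower, mvfderiv_inner_constField_add, map_add,
    add_apply]
  ring

theorem christoffelLower_smul_left (p : M) (c : ℝ) (u v w : TangentSpace (𝓡 n) p) :
    christoffelLower p (c • u) v w = c * christoffelLower p u v w := by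
  simp only [christoffelLower, mvfderiv_inner_constField_smul, map_smul,
    smul_apply, smul_eq_mul]
  ring

theorem christoffelLower_add_right (p : M) (u v w w' : TangentSpace (𝓡 n) p) :
    christoffelLower p u v (w + w') = christoffelLower p u v w + christoffelLower p u v w' := by
  simp only [christoffelLower, mvfderiv_inner_constField_comm p _ (w + w'),
    mvfderiv_inner_constField_add, map_add, add_apply,
    mvfderiv_inner_constField_comm p w, mvfderiv_inner_constField_comm p w']
  ring

theorem christoffelLower_smul_right (p : M) (c : ℝ) (u v w : TangentSpace (𝓡 n) p) :
    christoffelLower p u v (c • w) = c * christoffelLower p u v w := by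
  simp only [christoffelLower, mvfderiv_inner_constField_comm p _ (c • w),
    mvfderiv_inner_constField_smul, map_smul, smul_apply, smul_eq_mul,
    mvfderiv_inner_constField_comm p w]
  ring

theorem inner_christoffel (p : M) (u v w : TangentSpace (𝓡 n) p) :
    ⟪christoffel p u v, w⟫_ℝ = christoffelLower p u v w := by
  let L : TangentSpace (𝓡 n) p →ₗ[ℝ] ℝ :=
    { toFun := christoffelLower p u v
      map_add' := christoffelLower_add_right p u v
      map_smul' := fun c w => christoffelLower_smul_right p c u v w }
  have h : christoffelLower p u v w = L w := rfl
  rw [h]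
  conv_rhs => rw [← (stdOrthonormalBasis ℝ (TangentSpace (𝓡 n) p)).sum_repr' w, map_sum]
  simp only [christoffel, sum_inner, real_inner_smul_left, map_smul, smul_eq_mul]
  exact Finset.sum_congr rfl fun i _ => mul_comm _ _

theorem christoffel_add_left (p : M) (u u' v : TangentSpace (𝓡 n) p) :
    christoffel p (u + u') v = christoffel p u v + christoffel p u' v := by
  simp only [christoffel, christoffelLower_add_left, add_smul, Finset.sum_add_distrib]

theorem christoffel_smul_left (p : M) (c : ℝ) (u v : TangentSpace (𝓡 n) p) :
    christoffel p (c • u) v = c • christoffel p u v := by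
  simp only [christoffel, christoffelLower_smul_left, mul_smul, Finset.smul_sum]


/-- The Levi-Civita covariant derivative `u ↦ ∇_u σ` at `p`, computed in the preferred chart at `p`:
the derivative of the components of `σ` in the direction `u`, plus `Γ(u, σ p)`. -/
def leviCivitaAux (σ : ∀ q : M, TangentSpace (𝓡 n) q) (p : M) :
    TangentSpace (𝓡 n) p →L[ℝ] TangentSpace (𝓡 n) p :=
  (chartTriv n p).symmL ℝ p ∘L mvfderiv (𝓡 n) (fun q : M => (chartTriv n p ⟨q, σ q⟩).2) p
  + LinearMap.toContinuousLinearMap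
      { toFun := fun u => christoffel p u (σ p)
        map_add' := fun u u' => christoffel_add_left p u u' (σ p)
        map_smul' := fun c u => christoffel_smul_left p c u (σ p) }

theorem leviCivitaAux_apply (σ : ∀ q : M, TangentSpace (𝓡 n) q) (p : M)
    (u : TangentSpace (𝓡 n) p) :
    leviCivitaAux σ p u = (chartTriv n p).symmL ℝ p
      (mvfderiv (𝓡 n) (fun q : M => (chartTriv n p ⟨q, σ q⟩).2) p u) + christoffel p u (σ p) :=
  rfl

theorem christoffel_add_right (p : M) (u v v' : TangentSpace (𝓡 n) p) :
    christoffel p u (v + v') = christoffel p u v + christoffel p u v' := by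
  simp only [christoffel_comm p u, christoffel_add_left]

theorem christoffel_smul_right (p : M) (c : ℝ) (u v : TangentSpace (𝓡 n) p) :
    christoffel p u (c • v) = c • christoffel p u v := by
  simp only [christoffel_comm p u, christoffel_smul_left]

variable (n M) in
/-- The Levi-Civita connection of `M`. -/
def leviCivita : CovariantDerivative (𝓡 n) (EuclideanSpace ℝ (Fin n))
    (fun p : M => TangentSpace (𝓡 n) p) where
  toFun := leviCivitaAux
  isCovariantDerivativeOnUniv :=
    { add := by
        intro σ σ' p hσ hσ' _
        rw [mdifferentiableAt_section] at hσ hσ'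
        ext1 u
        have h : mvfderiv (𝓡 n) (fun q : M => (chartTriv n p ⟨q, (σ + σ') q⟩).2) p =
            mvfderiv (𝓡 n) (fun q : M => (chartTriv n p ⟨q, σ q⟩).2) p +
            mvfderiv (𝓡 n) (fun q : M => (chartTriv n p ⟨q, σ' q⟩).2) p := by
          rw [← mvfderiv_add hσ hσ']
          refine mvfderiv_congr ?_
          filter_upwards [(chartTriv n p).open_baseSet.mem_nhds (mem_baseSet_chartTriv p)] with q hq
          rw [Pi.add_apply, Pi.add_apply, snd_chartTriv p hq, snd_chartTriv p hq,
            snd_chartTriv p hq, map_add]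
        rw [add_apply, leviCivitaAux_apply, leviCivitaAux_apply, leviCivitaAux_apply, h,
          add_apply, map_add, Pi.add_apply, christoffel_add_right]
        abel
      leibniz := by
        intro σ g p hσ hg _
        rw [mdifferentiableAt_section] at hσ
        ext1 u
        have h : mvfderiv (𝓡 n) (fun q : M => (chartTriv n p ⟨q, (g • σ) q⟩).2) p =
            g p • mvfderiv (𝓡 n) (fun q : M => (chartTriv n p ⟨q, σ q⟩).2) p +
            (mvfderiv (𝓡 n) g p).smulRight (chartTriv n p ⟨p, σ p⟩).2 := by
          rw [← mvfderiv_smul hg hσ]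
          refine mvfderiv_congr ?_
          filter_upwards [(chartTriv n p).open_baseSet.mem_nhds (mem_baseSet_chartTriv p)] with q hq
          rw [Pi.smul_apply', Pi.smul_apply', snd_chartTriv p hq, snd_chartTriv p hq, map_smul]
        rw [add_apply, smul_apply, leviCivitaAux_apply, leviCivitaAux_apply, h, add_apply,
          smul_apply, map_add, map_smul, ContinuousLinearMap.smulRight_apply, map_smul,
          snd_chartTriv p (mem_baseSet_chartTriv p),
          Trivialization.symmL_continuousLinearMapAt _ (mem_baseSet_chartTriv p),
          Pi.smul_apply', christoffel_smul_right, smul_add,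
          ContinuousLinearMap.smulRight_apply]
        abel }


theorem leviCivita_constField (p : M) (u v : TangentSpace (𝓡 n) p) :
    leviCivita n M (constField p v) p u = christoffel p u v := by
  change leviCivitaAux (constField p v) p u = _
  have h : mvfderiv (𝓡 n) (fun q : M => (chartTriv n p ⟨q, constField p v q⟩).2) p = 0 := by
    rw [← mvfderiv_const (I := 𝓡 n) ((chartTriv n p).continuousLinearMapAt ℝ p v)]
    refine mvfderiv_congr ?_
    filter_upwards [(chartTriv n p).open_baseSet.mem_nhds (mem_baseSet_chartTriv p)] with q hq
    exact snd_chartTriv_constField p hq v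
  rw [leviCivitaAux_apply, h, zero_apply, map_zero, zero_add, constField_self]

/-- The Levi-Civita connection is compatible with the metric. -/
theorem leviCivita_isMetricCompatible : (leviCivita n M).IsMetricCompatible := by
  unfold CovariantDerivative.IsMetricCompatible
  ext p v w u
  have h := CovariantDerivative.derivMetricTensor_apply (leviCivita n M)
    (X := constField p u) p (mdifferentiableAt_constField p v) (mdifferentiableAt_constField p w)
  rw [constField_self, constField_self, constField_self] at h
  rw [h]
  beta_reduce
  rw [constField_self, leviCivita_constField, leviCivita_constField, inner_christoffel, constField_self,
    constField_self, real_inner_comm, inner_christoffel]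
  simp only [christoffelLower, mvfderiv_inner_constField_comm p w]
  simp
  ring

/-- The Levi-Civita connection is torsion-free. -/
theorem leviCivita_torsion : (leviCivita n M).torsion = 0 := by
  ext1 p
  ext1 u
  ext1 v
  have h := CovariantDerivative.torsion_apply (leviCivita n M)
    (mdifferentiableAt_constField p u) (mdifferentiableAt_constField p v)
  rw [constField_self, constField_self] at h
  rw [h, leviCivita_constField, leviCivita_constField, mlieBracket_constField, christoffel_comm]
  simp

end Connection

section Orientation

/-- An orientation of an `n`-dimensional manifold `M`: an orientation of every tangent space such
that, read in the preferred chart at any point, it is constant near that point. -/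
structure ManifoldOrientation (n : ℕ) (M : Type*) [TopologicalSpace M]
    [ChartedSpace (EuclideanSpace ℝ (Fin n)) M] [IsManifold (𝓡 n) ∞ M] where
  /-- The orientation of the tangent space at a point. -/
  orient : ∀ p : M, Orientation ℝ (TangentSpace (𝓡 n) p) (Fin n)
  /-- The orientation is locally constant in charts. -/
  locally_constant : ∀ p : M, ∃ oE : Orientation ℝ (EuclideanSpace ℝ (Fin n)) (Fin n),
    ∀ᶠ q in 𝓝 p, ∀ hq : q ∈ (chartTriv n p).baseSet,
      Orientation.map (Fin n) ((chartTriv n p).continuousLinearEquivAt ℝ q hq).toLinearEquiv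
        (orient q) = oE

end Orientation

section Curves

variable {n : ℕ} {M : Type*} [TopologicalSpace M] [ChartedSpace (EuclideanSpace ℝ (Fin n)) M]
  [IsManifold (𝓡 n) ∞ M]

variable (n) in
/-- The velocity of a curve `x : [0, τ] → M` (one-sided at the end points). A curve on `[0, τ]` is a
function on `ℝ` of which only the values on `[0, τ]` matter. -/
def velocity (τ : ℝ) (x : ℝ → M) (t : ℝ) : TangentSpace (𝓡 n) (x t) :=
  mfderivWithin 𝓘(ℝ, ℝ) (𝓡 n) x (Icc 0 τ) t (1 : ℝ)

/-- The function `f` is absolutely continuous on a neighbourhood of `t₀` in `[0, τ]` that is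
contained in `S`. -/
def IsACNear (τ t₀ : ℝ) (S : Set ℝ) (f : ℝ → EuclideanSpace ℝ (Fin n)) : Prop :=
  ∃ a b : ℝ, Icc a b ∈ 𝓝[Icc 0 τ] t₀ ∧ Icc a b ⊆ Icc 0 τ ∩ S ∧ AbsolutelyContinuousOnInterval f a b

variable (n) in
/-- Absolutely continuous curves `[0, τ] → M`. -/
def IsACCurve (τ : ℝ) (x : ℝ → M) : Prop :=
  ∀ t₀ ∈ Icc 0 τ, IsACNear τ t₀ (x ⁻¹' (extChartAt (𝓡 n) (x t₀)).source)
    (fun t => extChartAt (𝓡 n) (x t₀) (x t))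

/-- Absolutely continuous vector fields along a curve `x : [0, τ] → M`. -/
def IsACField (τ : ℝ) (x : ℝ → M) (Z : ∀ t, TangentSpace (𝓡 n) (x t)) : Prop :=
  ∀ t₀ ∈ Icc 0 τ, IsACNear τ t₀ (x ⁻¹' (chartTriv n (x t₀)).baseSet)
    (fun t => (chartTriv n (x t₀) ⟨x t, Z t⟩).2)

variable [RiemannianBundle (fun p : M => TangentSpace (𝓡 n) p)]
  [IsContMDiffRiemannianBundle (𝓡 n) ∞ (EuclideanSpace ℝ (Fin n))
    (fun p : M => TangentSpace (𝓡 n) p)]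

/-- The covariant derivative `D/dt` of a vector field `Z` along a curve `x : [0, τ] → M`:
if `Z = ∑ zᵢ eᵢ` in the frame `eᵢ` of coordinate fields of the preferred chart at `x t`, then
`DZ/dt = ∑ zᵢ' eᵢ + ∇_{x'} (∑ zᵢ(t) eᵢ)` at time `t`. -/
def covDerivAlong (τ : ℝ) (x : ℝ → M) (Z : ∀ t, TangentSpace (𝓡 n) (x t)) (t : ℝ) :
    TangentSpace (𝓡 n) (x t) :=
  (chartTriv n (x t)).symmL ℝ (x t)
      (derivWithin (fun s => (chartTriv n (x t) ⟨x s, Z s⟩).2) (Icc 0 τ) t)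
    + leviCivita n M (constField (x t) (Z t)) (x t) (velocity n τ x t)

variable (n) in
/-- The iterated covariant derivatives `D^j/dt^j x'` of the velocity. -/
def iterCovDeriv (τ : ℝ) (x : ℝ → M) : ℕ → ∀ t, TangentSpace (𝓡 n) (x t)
  | 0 => velocity n τ x
  | j + 1 => covDerivAlong τ x (iterCovDeriv τ x j)

variable (n) in
/-- `C^k`-regular curves: the `k` vectors `x', D/dt x', …, D^{k-1}/dt^{k-1} x'` are linearly
independent at every time. -/
def IsRegularCurve (τ : ℝ) (k : ℕ) (x : ℝ → M) : Prop :=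
  ∀ t ∈ Icc 0 τ, LinearIndependent ℝ (fun i : Fin k => iterCovDeriv n τ x i t)

variable (n) in
/-- Curves parametrized by arc length. -/
def IsArcLength (τ : ℝ) (x : ℝ → M) : Prop :=
  ∀ t ∈ Icc 0 τ, ‖velocity n τ x t‖ = 1

/-- The vector field `D/dt w + κ v`, for a triple `(v, w, κ)` of two vector fields along `x` and a
function. -/
def frenetRemainder (τ : ℝ) (x : ℝ → M)
    (d : (∀ t, TangentSpace (𝓡 n) (x t)) × (∀ t, TangentSpace (𝓡 n) (x t)) × (ℝ → ℝ)) (t : ℝ) :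
    TangentSpace (𝓡 n) (x t) :=
  covDerivAlong τ x d.2.1 t + d.2.2 t • d.1 t

variable (n) in
/-- The triple `(v_j, v_{j+1}, κ_j)` of consecutive Frenet vector fields and unsigned geodesic
curvature, defined by `v_0 = 0`, `κ_0 = 0`, `v_1 = x'`,
`κ_{j+1} = ‖D/dt v_{j+1} + κ_j v_j‖` and `κ_{j+1} v_{j+2} = D/dt v_{j+1} + κ_j v_j`. -/
def frenetData (τ : ℝ) (x : ℝ → M) :
    ℕ → (∀ t, TangentSpace (𝓡 n) (x t)) × (∀ t, TangentSpace (𝓡 n) (x t)) × (ℝ → ℝ)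
  | 0 => (fun _ => 0, velocity n τ x, fun _ => 0)
  | j + 1 =>
    ((frenetData τ x j).2.1,
      fun t => ‖frenetRemainder τ x (frenetData τ x j) t‖⁻¹ •
        frenetRemainder τ x (frenetData τ x j) t,
      fun t => ‖frenetRemainder τ x (frenetData τ x j) t‖)

instance fact_finrank_tangentSpace (p : M) : Fact (finrank ℝ (TangentSpace (𝓡 n) p) = n) :=
  ⟨finrank_euclideanSpace_fin (𝕜 := ℝ) (n := n)⟩

/-- The last Frenet vector field `v_n = ♯ ⋆ ♭ (v_1 ∧ ⋯ ∧ v_{n-1})` of a curve in an oriented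
manifold: the vector with `⟪v_n, w⟫ = vol (v_1, …, v_{n-1}, w)` for all `w`. If `v_1, …, v_{n-1}`
are orthonormal, then it is the unit vector that completes them to a positively oriented
orthonormal basis. -/
def lastFrenet (o : ManifoldOrientation n M) (τ : ℝ) (x : ℝ → M) (t : ℝ) :
    TangentSpace (𝓡 n) (x t) :=
  ∑ i, (o.orient (x t)).volumeForm (fun j : Fin n =>
      if j.val + 1 < n then (frenetData n τ x (j.val + 1)).1 t
      else stdOrthonormalBasis ℝ (TangentSpace (𝓡 n) (x t)) i) •
    stdOrthonormalBasis ℝ (TangentSpace (𝓡 n) (x t)) i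

/-- The `j`-th geodesic curvature, `1 ≤ j ≤ n - 1`. For `j < n - 1` it is
`κ_j = ‖D/dt v_j + κ_{j-1} v_{j-1}‖`; the last one is signed,
`κ_{n-1} = ⟪v_n, D/dt v_{n-1} + κ_{n-2} v_{n-2}⟫`. -/
def geodesicCurvature (o : ManifoldOrientation n M) (τ : ℝ) (x : ℝ → M) (j : ℕ) (t : ℝ) : ℝ :=
  if j + 1 = n then ⟪lastFrenet o τ x t, frenetRemainder τ x (frenetData n τ x (j - 1)) t⟫_ℝ
  else (frenetData n τ x j).2.2 t

/-- Parallel vector fields along a differentiable curve. -/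
def IsParallelField (τ : ℝ) (x : ℝ → M) (Z : ∀ t, TangentSpace (𝓡 n) (x t)) : Prop :=
  ∀ t ∈ Icc 0 τ,
    MDifferentiableWithinAt 𝓘(ℝ, ℝ) (𝓡 n).tangent
      (fun s => (⟨x s, Z s⟩ : TangentBundle (𝓡 n) M)) (Icc 0 τ) t ∧
    covDerivAlong τ x Z t = 0

/-- Parallel distributions along a differentiable curve: families of subspaces of the tangent
spaces that are closed under parallel transport along the curve. (Their rank is constant, because
parallel transport is a linear isomorphism.) -/
def IsParallelDistribution (τ : ℝ) (x : ℝ → M)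
    (V : ∀ t, Submodule ℝ (TangentSpace (𝓡 n) (x t))) : Prop :=
  ∀ Z, IsParallelField τ x Z → ∀ s ∈ Icc 0 τ, ∀ t ∈ Icc 0 τ, Z s ∈ V s → Z t ∈ V t

/-- The distribution `V` along `x` contains the velocity. -/
def ContainsVelocity (τ : ℝ) (x : ℝ → M)
    (V : ∀ t, Submodule ℝ (TangentSpace (𝓡 n) (x t))) : Prop :=
  ∀ t ∈ Icc 0 τ, velocity n τ x t ∈ V t

variable (n) in
/-- The minimal parallel distribution along `x` that contains the velocity: the intersection of all
of them. -/
def minimalParallelDistribution (τ : ℝ) (x : ℝ → M) (t : ℝ) :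
    Submodule ℝ (TangentSpace (𝓡 n) (x t)) :=
  sInf {W | ∃ V, IsParallelDistribution τ x V ∧ ContainsVelocity τ x V ∧ W = V t}

/-- It is indeed the least element of the set of these distributions. -/
theorem isLeast_minimalParallelDistribution (τ : ℝ) (x : ℝ → M) :
    IsLeast {V : ∀ t, Submodule ℝ (TangentSpace (𝓡 n) (x t)) |
      IsParallelDistribution τ x V ∧ ContainsVelocity τ x V}
      (minimalParallelDistribution n τ x) := by
  refine ⟨⟨?_, ?_⟩, ?_⟩
  · intro Z hZ s hs t ht hZs
    refine Submodule.mem_sInf.2 ?_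
    rintro _ ⟨V, hV, hV', rfl⟩
    exact hV Z hZ s hs t ht (Submodule.mem_sInf.1 hZs _ ⟨V, hV, hV', rfl⟩)
  · intro t ht
    refine Submodule.mem_sInf.2 ?_
    rintro _ ⟨V, _, hV', rfl⟩
    exact hV' t ht
  · rintro V ⟨hV, hV'⟩ t
    exact sInf_le ⟨V, hV, hV', rfl⟩

/-- The distribution `V` along a curve on `[0, τ]` has rank `k`. -/
def HasRank (τ : ℝ) (k : ℕ) {x : ℝ → M}
    (V : ∀ t, Submodule ℝ (TangentSpace (𝓡 n) (x t))) : Prop :=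
  ∀ t ∈ Icc 0 τ, finrank ℝ (V t) = k

end Curves

section Rolling

variable {n : ℕ} {M M' : Type*}
  [TopologicalSpace M] [ChartedSpace (EuclideanSpace ℝ (Fin n)) M] [IsManifold (𝓡 n) ∞ M]
  [RiemannianBundle (fun p : M => TangentSpace (𝓡 n) p)]
  [IsContMDiffRiemannianBundle (𝓡 n) ∞ (EuclideanSpace ℝ (Fin n))
    (fun p : M => TangentSpace (𝓡 n) p)]
  [TopologicalSpace M'] [ChartedSpace (EuclideanSpace ℝ (Fin n)) M'] [IsManifold (𝓡 n) ∞ M']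
  [RiemannianBundle (fun p : M' => TangentSpace (𝓡 n) p)]
  [IsContMDiffRiemannianBundle (𝓡 n) ∞ (EuclideanSpace ℝ (Fin n))
    (fun p : M' => TangentSpace (𝓡 n) p)]

/-- The family of isometries `q t : T_{x t} M → T_{x' t} M'` over the curves `x : [0, τ] → M` and
`x' : [0, τ] → M'` is a rolling of `M` on `M'` along `x` and `x'` (without slipping or twisting). -/
structure IsRolling (o : ManifoldOrientation n M) (o' : ManifoldOrientation n M') (τ : ℝ)
    (x : ℝ → M) (x' : ℝ → M')
    (q : ∀ t, TangentSpace (𝓡 n) (x t) ≃ₗᵢ[ℝ] TangentSpace (𝓡 n) (x' t)) : Prop where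
  /-- `q t` is an element of the configuration space: it preserves the orientation. -/
  orientation : ∀ t ∈ Icc 0 τ,
    Orientation.map (Fin n) (q t).toLinearEquiv (o.orient (x t)) = o'.orient (x' t)
  /-- The curve `q` in the configuration space is absolutely continuous, that is, so are `x`, `x'`
  and the matrix entries of `q` with respect to charts. -/
  ac_left : IsACCurve n τ x
  ac_right : IsACCurve n τ x'
  ac : ∀ t₀ ∈ Icc 0 τ, ∀ e : EuclideanSpace ℝ (Fin n),
    IsACNear τ t₀
      (x ⁻¹' (chartTriv n (x t₀)).baseSet ∩ x' ⁻¹' (chartTriv n (x' t₀)).baseSet)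
      (fun t => (chartTriv n (x' t₀) ⟨x' t, q t ((chartTriv n (x t₀)).symmL ℝ (x t) e)⟩).2)
  no_slip : ∀ᵐ t ∂volume.restrict (Icc 0 τ), velocity n τ x' t = q t (velocity n τ x t)
  no_twist : ∀ Z : ∀ t, TangentSpace (𝓡 n) (x t), IsACField τ x Z →
    ∀ᵐ t ∂volume.restrict (Icc 0 τ),
      q t (covDerivAlong τ x Z t) = covDerivAlong τ x' (fun s => q s (Z s)) t

end Rolling

end

/-!
A curve in an oriented Riemannian manifold carries a parallel, positively oriented, orthonormal
frame (`exists_oriented_parallelFrame`), encoded as a family of isometries `φ t` from `ℝⁿ` to the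
tangent spaces. In this frame the covariant derivative becomes the ordinary derivative, so all
notions that occur in the statement depend only on the curve `u` in the unit sphere of `ℝⁿ` with
`φ t (u t) = velocity n τ x t` (`frameVelocity`), and likewise on a curve `u'` for `x'`:

* A rolling, read in the two frames, is an absolutely continuous family of rotations of `ℝⁿ`. The
  no-twist condition, applied to the parallel fields of the frame, says that its derivative vanishes
  almost everywhere, so it is a constant rotation `A`, and the no-slip condition says that
  `u' = A u`. Conversely such an `A` defines a rolling (`exists_isRolling_iff`).
* The minimal parallel distribution becomes the constant subspace spanned by all values of `u`
  (`minimalParallelDistribution_eq`).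
* The Frenet vectors and geodesic curvatures become those of the curve with velocity `u`
  (`frenetData_eq`, `geodesicCurvature_eq`).

It remains to prove a congruence theorem for curves in `ℝⁿ`
(`exists_isometry_iff_signedCurvature_eq`). Let the values of `u` and of `u'` span subspaces of
dimension `k`. By regularity the first `k` Frenet vectors are orthonormal, and as they lie in the
span of the values of `u`, the next curvature vanishes. So the Frenet equations are a closed linear
system for these `k` vectors, with an antisymmetric matrix whose entries are the first `k - 1`
curvatures. If an isometry `A` maps one Frenet frame to the other at one time, then the sum of the
squared distances between the `A`-image of the one and the other is constant, hence zero
(`eq_of_curvature_eq`). Such an `A` exists, and it can be chosen of positive determinant: for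
`k < n` by a reflection that fixes the frame, and for `k = n` because the sign of the last curvature
is the orientation of the Frenet frame (`exists_isometry_frenetVector`).

The parallel frames come from the linear differential equation of parallel transport. That its
coefficients are smooth along the curve is not part of the definition of the connection, which uses
a different chart at each point; it follows from the Koszul formula for the coordinate fields of one
chart (`contMDiffAt_leviCivita_chartField`).
-/

noncomputable section

/-! ### Vector fields along curves -/

section FieldsAlong

variable {n : ℕ} {M : Type*} [TopologicalSpace M] [ChartedSpace (EuclideanSpace ℝ (Fin n)) M]
  [IsManifold (𝓡 n) ∞ M]

/-- The vector field `Z` along `x` is differentiable at `t` (within `[0, τ]`). -/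
def DiffFieldAt (τ : ℝ) (x : ℝ → M) (Z : ∀ t, TangentSpace (𝓡 n) (x t)) (t : ℝ) : Prop :=
  MDifferentiableWithinAt 𝓘(ℝ, ℝ) (𝓡 n).tangent
    (fun s => (⟨x s, Z s⟩ : TangentBundle (𝓡 n) M)) (Icc 0 τ) t

/-- The vector field `Z` along `x` is `C^m` at `t` (within `[0, τ]`). -/
def SmoothFieldAt (m : WithTop ℕ∞) (τ : ℝ) (x : ℝ → M) (Z : ∀ t, TangentSpace (𝓡 n) (x t))
    (t : ℝ) : Prop :=
  ContMDiffWithinAt 𝓘(ℝ, ℝ) (𝓡 n).tangent m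
    (fun s => (⟨x s, Z s⟩ : TangentBundle (𝓡 n) M)) (Icc 0 τ) t

/-- The vector field with constant components `w` in the preferred chart at `p`. -/
def chartField (p : M) (w : EuclideanSpace ℝ (Fin n)) (q : M) : TangentSpace (𝓡 n) q :=
  (chartTriv n p).symmL ℝ q w

variable {τ t : ℝ} {x : ℝ → M} {Z W : ∀ t, TangentSpace (𝓡 n) (x t)}

theorem SmoothFieldAt.diffFieldAt {m : WithTop ℕ∞} (hm : m ≠ 0) (h : SmoothFieldAt m τ x Z t) :
    DiffFieldAt τ x Z t :=
  ContMDiffWithinAt.mdifferentiableWithinAt h hm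

theorem diffFieldAt_iff (hx : MDifferentiableWithinAt 𝓘(ℝ, ℝ) (𝓡 n) x (Icc 0 τ) t) {p : M}
    (hp : x t ∈ (chartTriv n p).baseSet) :
    DiffFieldAt τ x Z t ↔
      DifferentiableWithinAt ℝ (fun s => (chartTriv n p ⟨x s, Z s⟩).2) (Icc 0 τ) t := by
  unfold DiffFieldAt
  rw [(chartTriv n p).mdifferentiableWithinAt_totalSpace_iff (𝓡 n) _
    (by rwa [Trivialization.mem_source])]
  rw [← mdifferentiableWithinAt_iff_differentiableWithinAt]
  exact and_iff_right hx

theorem smoothFieldAt_iff {m : WithTop ℕ∞} (hm : m ≤ ∞)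
    (hx : ContMDiffWithinAt 𝓘(ℝ, ℝ) (𝓡 n) m x (Icc 0 τ) t) {p : M}
    (hp : x t ∈ (chartTriv n p).baseSet) :
    SmoothFieldAt m τ x Z t ↔
      ContDiffWithinAt ℝ m (fun s => (chartTriv n p ⟨x s, Z s⟩).2) (Icc 0 τ) t := by
  unfold SmoothFieldAt
  have : ContMDiffVectorBundle m (EuclideanSpace ℝ (Fin n))
    (TangentSpace (𝓡 n) : M → Type _) (𝓡 n) := ContMDiffVectorBundle.of_le hm
  rw [(chartTriv n p).contMDiffWithinAt_iff
    (by rwa [Trivialization.mem_source])]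
  rw [← contMDiffWithinAt_iff_contDiffWithinAt]
  exact and_iff_right hx

theorem continuousLinearMapAt_chartField (p : M) {q : M} (hq : q ∈ (chartTriv n p).baseSet)
    (w : EuclideanSpace ℝ (Fin n)) :
    (chartTriv n p).continuousLinearMapAt ℝ q (chartField p w q) = w :=
  Trivialization.continuousLinearMapAt_symmL _ hq _

theorem chartField_continuousLinearMapAt (p : M) {q : M} (hq : q ∈ (chartTriv n p).baseSet)
    (u : TangentSpace (𝓡 n) q) :
    chartField p ((chartTriv n p).continuousLinearMapAt ℝ q u) q = u :=
  Trivialization.symmL_continuousLinearMapAt _ hq _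

theorem snd_chartTriv_chartField (p : M) {q : M} (hq : q ∈ (chartTriv n p).baseSet)
    (w : EuclideanSpace ℝ (Fin n)) : (chartTriv n p ⟨q, chartField p w q⟩).2 = w := by
  rw [snd_chartTriv p hq, continuousLinearMapAt_chartField p hq]

theorem chartField_sum (p q : M) (w : EuclideanSpace ℝ (Fin n)) :
    chartField p w q = ∑ i, w i • chartField p (EuclideanSpace.basisFun (Fin n) ℝ i) q := by
  conv_lhs => rw [← (EuclideanSpace.basisFun (Fin n) ℝ).sum_repr w]
  simp [chartField, map_sum, map_smul]

theorem eq_sum_chartField (p : M) {q : M} (hq : q ∈ (chartTriv n p).baseSet)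
    (u : TangentSpace (𝓡 n) q) :
    u = ∑ i, (chartTriv n p ⟨q, u⟩).2 i • chartField p (EuclideanSpace.basisFun (Fin n) ℝ i) q := by
  rw [← chartField_sum, snd_chartTriv p hq]
  exact (chartField_continuousLinearMapAt p hq u).symm

theorem contMDiffAt_chartField (p : M) {q : M} (hq : q ∈ (chartTriv n p).baseSet)
    (w : EuclideanSpace ℝ (Fin n)) :
    ContMDiffAt (𝓡 n) (𝓡 n).tangent ∞
      (fun q : M => (⟨q, chartField p w q⟩ : TangentBundle (𝓡 n) M)) q := by
  rw [(chartTriv n p).contMDiffAt_section_iff hq]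
  refine ContMDiffAt.congr_of_eventuallyEq (f := fun _ => w) contMDiffAt_const ?_
  filter_upwards [(chartTriv n p).open_baseSet.mem_nhds hq] with q hq
  exact snd_chartTriv_chartField p hq w

theorem mdifferentiableAt_chartField (p : M) {q : M} (hq : q ∈ (chartTriv n p).baseSet)
    (w : EuclideanSpace ℝ (Fin n)) :
    MDifferentiableAt (𝓡 n) (𝓡 n).tangent
      (fun q : M => (⟨q, chartField p w q⟩ : TangentBundle (𝓡 n) M)) q :=
  (contMDiffAt_chartField p hq w).mdifferentiableAt (by simp)

theorem eventually_mem_baseSet {p : M} (hx : ContinuousWithinAt x (Icc 0 τ) t)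
    (hp : x t ∈ (chartTriv n p).baseSet) : ∀ᶠ s in 𝓝[Icc 0 τ] t, x s ∈ (chartTriv n p).baseSet :=
  hx ((chartTriv n p).open_baseSet.mem_nhds hp)

theorem SmoothFieldAt.congr_of_eventuallyEq {m : WithTop ℕ∞} (h : SmoothFieldAt m τ x Z t)
    (ht : t ∈ Icc 0 τ) (he : ∀ᶠ s in 𝓝[Icc 0 τ] t, W s = Z s) : SmoothFieldAt m τ x W t :=
  ContMDiffWithinAt.congr_of_eventuallyEq h
    (he.mono fun s hs => congrArg (TotalSpace.mk (x s)) hs) (by rw [he.self_of_nhdsWithin ht])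

theorem diffFieldAt_comp (hx : MDifferentiableWithinAt 𝓘(ℝ, ℝ) (𝓡 n) x (Icc 0 τ) t)
    {σ : ∀ q : M, TangentSpace (𝓡 n) q}
    (hσ : MDifferentiableAt (𝓡 n) (𝓡 n).tangent
      (fun q : M => (⟨q, σ q⟩ : TangentBundle (𝓡 n) M)) (x t)) :
    DiffFieldAt τ x (fun s => σ (x s)) t :=
  MDifferentiableAt.comp_mdifferentiableWithinAt t hσ hx

theorem smoothFieldAt_comp {m : WithTop ℕ∞}
    (hx : ContMDiffWithinAt 𝓘(ℝ, ℝ) (𝓡 n) m x (Icc 0 τ) t)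
    {σ : ∀ q : M, TangentSpace (𝓡 n) q}
    (hσ : ContMDiffAt (𝓡 n) (𝓡 n).tangent m
      (fun q : M => (⟨q, σ q⟩ : TangentBundle (𝓡 n) M)) (x t)) :
    SmoothFieldAt m τ x (fun s => σ (x s)) t :=
  ContMDiffAt.comp_contMDiffWithinAt t hσ hx

/-- Components, in the chart at `p`, of a linear combination with variable coefficients. -/
theorem eventually_snd_chartTriv_sum {ι : Type*} (I : Finset ι) {p : M}
    (hx : ContinuousWithinAt x (Icc 0 τ) t) (hp : x t ∈ (chartTriv n p).baseSet)
    (f : ι → ℝ → ℝ) (Z : ι → ∀ t, TangentSpace (𝓡 n) (x t)) :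
    ∀ᶠ s in 𝓝[Icc 0 τ] t, (chartTriv n p ⟨x s, ∑ i ∈ I, f i s • Z i s⟩).2 =
      ∑ i ∈ I, f i s • (chartTriv n p ⟨x s, Z i s⟩).2 := by
  filter_upwards [eventually_mem_baseSet hx hp] with s hs
  simp [snd_chartTriv p hs, map_sum, map_smul]

theorem DiffFieldAt.sum_smul {ι : Type*} (I : Finset ι)
    (hx : MDifferentiableWithinAt 𝓘(ℝ, ℝ) (𝓡 n) x (Icc 0 τ) t) (ht : t ∈ Icc 0 τ)
    {f : ι → ℝ → ℝ} {Z : ι → ∀ t, TangentSpace (𝓡 n) (x t)}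
    (hf : ∀ i ∈ I, DifferentiableWithinAt ℝ (f i) (Icc 0 τ) t)
    (hZ : ∀ i ∈ I, DiffFieldAt τ x (Z i) t) :
    DiffFieldAt τ x (fun s => ∑ i ∈ I, f i s • Z i s) t := by
  have hp := mem_baseSet_chartTriv (n := n) (x t)
  rw [diffFieldAt_iff hx hp]
  have he := eventually_snd_chartTriv_sum I hx.continuousWithinAt hp f Z
  refine DifferentiableWithinAt.congr_of_eventuallyEq (DifferentiableWithinAt.fun_sum fun i hi =>
    (hf i hi).fun_smul ((diffFieldAt_iff hx hp).1 (hZ i hi))) he (he.self_of_nhdsWithin ht)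

theorem SmoothFieldAt.sum_smul {ι : Type*} (I : Finset ι) {m : WithTop ℕ∞} (hm : m ≤ ∞)
    (hx : ContMDiffWithinAt 𝓘(ℝ, ℝ) (𝓡 n) m x (Icc 0 τ) t) (ht : t ∈ Icc 0 τ)
    {f : ι → ℝ → ℝ} {Z : ι → ∀ t, TangentSpace (𝓡 n) (x t)}
    (hf : ∀ i ∈ I, ContDiffWithinAt ℝ m (f i) (Icc 0 τ) t)
    (hZ : ∀ i ∈ I, SmoothFieldAt m τ x (Z i) t) :
    SmoothFieldAt m τ x (fun s => ∑ i ∈ I, f i s • Z i s) t := by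
  have hp := mem_baseSet_chartTriv (n := n) (x t)
  rw [smoothFieldAt_iff hm hx hp]
  have he := eventually_snd_chartTriv_sum I hx.continuousWithinAt hp f Z
  refine ContDiffWithinAt.congr_of_eventuallyEq (ContDiffWithinAt.sum fun i hi =>
    (hf i hi).smul ((smoothFieldAt_iff hm hx hp).1 (hZ i hi))) he (he.self_of_nhdsWithin ht)

theorem eventually_eq_sum_chartField {p : M} (hx : ContinuousWithinAt x (Icc 0 τ) t)
    (hp : x t ∈ (chartTriv n p).baseSet) (Z : ∀ t, TangentSpace (𝓡 n) (x t)) :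
    ∀ᶠ s in 𝓝[Icc 0 τ] t, Z s = ∑ i, (chartTriv n p ⟨x s, Z s⟩).2 i •
      chartField p (EuclideanSpace.basisFun (Fin n) ℝ i) (x s) := by
  filter_upwards [eventually_mem_baseSet hx hp] with s hs
  exact eq_sum_chartField p hs (Z s)

theorem hasDerivWithinAt_comp_curve {E : Type*} [NormedAddCommGroup E] [NormedSpace ℝ E]
    (hx : MDifferentiableWithinAt 𝓘(ℝ, ℝ) (𝓡 n) x (Icc 0 τ) t) {f : M → E}
    (hf : MDifferentiableAt (𝓡 n) 𝓘(ℝ, E) f (x t)) :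
    HasDerivWithinAt (fun s => f (x s)) (mvfderiv (𝓡 n) f (x t) (velocity n τ x t))
      (Icc 0 τ) t := by
  have h : HasFDerivWithinAt (fun s => f (x s)) ((show ℝ →L[ℝ] E from
      (mfderiv (𝓡 n) 𝓘(ℝ, E) f (x t)).comp (mfderivWithin 𝓘(ℝ, ℝ) (𝓡 n) x (Icc 0 τ) t)))
      (Icc 0 τ) t := hasMFDerivWithinAt_iff_hasFDerivWithinAt.1
    (hf.hasMFDerivAt.comp_hasMFDerivWithinAt t hx.hasMFDerivWithinAt)
  exact h.hasDerivWithinAt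

theorem smoothFieldAt_velocity {m k : WithTop ℕ∞} (hk : m + 1 ≤ k) (hτ : 0 < τ)
    (hx : ContMDiffOn 𝓘(ℝ, ℝ) (𝓡 n) k x (Icc 0 τ)) (ht : t ∈ Icc 0 τ) :
    SmoothFieldAt m τ x (velocity n τ x) t := by
  have h := hx.contMDiffOn_tangentMapWithin hk (uniqueDiffOn_Icc hτ).uniqueMDiffOn
  have h2 : ContMDiffWithinAt 𝓘(ℝ, ℝ) 𝓘(ℝ, ℝ).tangent m
      (fun s : ℝ => (⟨s, (1 : ℝ)⟩ : TangentBundle 𝓘(ℝ, ℝ) ℝ)) (Icc 0 τ) t := by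
    exact contMDiffWithinAt_vectorSpace_iff_contDiffWithinAt (V := fun _ : ℝ => (1 : ℝ)).2
      contDiffWithinAt_const
  exact (h ⟨t, (1 : ℝ)⟩ ht).comp t h2 (fun s hs => hs)

end FieldsAlong

/-! ### The covariant derivative along a curve -/

section CovariantDerivative

variable {n : ℕ} {M : Type*} [TopologicalSpace M] [ChartedSpace (EuclideanSpace ℝ (Fin n)) M]
  [IsManifold (𝓡 n) ∞ M] [RiemannianBundle (fun p : M => TangentSpace (𝓡 n) p)]
  [IsContMDiffRiemannianBundle (𝓡 n) ∞ (EuclideanSpace ℝ (Fin n))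
    (fun p : M => TangentSpace (𝓡 n) p)]
  {τ t : ℝ} {x : ℝ → M} {Z W : ∀ t, TangentSpace (𝓡 n) (x t)}

theorem covDerivAlong_eq (Z : ∀ t, TangentSpace (𝓡 n) (x t)) (t : ℝ) :
    covDerivAlong τ x Z t = (chartTriv n (x t)).symmL ℝ (x t)
      (derivWithin (fun s => (chartTriv n (x t) ⟨x s, Z s⟩).2) (Icc 0 τ) t)
    + christoffel (x t) (velocity n τ x t) (Z t) := by
  rw [covDerivAlong, leviCivita_constField]

theorem covDerivAlong_congr (ht : t ∈ Icc 0 τ) (he : ∀ᶠ s in 𝓝[Icc 0 τ] t, W s = Z s) :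
    covDerivAlong τ x W t = covDerivAlong τ x Z t := by
  rw [covDerivAlong_eq, covDerivAlong_eq, he.self_of_nhdsWithin ht]
  congr 2
  exact Filter.EventuallyEq.derivWithin_eq
    (he.mono fun s hs => congrArg (fun u => (chartTriv n (x t) ⟨x s, u⟩).2) hs)
    (by rw [he.self_of_nhdsWithin ht])

theorem covDerivAlong_sum_smul {ι : Type*} (I : Finset ι) (hτ : 0 < τ)
    (hx : MDifferentiableWithinAt 𝓘(ℝ, ℝ) (𝓡 n) x (Icc 0 τ) t) (ht : t ∈ Icc 0 τ)
    {f : ι → ℝ → ℝ} {Z : ι → ∀ t, TangentSpace (𝓡 n) (x t)} {f' : ι → ℝ}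
    (hf : ∀ i ∈ I, HasDerivWithinAt (f i) (f' i) (Icc 0 τ) t)
    (hZ : ∀ i ∈ I, DiffFieldAt τ x (Z i) t) :
    covDerivAlong τ x (fun s => ∑ i ∈ I, f i s • Z i s) t =
      ∑ i ∈ I, (f' i • Z i t + f i t • covDerivAlong τ x (Z i) t) := by
  have hp := mem_baseSet_chartTriv (n := n) (x t)
  have he := eventually_snd_chartTriv_sum I hx.continuousWithinAt hp f Z
  have hd : HasDerivWithinAt (fun s => ∑ i ∈ I, f i s • (chartTriv n (x t) ⟨x s, Z i s⟩).2)
      (∑ i ∈ I, (f i t • derivWithin (fun s => (chartTriv n (x t) ⟨x s, Z i s⟩).2) (Icc 0 τ) t +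
        f' i • (chartTriv n (x t) ⟨x t, Z i t⟩).2)) (Icc 0 τ) t :=
    HasDerivWithinAt.fun_sum fun i hi => (hf i hi).fun_smul
      ((diffFieldAt_iff hx hp).1 (hZ i hi)).hasDerivWithinAt
  have hd' := (hd.congr_of_eventuallyEq he (he.self_of_nhdsWithin ht)).derivWithin
    (uniqueDiffOn_Icc hτ t ht)
  have hs : ∀ i, (chartTriv n (x t)).symmL ℝ (x t) (chartTriv n (x t) ⟨x t, Z i t⟩).2 = Z i t := by
    intro i
    rw [snd_chartTriv _ hp]
    exact chartField_continuousLinearMapAt _ hp _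
  have hc : christoffel (x t) (velocity n τ x t) (∑ i ∈ I, f i t • Z i t) =
      ∑ i ∈ I, f i t • christoffel (x t) (velocity n τ x t) (Z i t) := by
    let L : TangentSpace (𝓡 n) (x t) →ₗ[ℝ] TangentSpace (𝓡 n) (x t) :=
      { toFun := christoffel (x t) (velocity n τ x t)
        map_add' := christoffel_add_right _ _
        map_smul' := fun c w => christoffel_smul_right _ c _ w }
    change L _ = ∑ i ∈ I, f i t • L _
    simp only [map_sum, map_smul]
  rw [covDerivAlong_eq, hd', hc, map_sum, ← Finset.sum_add_distrib]
  refine Finset.sum_congr rfl fun i _ => ?_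
  rw [covDerivAlong_eq, map_add, map_smul, map_smul, hs i, smul_add]
  abel

/-- The covariant derivative along a curve of the restriction of a vector field on the manifold is
the covariant derivative of that field in the direction of the velocity. -/
theorem covDerivAlong_comp (hτ : 0 < τ)
    (hx : MDifferentiableWithinAt 𝓘(ℝ, ℝ) (𝓡 n) x (Icc 0 τ) t) (ht : t ∈ Icc 0 τ)
    {σ : ∀ q : M, TangentSpace (𝓡 n) q}
    (hσ : MDifferentiableAt (𝓡 n) (𝓡 n).tangent
      (fun q : M => (⟨q, σ q⟩ : TangentBundle (𝓡 n) M)) (x t)) :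
    covDerivAlong τ x (fun s => σ (x s)) t = leviCivita n M σ (x t) (velocity n τ x t) := by
  change _ = leviCivitaAux σ (x t) (velocity n τ x t)
  rw [leviCivitaAux_apply, covDerivAlong_eq]
  rw [mdifferentiableAt_section] at hσ
  rw [(hasDerivWithinAt_comp_curve hx hσ).derivWithin (uniqueDiffOn_Icc hτ t ht)]

theorem hasDerivWithinAt_inner_chartField (hτ : 0 < τ)
    (hx : MDifferentiableWithinAt 𝓘(ℝ, ℝ) (𝓡 n) x (Icc 0 τ) t) (ht : t ∈ Icc 0 τ) {p : M}
    (hp : x t ∈ (chartTriv n p).baseSet) (v w : EuclideanSpace ℝ (Fin n)) :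
    HasDerivWithinAt (fun s => ⟪chartField p v (x s), chartField p w (x s)⟫_ℝ)
      (⟪covDerivAlong τ x (fun s => chartField p v (x s)) t, chartField p w (x t)⟫_ℝ +
        ⟪chartField p v (x t), covDerivAlong τ x (fun s => chartField p w (x s)) t⟫_ℝ)
      (Icc 0 τ) t := by
  have hv := mdifferentiableAt_chartField p hp v
  have hw := mdifferentiableAt_chartField p hp w
  have h := hasDerivWithinAt_comp_curve hx (MDifferentiableAt.inner_bundle (IB := 𝓡 n)
    (F := EuclideanSpace ℝ (Fin n)) (E := fun p : M => TangentSpace (𝓡 n) p) hv hw)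
  convert! h using 1
  rw [covDerivAlong_comp hτ hx ht hv, covDerivAlong_comp hτ hx ht hw]
  have hm := (leviCivita_isMetricCompatible (n := n) (M := M)).mvfderiv_inner_eq
    (constField (x t) (velocity n τ x t)) hv hw
  simp only [constField_self] at hm
  exact hm.symm

/-- The Levi-Civita connection is compatible with the metric along curves. -/
theorem hasDerivWithinAt_inner (hτ : 0 < τ)
    (hx : MDifferentiableWithinAt 𝓘(ℝ, ℝ) (𝓡 n) x (Icc 0 τ) t) (ht : t ∈ Icc 0 τ)
    (hZ : DiffFieldAt τ x Z t) (hW : DiffFieldAt τ x W t) :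
    HasDerivWithinAt (fun s => ⟪Z s, W s⟫_ℝ)
      (⟪covDerivAlong τ x Z t, W t⟫_ℝ + ⟪Z t, covDerivAlong τ x W t⟫_ℝ) (Icc 0 τ) t := by
  have hp := mem_baseSet_chartTriv (n := n) (x t)
  let X : Fin n → ∀ s, TangentSpace (𝓡 n) (x s) := fun i s =>
    chartField (x t) (EuclideanSpace.basisFun (Fin n) ℝ i) (x s)
  have hX : ∀ i, DiffFieldAt τ x (X i) t := fun i =>
    diffFieldAt_comp hx (mdifferentiableAt_chartField (x t) hp _)
  have hXX : ∀ i j, HasDerivWithinAt (fun s => ⟪X i s, X j s⟫_ℝ)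
      (⟪covDerivAlong τ x (X i) t, X j t⟫_ℝ + ⟪X i t, covDerivAlong τ x (X j) t⟫_ℝ)
      (Icc 0 τ) t := fun i j => hasDerivWithinAt_inner_chartField hτ hx ht hp _ _
  have hcoord : ∀ {Y : ∀ t, TangentSpace (𝓡 n) (x t)}, DiffFieldAt τ x Y t →
      ∃ (f : Fin n → ℝ → ℝ) (f' : Fin n → ℝ), (∀ i, HasDerivWithinAt (f i) (f' i) (Icc 0 τ) t) ∧
        ∀ᶠ s in 𝓝[Icc 0 τ] t, Y s = ∑ i, f i s • X i s := fun {Y} hY =>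
    ⟨fun i s => (chartTriv n (x t) ⟨x s, Y s⟩).2 i, _, fun i =>
      ((differentiableWithinAt_piLp 2).1 ((diffFieldAt_iff hx hp).1 hY) i).hasDerivWithinAt,
      eventually_eq_sum_chartField hx.continuousWithinAt hp Y⟩
  obtain ⟨f, f', hf, hfe⟩ := hcoord hZ
  obtain ⟨g, g', hg, hge⟩ := hcoord hW
  have he : ∀ᶠ s in 𝓝[Icc 0 τ] t, ⟪Z s, W s⟫_ℝ =
      ∑ j, ∑ i, g j s * (f i s * ⟪X i s, X j s⟫_ℝ) := by
    filter_upwards [hfe, hge] with s h1 h2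
    rw [h1, h2]
    simp only [sum_inner, inner_sum, real_inner_smul_left, real_inner_smul_right]
  have hd := HasDerivWithinAt.fun_sum (u := Finset.univ) fun j _ =>
    HasDerivWithinAt.fun_sum (u := Finset.univ) fun i _ =>
      (hg j).fun_mul ((hf i).fun_mul (hXX i j))
  refine (hd.congr_of_eventuallyEq he (he.self_of_nhdsWithin ht)).congr_deriv ?_
  rw [covDerivAlong_congr ht hfe, covDerivAlong_congr ht hge,
    covDerivAlong_sum_smul Finset.univ hτ hx ht (fun i _ => hf i) fun i _ => hX i,
    covDerivAlong_sum_smul Finset.univ hτ hx ht (fun i _ => hg i) fun i _ => hX i,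
    hfe.self_of_nhdsWithin ht, hge.self_of_nhdsWithin ht]
  simp only [sum_inner, inner_sum, inner_add_left, inner_add_right, real_inner_smul_left,
    real_inner_smul_right, ← Finset.sum_add_distrib]
  refine Finset.sum_congr rfl fun j _ => Finset.sum_congr rfl fun i _ => ?_
  ring

end CovariantDerivative

/-! ### Linear differential equations -/

section LinearODE

variable {E : Type*} [NormedAddCommGroup E] [NormedSpace ℝ E]

/-- A neighbourhood of `t₀` within `[0, τ]` contains an arbitrarily short nondegenerate interval
around `t₀` that is again such a neighbourhood; `t₀` may be an end point of `[0, τ]`. -/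
theorem exists_Icc_mem_nhdsWithin {τ t₀ : ℝ} (hτ : 0 < τ) (ht₀ : t₀ ∈ Icc 0 τ) {S : Set ℝ}
    (hS : S ∈ 𝓝[Icc 0 τ] t₀) {ε : ℝ} (hε : 0 < ε) :
    ∃ a b, a < b ∧ t₀ ∈ Icc a b ∧ Icc a b ⊆ Icc 0 τ ∩ S ∧ Icc a b ∈ 𝓝[Icc 0 τ] t₀ ∧
      b - t₀ ≤ ε ∧ t₀ - a ≤ ε := by
  obtain ⟨δ, hδ, hδS⟩ := Metric.mem_nhdsWithin_iff.1 hS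
  have hr : 0 < min (δ / 2) ε := lt_min (by linarith) hε
  set r := min (δ / 2) ε with hr_def
  have h1 : r ≤ δ / 2 := min_le_left _ _
  have h2 : r ≤ ε := min_le_right _ _
  obtain ⟨h0, hτ'⟩ := ht₀
  refine ⟨max 0 (t₀ - r), min τ (t₀ + r), ?_, ⟨?_, ?_⟩, ?_, ?_, ?_, ?_⟩
  · rw [max_lt_iff, lt_min_iff, lt_min_iff]
    constructor <;> constructor <;> linarith
  · exact max_le h0 (by linarith)
  · exact le_min hτ' (by linarith)
  · intro s hs
    obtain ⟨hs1, hs2⟩ := hs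
    rw [max_le_iff] at hs1
    rw [le_min_iff] at hs2
    refine ⟨⟨hs1.1, hs2.1⟩, hδS ⟨?_, hs1.1, hs2.1⟩⟩
    rw [Metric.mem_ball, Real.dist_eq, abs_lt]
    constructor <;> linarith
  · rw [mem_nhdsWithin]
    refine ⟨Ioo (t₀ - r) (t₀ + r), isOpen_Ioo, ⟨by linarith, by linarith⟩, ?_⟩
    rintro s ⟨hs, hs'⟩
    exact ⟨max_le hs'.1 hs.1.le, le_min hs'.2 hs.2.le⟩
  · have := min_le_right τ (t₀ + r); linarith
  · have := le_max_right 0 (t₀ - r); linarith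

/-- Local existence of the fundamental solution of a linear differential equation. -/
theorem exists_fundamentalSolution [CompleteSpace E] {τ t₀ : ℝ} (hτ : 0 < τ)
    (ht₀ : t₀ ∈ Icc 0 τ) {L : ℝ → E →L[ℝ] E} {S : Set ℝ} (hS : S ∈ 𝓝[Icc 0 τ] t₀)
    (hL : ContinuousOn L S) :
    ∃ a b, a < b ∧ t₀ ∈ Icc a b ∧ Icc a b ⊆ Icc 0 τ ∩ S ∧ Icc a b ∈ 𝓝[Icc 0 τ] t₀ ∧
      ∃ Φ : ℝ → E →L[ℝ] E, Φ t₀ = 1 ∧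
        ∀ s ∈ Icc a b, HasDerivWithinAt Φ (-(L s * Φ s)) (Icc a b) s := by
  obtain ⟨a₁, b₁, -, -, hsub₁, hmem₁, -, -⟩ := exists_Icc_mem_nhdsWithin hτ ht₀ hS one_pos
  obtain ⟨C, hC⟩ := (isCompact_Icc (a := a₁) (b := b₁)).exists_bound_of_continuousOn
    (hL.mono fun s hs => (hsub₁ hs).2)
  set K : NNReal := C.toNNReal with hK
  have hCK : ∀ s ∈ Icc a₁ b₁, ‖L s‖ ≤ K := fun s hs =>
    (hC s hs).trans (by rw [hK]; exact Real.le_coe_toNNReal C)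
  obtain ⟨a, b, hab, ht, hsub, hmem, hb, ha⟩ := exists_Icc_mem_nhdsWithin hτ ht₀ hmem₁
    -- On the unit ball around `1` the right-hand side is bounded by `2 * K`, so this length keeps
    -- the solution in the ball.
    (ε := 1 / (2 * K + 1)) (by positivity)
  have hsub' : Icc a b ⊆ Icc 0 τ ∩ S := fun s hs => hsub₁ (hsub hs).2
  have hPL : IsPicardLindelof (fun s (A : E →L[ℝ] E) => -(L s * A)) (⟨t₀, ht⟩ : Icc a b)
      (1 : E →L[ℝ] E) 1 0 (2 * K) K := by
    refine ⟨fun s hs => ?_, fun A _ => ?_, fun s hs A hA => ?_, ?_⟩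
    · refine LipschitzOnWith.of_dist_le_mul fun A _ B _ => ?_
      rw [dist_eq_norm, dist_eq_norm]
      have : -(L s * A) - -(L s * B) = -(L s * (A - B)) := by rw [mul_sub]; abel
      rw [this, norm_neg]
      exact (norm_mul_le _ _).trans (by gcongr; exact hCK s (hsub hs).2)
    · exact ((hL.mono fun s hs => (hsub' hs).2).mul continuousOn_const).neg
    · have hA' : ‖A‖ ≤ 2 := by
        have h1 : ‖A - 1‖ ≤ 1 := by simpa [dist_eq_norm] using hA
        have h2 : ‖(1 : E →L[ℝ] E)‖ ≤ 1 := ContinuousLinearMap.norm_id_le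
        calc ‖A‖ = ‖(A - 1) + 1‖ := by rw [sub_add_cancel]
          _ ≤ 2 := (norm_add_le _ _).trans (by linarith)
      rw [norm_neg]
      refine (norm_mul_le _ _).trans ?_
      calc ‖L s‖ * ‖A‖ ≤ K * 2 := by
            gcongr
            exact hCK s (hsub hs).2
        _ = ((2 * K : NNReal) : ℝ) := by push_cast; ring
    · have h3 : max (b - t₀) (t₀ - a) ≤ 1 / (2 * K + 1) := max_le hb ha
      have h4 : (2 * (K : ℝ)) * (1 / (2 * K + 1)) ≤ 1 := by
        rw [mul_one_div, div_le_one (by positivity)]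
        linarith
      push_cast
      calc (2 * (K : ℝ)) * max (b - t₀) (t₀ - a) ≤ (2 * K) * (1 / (2 * K + 1)) := by gcongr
        _ ≤ 1 - 0 := by linarith
  obtain ⟨Φ, hΦ0, hΦ⟩ := hPL.exists_eq_forall_mem_Icc_hasDerivWithinAt₀
  exact ⟨a, b, hab, ht, hsub', hmem, Φ, hΦ0, hΦ⟩

/-- Solutions of a linear differential equation with `C^m` coefficients are `C^m`. -/
theorem contDiffOn_of_linearODE {a b : ℝ} (hab : a < b) {L Φ : ℝ → E →L[ℝ] E} {m : ℕ}
    (hL : ContDiffOn ℝ m L (Icc a b))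
    (hΦ : ∀ s ∈ Icc a b, HasDerivWithinAt Φ (-(L s * Φ s)) (Icc a b) s) :
    ContDiffOn ℝ m Φ (Icc a b) := by
  have hu := uniqueDiffOn_Icc hab
  induction m with
  | zero =>
    rw [Nat.cast_zero, contDiffOn_zero]
    exact fun s hs => (hΦ s hs).continuousWithinAt
  | succ m ih =>
    have h1 := ih (hL.of_le (by exact_mod_cast Nat.le_succ m))
    rw [Nat.cast_succ, contDiffOn_succ_iff_derivWithin hu]
    refine ⟨fun s hs => (hΦ s hs).differentiableWithinAt, by simp, ?_⟩
    refine (((hL.of_le (by exact_mod_cast Nat.le_succ m)).mul h1).neg).congr fun s hs => ?_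
    exact (hΦ s hs).derivWithin (hu s hs)

end LinearODE

/-! ### Coordinate vector fields -/

section Christoffel

variable {n : ℕ} {M : Type*} [TopologicalSpace M] [ChartedSpace (EuclideanSpace ℝ (Fin n)) M]
  [IsManifold (𝓡 n) ∞ M]

/-- Coordinate vector fields are pullbacks of constant vector fields along the chart. -/
theorem chartField_eventuallyEq_mpullback (p : M) {q : M} (hq : q ∈ (chartTriv n p).baseSet)
    (w : EuclideanSpace ℝ (Fin n)) :
    chartField p w =ᶠ[𝓝 q] VectorField.mpullback (𝓡 n) 𝓘(ℝ, EuclideanSpace ℝ (Fin n))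
      (extChartAt (𝓡 n) p) (fun _ => w) := by
  filter_upwards [(chartTriv n p).open_baseSet.mem_nhds hq] with r hr
  have hr' : r ∈ (chartAt (EuclideanSpace ℝ (Fin n)) p).source := by
    simpa using hr
  have hr2 : r ∈ (extChartAt (𝓡 n) p).source := by rwa [extChartAt_source]
  have hinv : (mfderiv (𝓡 n) 𝓘(ℝ, EuclideanSpace ℝ (Fin n)) (extChartAt (𝓡 n) p) r).IsInvertible :=
    isInvertible_mfderiv_extChartAt hr2
  refine hinv.injective (Eq.trans ?_ (hinv.self_apply_inverse w).symm)
  rw [← TangentBundle.continuousLinearMapAt_trivializationAt hr']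
  exact continuousLinearMapAt_chartField p hr w

/-- Coordinate vector fields commute. -/
theorem mlieBracket_chartField (p : M) {q : M} (hq : q ∈ (chartTriv n p).baseSet)
    (v w : EuclideanSpace ℝ (Fin n)) :
    VectorField.mlieBracket (𝓡 n) (chartField p v) (chartField p w) q = 0 := by
  have hq' : q ∈ (chartAt (EuclideanSpace ℝ (Fin n)) p).source := by
    simpa using hq
  have hc : ∀ u : EuclideanSpace ℝ (Fin n), MDifferentiableAt 𝓘(ℝ, EuclideanSpace ℝ (Fin n))
      𝓘(ℝ, EuclideanSpace ℝ (Fin n)).tangent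
      (fun y : EuclideanSpace ℝ (Fin n) => (⟨y, u⟩ :
        TangentBundle 𝓘(ℝ, EuclideanSpace ℝ (Fin n)) (EuclideanSpace ℝ (Fin n))))
      (extChartAt (𝓡 n) p q) := fun u =>
    (contMDiffAt_vectorSpace_iff_contDiffAt (n := 1)
      (V := fun _ : EuclideanSpace ℝ (Fin n) => u)).2 contDiffAt_const
      |>.mdifferentiableAt one_ne_zero
  rw [Filter.EventuallyEq.mlieBracket_vectorField_eq (chartField_eventuallyEq_mpullback p hq v)
    (chartField_eventuallyEq_mpullback p hq w)]
  have hsm : minSmoothness ℝ 2 ≤ (∞ : WithTop ℕ∞) := by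
    rw [minSmoothness_of_isRCLikeNormedField]
    exact WithTop.coe_le_coe.2 (le_top (a := (2 : ℕ∞)))
  have : IsManifold (𝓡 n) (minSmoothness ℝ 2) M := IsManifold.of_le hsm
  rw [← VectorField.mpullback_mlieBracket (n := ∞) (hc v) (hc w)
    (contMDiffAt_extChartAt' hq') hsm]
  rw [VectorField.mpullback_apply]
  have : VectorField.mlieBracket 𝓘(ℝ, EuclideanSpace ℝ (Fin n)) (fun _ => v) (fun _ => w)
      (extChartAt (𝓡 n) p q) = 0 := by
    have h0 : VectorField.lieBracketWithin ℝ (fun _ : EuclideanSpace ℝ (Fin n) => v)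
        (fun _ => w) univ (extChartAt (𝓡 n) p q) = 0 := by
      rw [VectorField.lieBracketWithin_eq, fderivWithin_fun_const, fderivWithin_fun_const]
      simp
    exact (congrFun VectorField.mlieBracketWithin_univ _).symm.trans
      ((congrFun VectorField.mlieBracketWithin_eq_lieBracketWithin _).trans h0)
  rw [this]
  exact map_zero _

theorem contMDiffAt_mvfderiv_chartField (p : M) {q : M} (hq : q ∈ (chartTriv n p).baseSet)
    (v : EuclideanSpace ℝ (Fin n)) {f : M → ℝ}
    (hf : ContMDiffOn (𝓡 n) 𝓘(ℝ, ℝ) ∞ f (chartTriv n p).baseSet) :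
    ContMDiffAt (𝓡 n) 𝓘(ℝ, ℝ) ∞ (fun r => mvfderiv (𝓡 n) f r (chartField p v r)) q := by
  have ho := (chartTriv n p).open_baseSet
  have h := hf.contMDiffOn_tangentMapWithin (m := ∞) (by simp) ho.uniqueMDiffOn
  have h2 : ContMDiffAt 𝓘(ℝ, ℝ).tangent 𝓘(ℝ, ℝ) ∞ (fun a : TangentBundle 𝓘(ℝ, ℝ) ℝ => a.2)
      (tangentMapWithin (𝓡 n) 𝓘(ℝ, ℝ) f (chartTriv n p).baseSet ⟨q, chartField p v q⟩) :=
    (contMDiff_snd_tangentBundle_modelSpace ℝ 𝓘(ℝ, ℝ)).contMDiffAt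
  have h1 : ContMDiffWithinAt (𝓡 n) 𝓘(ℝ, ℝ).tangent ∞
      (fun r => tangentMapWithin (𝓡 n) 𝓘(ℝ, ℝ) f (chartTriv n p).baseSet ⟨r, chartField p v r⟩)
      (chartTriv n p).baseSet q :=
    (h ⟨q, chartField p v q⟩ hq).comp q (contMDiffAt_chartField p hq v).contMDiffWithinAt
      (fun s hs => hs)
  have h3 := (h2.comp_contMDiffWithinAt q h1).contMDiffAt (ho.mem_nhds hq)
  refine h3.congr_of_eventuallyEq ?_
  filter_upwards [ho.mem_nhds hq] with r hr
  have e : mfderivWithin (𝓡 n) 𝓘(ℝ, ℝ) f (chartTriv n p).baseSet r =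
      mfderiv (𝓡 n) 𝓘(ℝ, ℝ) f r := mfderivWithin_of_isOpen ho hr
  exact congrArg (fun L => L (chartField p v r)) e.symm

variable [RiemannianBundle (fun p : M => TangentSpace (𝓡 n) p)]
  [IsContMDiffRiemannianBundle (𝓡 n) ∞ (EuclideanSpace ℝ (Fin n))
    (fun p : M => TangentSpace (𝓡 n) p)]

theorem contMDiffAt_inner_chartField (p : M) {q : M} (hq : q ∈ (chartTriv n p).baseSet)
    (v w : EuclideanSpace ℝ (Fin n)) :
    ContMDiffAt (𝓡 n) 𝓘(ℝ, ℝ) ∞ (fun r => ⟪chartField p v r, chartField p w r⟫_ℝ) q :=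
  ContMDiffAt.inner_bundle (IB := 𝓡 n) (F := EuclideanSpace ℝ (Fin n))
    (E := fun p : M => TangentSpace (𝓡 n) p)
    (contMDiffAt_chartField p hq v) (contMDiffAt_chartField p hq w)

/-- The Levi-Civita connection is torsion-free and coordinate fields commute. -/
theorem leviCivita_chartField_comm (p : M) {q : M} (hq : q ∈ (chartTriv n p).baseSet)
    (v w : EuclideanSpace ℝ (Fin n)) :
    leviCivita n M (chartField p w) q (chartField p v q) =
      leviCivita n M (chartField p v) q (chartField p w q) := by
  have h := CovariantDerivative.torsion_apply (leviCivita n M)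
    (mdifferentiableAt_chartField p hq v) (mdifferentiableAt_chartField p hq w)
  rw [leviCivita_torsion, mlieBracket_chartField p hq, sub_zero] at h
  exact (sub_eq_zero.1 h.symm)

/-- The Koszul formula for coordinate vector fields. -/
theorem inner_leviCivita_chartField (p : M) {q : M} (hq : q ∈ (chartTriv n p).baseSet)
    (u v w : EuclideanSpace ℝ (Fin n)) :
    ⟪leviCivita n M (chartField p v) q (chartField p u q), chartField p w q⟫_ℝ = (1 / 2) *
      (mvfderiv (𝓡 n) (fun r => ⟪chartField p v r, chartField p w r⟫_ℝ) q (chartField p u q)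
      + mvfderiv (𝓡 n) (fun r => ⟪chartField p u r, chartField p w r⟫_ℝ) q (chartField p v q)
      - mvfderiv (𝓡 n) (fun r => ⟪chartField p u r, chartField p v r⟫_ℝ) q
        (chartField p w q)) := by
  have hm := fun a b c => (leviCivita_isMetricCompatible (n := n) (M := M)).mvfderiv_inner_eq
    (chartField p a) (mdifferentiableAt_chartField p hq b) (mdifferentiableAt_chartField p hq c)
  rw [hm, hm, hm]
  beta_reduce
  rw [leviCivita_chartField_comm p hq v u, leviCivita_chartField_comm p hq w u,
    leviCivita_chartField_comm p hq w v,
    real_inner_comm (leviCivita n M (chartField p w) q (chartField p u q)) (chartField p v q)]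
  ring

end Christoffel

/-! ### Smoothness of the connection coefficients -/

section ConnectionCoefficients

variable {n : ℕ} {M : Type*} [TopologicalSpace M] [ChartedSpace (EuclideanSpace ℝ (Fin n)) M]
  [IsManifold (𝓡 n) ∞ M] [RiemannianBundle (fun p : M => TangentSpace (𝓡 n) p)]
  [IsContMDiffRiemannianBundle (𝓡 n) ∞ (EuclideanSpace ℝ (Fin n))
    (fun p : M => TangentSpace (𝓡 n) p)]

/-- The Gram operator at `q` of the coordinate frame of the chart at `p`. -/
def gramOperator (p q : M) : EuclideanSpace ℝ (Fin n) →L[ℝ] EuclideanSpace ℝ (Fin n) :=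
  ∑ i, ∑ j, ⟪chartField p (EuclideanSpace.basisFun (Fin n) ℝ i) q,
    chartField p (EuclideanSpace.basisFun (Fin n) ℝ j) q⟫_ℝ •
    (EuclideanSpace.proj (𝕜 := ℝ) i : EuclideanSpace ℝ (Fin n) →L[ℝ] ℝ).smulRight
      (EuclideanSpace.basisFun (Fin n) ℝ j)

theorem gramOperator_apply (p q : M) (v : EuclideanSpace ℝ (Fin n)) :
    gramOperator p q v = ∑ j, ⟪chartField p v q,
      chartField p (EuclideanSpace.basisFun (Fin n) ℝ j) q⟫_ℝ •
        EuclideanSpace.basisFun (Fin n) ℝ j := by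
  rw [chartField_sum p q v]
  simp only [gramOperator, sum_apply, smul_apply, ContinuousLinearMap.smulRight_apply, sum_inner,
    real_inner_smul_left, Finset.sum_smul, smul_smul]
  rw [Finset.sum_comm]
  refine Finset.sum_congr rfl fun j _ => Finset.sum_congr rfl fun i _ => ?_
  congr 1
  exact mul_comm _ _

theorem inner_gramOperator (p q : M) (v w : EuclideanSpace ℝ (Fin n)) :
    ⟪gramOperator p q v, w⟫_ℝ = ⟪chartField p v q, chartField p w q⟫_ℝ := by
  rw [gramOperator_apply, chartField_sum p q w, sum_inner, inner_sum]
  refine Finset.sum_congr rfl fun j _ => ?_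
  rw [real_inner_smul_left, real_inner_smul_right, EuclideanSpace.basisFun_inner, mul_comm]

/-- On the chart domain the coordinate fields form a frame, so their Gram operator is injective. -/
theorem isUnit_gramOperator (p : M) {q : M} (hq : q ∈ (chartTriv n p).baseSet) :
    IsUnit (gramOperator (n := n) p q) := by
  have hinj : Function.Injective (gramOperator (n := n) p q : EuclideanSpace ℝ (Fin n) →ₗ[ℝ]
      EuclideanSpace ℝ (Fin n)) := by
    rw [← LinearMap.ker_eq_bot, LinearMap.ker_eq_bot']
    intro v hv
    have h : ⟪chartField p v q, chartField p v q⟫_ℝ = 0 := by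
      rw [← inner_gramOperator]
      have : gramOperator (n := n) p q v = 0 := hv
      rw [this, inner_zero_left]
    rw [inner_self_eq_zero] at h
    rw [← continuousLinearMapAt_chartField p hq v, h, map_zero]
  let e := (LinearEquiv.ofInjectiveEndo _ hinj).toContinuousLinearEquiv
  exact ⟨ContinuousLinearEquiv.toUnit e, rfl⟩

/-- A vector field is smooth if its inner products with the coordinate fields are. -/
theorem contMDiffAt_of_inner_chartField (p : M) {q : M} (hq : q ∈ (chartTriv n p).baseSet)
    {Y : ∀ r : M, TangentSpace (𝓡 n) r}
    (hY : ∀ w, ContMDiffAt (𝓡 n) 𝓘(ℝ, ℝ) ∞ (fun r => ⟪Y r, chartField p w r⟫_ℝ) q) :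
    ContMDiffAt (𝓡 n) (𝓡 n).tangent ∞
      (fun r : M => (⟨r, Y r⟩ : TangentBundle (𝓡 n) M)) q := by
  rw [(chartTriv n p).contMDiffAt_section_iff hq]
  have hG : ContMDiffAt (𝓡 n) 𝓘(ℝ, EuclideanSpace ℝ (Fin n) →L[ℝ] EuclideanSpace ℝ (Fin n)) ∞
      (fun r => gramOperator (n := n) p r) q := by
    unfold gramOperator
    exact ContMDiffAt.sum fun i _ => ContMDiffAt.sum fun j _ =>
      (contMDiffAt_inner_chartField p hq _ _).smul contMDiffAt_const
  have hl : ContMDiffAt (𝓡 n) 𝓘(ℝ, EuclideanSpace ℝ (Fin n)) ∞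
      (fun r => ∑ j, ⟪Y r, chartField p (EuclideanSpace.basisFun (Fin n) ℝ j) r⟫_ℝ •
        (EuclideanSpace.basisFun (Fin n) ℝ j)) q :=
    ContMDiffAt.sum fun j _ => (hY _).smul contMDiffAt_const
  have hinv : ContMDiffAt (𝓡 n)
      𝓘(ℝ, EuclideanSpace ℝ (Fin n) →L[ℝ] EuclideanSpace ℝ (Fin n)) ∞
      (fun r => Ring.inverse (gramOperator (n := n) p r)) q := by
    obtain ⟨u, hu⟩ := isUnit_gramOperator p hq
    have h := contDiffAt_ringInverse (n := ∞) ℝ u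
    rw [hu] at h
    exact h.contMDiffAt.comp q hG
  refine (hinv.clm_apply hl).congr_of_eventuallyEq ?_
  filter_upwards [(chartTriv n p).open_baseSet.mem_nhds hq] with r hr
  rw [snd_chartTriv p hr]
  have h1 : gramOperator p r ((chartTriv n p).continuousLinearMapAt ℝ r (Y r)) =
      ∑ j, ⟪Y r, chartField p (EuclideanSpace.basisFun (Fin n) ℝ j) r⟫_ℝ •
        (EuclideanSpace.basisFun (Fin n) ℝ j) := by
    rw [gramOperator_apply, chartField_continuousLinearMapAt p hr]
  rw [← h1, ← mul_apply_eq_comp, Ring.inverse_mul_cancel _ (isUnit_gramOperator p hr)]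
  rfl

/-- The Christoffel symbols of a chart are smooth: the covariant derivatives of coordinate fields
in coordinate directions are smooth vector fields on the whole chart domain. -/
theorem contMDiffAt_leviCivita_chartField (p : M) {q : M} (hq : q ∈ (chartTriv n p).baseSet)
    (u v : EuclideanSpace ℝ (Fin n)) :
    ContMDiffAt (𝓡 n) (𝓡 n).tangent ∞
      (fun r : M => (⟨r, leviCivita n M (chartField p v) r (chartField p u r)⟩ :
        TangentBundle (𝓡 n) M)) q := by
  refine contMDiffAt_of_inner_chartField p hq fun w => ?_
  have hg : ∀ a b : EuclideanSpace ℝ (Fin n), ContMDiffOn (𝓡 n) 𝓘(ℝ, ℝ) ∞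
      (fun r => ⟪chartField p a r, chartField p b r⟫_ℝ) (chartTriv n p).baseSet := fun a b r hr =>
    (contMDiffAt_inner_chartField p hr a b).contMDiffWithinAt
  have h := contMDiffAt_const (c := (1 / 2 : ℝ)).mul
    (((contMDiffAt_mvfderiv_chartField p hq u (hg v w)).add
      (contMDiffAt_mvfderiv_chartField p hq v (hg u w))).sub
      (contMDiffAt_mvfderiv_chartField p hq w (hg u v)))
  refine h.congr_of_eventuallyEq ?_
  filter_upwards [(chartTriv n p).open_baseSet.mem_nhds hq] with r hr
  exact inner_leviCivita_chartField p hr u v w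

variable {τ t : ℝ} {x : ℝ → M}

theorem smoothFieldAt_covDerivAlong_chartField {m : WithTop ℕ∞} (hm : m ≤ ∞)
    (hτ : 0 < τ) (hx : ContMDiffOn 𝓘(ℝ, ℝ) (𝓡 n) (m + 1) x (Icc 0 τ)) (ht : t ∈ Icc 0 τ) {p : M}
    (hp : x t ∈ (chartTriv n p).baseSet) (w : EuclideanSpace ℝ (Fin n)) :
    SmoothFieldAt m τ x (covDerivAlong τ x (fun s => chartField p w (x s))) t := by
  have hxm : ContMDiffWithinAt 𝓘(ℝ, ℝ) (𝓡 n) m x (Icc 0 τ) t := (hx t ht).of_le le_self_add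
  have hv := (smoothFieldAt_iff hm hxm hp).1 (smoothFieldAt_velocity le_rfl hτ hx ht)
  have h := SmoothFieldAt.sum_smul Finset.univ hm hxm ht
    (f := fun i s => (chartTriv n p ⟨x s, velocity n τ x s⟩).2 i)
    (Z := fun i s => leviCivita n M (chartField p w) (x s)
      (chartField p (EuclideanSpace.basisFun (Fin n) ℝ i) (x s)))
    (fun i _ => (contDiffWithinAt_piLp 2).1 hv i)
    (fun i _ => smoothFieldAt_comp hxm
      ((contMDiffAt_leviCivita_chartField p hp _ _).of_le hm))
  refine h.congr_of_eventuallyEq ht ?_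
  filter_upwards [eventually_mem_baseSet hxm.continuousWithinAt hp,
    eventually_eq_sum_chartField hxm.continuousWithinAt hp (velocity n τ x),
    self_mem_nhdsWithin] with s hs hs2 hs3
  rw [covDerivAlong_comp hτ ((hx s hs3).mdifferentiableWithinAt (by simp)) hs3
    (mdifferentiableAt_chartField p hs w)]
  conv_lhs => rw [hs2]
  simp only [map_sum, map_smul]

/-- The connection form along `x` in the chart at `p`: it maps `w` to the components of the
covariant derivative of the field with constant components `w`. -/
def connectionForm (p : M) (τ : ℝ) (x : ℝ → M) (s : ℝ) :
    EuclideanSpace ℝ (Fin n) →L[ℝ] EuclideanSpace ℝ (Fin n) :=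
  ∑ i, (EuclideanSpace.proj (𝕜 := ℝ) i : EuclideanSpace ℝ (Fin n) →L[ℝ] ℝ).smulRight
    (chartTriv n p ⟨x s, covDerivAlong τ x
      (fun s => chartField p (EuclideanSpace.basisFun (Fin n) ℝ i) (x s)) s⟩).2

theorem contDiffWithinAt_connectionForm {m : WithTop ℕ∞} (hm : m ≤ ∞)
    (hτ : 0 < τ) (hx : ContMDiffOn 𝓘(ℝ, ℝ) (𝓡 n) (m + 1) x (Icc 0 τ)) (ht : t ∈ Icc 0 τ) {p : M}
    (hp : x t ∈ (chartTriv n p).baseSet) :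
    ContDiffWithinAt ℝ m (connectionForm (n := n) p τ x) (Icc 0 τ) t := by
  have hxm : ContMDiffWithinAt 𝓘(ℝ, ℝ) (𝓡 n) m x (Icc 0 τ) t := (hx t ht).of_le le_self_add
  unfold connectionForm
  refine ContDiffWithinAt.sum fun i _ => ?_
  have h := (smoothFieldAt_iff hm hxm hp).1
    (smoothFieldAt_covDerivAlong_chartField hm hτ hx ht hp
      (EuclideanSpace.basisFun (Fin n) ℝ i))
  exact contDiffWithinAt_const.smulRight h

/-- A field whose components in a chart solve the linear differential equation given by the
connection form is parallel. -/
theorem covDerivAlong_eq_zero_of_hasDerivWithinAt (hτ : 0 < τ)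
    (hx : MDifferentiableWithinAt 𝓘(ℝ, ℝ) (𝓡 n) x (Icc 0 τ) t) (ht : t ∈ Icc 0 τ) {p : M}
    (hp : x t ∈ (chartTriv n p).baseSet) {z : ℝ → EuclideanSpace ℝ (Fin n)}
    (hz : HasDerivWithinAt z (-(connectionForm p τ x t (z t))) (Icc 0 τ) t) :
    covDerivAlong τ x (fun s => chartField p (z s) (x s)) t = 0 := by
  have he : ∀ᶠ s in 𝓝[Icc 0 τ] t, chartField p (z s) (x s) =
      ∑ i, z s i • chartField p (EuclideanSpace.basisFun (Fin n) ℝ i) (x s) :=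
    Eventually.of_forall fun s => chartField_sum p (x s) (z s)
  have hz' : ∀ i ∈ Finset.univ, HasDerivWithinAt (fun s => z s i)
      (EuclideanSpace.proj (𝕜 := ℝ) i (-(connectionForm p τ x t (z t)))) (Icc 0 τ) t :=
    fun i _ => (EuclideanSpace.proj (𝕜 := ℝ) i).hasFDerivAt.comp_hasDerivWithinAt t hz
  rw [covDerivAlong_congr ht he, covDerivAlong_sum_smul Finset.univ hτ hx ht hz'
    fun i _ => diffFieldAt_comp hx (mdifferentiableAt_chartField p hp _)]
  have h : chartField p (connectionForm p τ x t (z t)) (x t) = ∑ i, z t i • covDerivAlong τ x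
      (fun s => chartField p (EuclideanSpace.basisFun (Fin n) ℝ i) (x s)) t := by
    simp only [connectionForm, sum_apply, ContinuousLinearMap.smulRight_apply]
    simp only [chartField, map_sum, map_smul]
    refine Finset.sum_congr rfl fun i _ => ?_
    congr 1
    rw [snd_chartTriv p hp]
    exact chartField_continuousLinearMapAt p hp _
  have h' : ∑ i, EuclideanSpace.proj (𝕜 := ℝ) i (-(connectionForm p τ x t (z t))) •
      chartField p (EuclideanSpace.basisFun (Fin n) ℝ i) (x t) =
      chartField p (-(connectionForm p τ x t (z t))) (x t) :=
    (chartField_sum p (x t) (-(connectionForm p τ x t (z t)))).symm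
  rw [Finset.sum_add_distrib, h', ← h]
  simp [chartField]

end ConnectionCoefficients

/-! ### Parallel orthonormal frames -/

section ParallelFrame

variable {n : ℕ} {M : Type*} [TopologicalSpace M] [ChartedSpace (EuclideanSpace ℝ (Fin n)) M]
  [IsManifold (𝓡 n) ∞ M] [RiemannianBundle (fun p : M => TangentSpace (𝓡 n) p)]
  [IsContMDiffRiemannianBundle (𝓡 n) ∞ (EuclideanSpace ℝ (Fin n))
    (fun p : M => TangentSpace (𝓡 n) p)]
  {τ t : ℝ} {x : ℝ → M} {Z : ∀ t, TangentSpace (𝓡 n) (x t)} {m : WithTop ℕ∞}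

/-- The orthonormal frame `φ` along `x`, encoded as a family of linear isometries from the model
space to the tangent spaces, is `C^m` and parallel at `t`. -/
def IsParallelFrameAt (m : WithTop ℕ∞) (τ : ℝ) (x : ℝ → M)
    (φ : ∀ t, EuclideanSpace ℝ (Fin n) ≃ₗᵢ[ℝ] TangentSpace (𝓡 n) (x t)) (t : ℝ) : Prop :=
  ∀ w, SmoothFieldAt m τ x (fun s => φ s w) t ∧ covDerivAlong τ x (fun s => φ s w) t = 0

variable {φ ψ : ∀ t, EuclideanSpace ℝ (Fin n) ≃ₗᵢ[ℝ] TangentSpace (𝓡 n) (x t)}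

theorem IsParallelFrameAt.congr_of_eventuallyEq (h : IsParallelFrameAt m τ x φ t)
    (ht : t ∈ Icc 0 τ) (he : ∀ᶠ s in 𝓝[Icc 0 τ] t, ∀ w, ψ s w = φ s w) :
    IsParallelFrameAt m τ x ψ t := fun w =>
  ⟨(h w).1.congr_of_eventuallyEq ht (he.mono fun _ hs => hs w),
    (covDerivAlong_congr ht (he.mono fun _ hs => hs w)).trans (h w).2⟩

theorem IsParallelFrameAt.trans_const (h : IsParallelFrameAt m τ x φ t)
    (A : EuclideanSpace ℝ (Fin n) ≃ₗᵢ[ℝ] EuclideanSpace ℝ (Fin n)) :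
    IsParallelFrameAt m τ x (fun s => A.trans (φ s)) t := fun w => h (A w)

theorem symm_apply_eq_sum {V : Type*} [NormedAddCommGroup V] [InnerProductSpace ℝ V]
    (φ : EuclideanSpace ℝ (Fin n) ≃ₗᵢ[ℝ] V) (u : V) :
    φ.symm u = ∑ i, ⟪φ (EuclideanSpace.basisFun (Fin n) ℝ i), u⟫_ℝ •
      EuclideanSpace.basisFun (Fin n) ℝ i := by
  rw [← (EuclideanSpace.basisFun (Fin n) ℝ).sum_repr' (φ.symm u)]
  refine Finset.sum_congr rfl fun i _ => ?_
  rw [← φ.inner_map_map, φ.apply_symm_apply]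

/-- In a parallel frame, the covariant derivative is the ordinary derivative of the components. -/
theorem IsParallelFrameAt.hasDerivWithinAt_symm (h : IsParallelFrameAt m τ x φ t) (hm : m ≠ 0)
    (hτ : 0 < τ) (hx : MDifferentiableWithinAt 𝓘(ℝ, ℝ) (𝓡 n) x (Icc 0 τ) t) (ht : t ∈ Icc 0 τ)
    (hZ : DiffFieldAt τ x Z t) :
    HasDerivWithinAt (fun s => (φ s).symm (Z s)) ((φ t).symm (covDerivAlong τ x Z t))
      (Icc 0 τ) t := by
  simp only [symm_apply_eq_sum]
  refine HasDerivWithinAt.fun_sum fun i _ => HasDerivWithinAt.smul_const ?_ _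
  have h1 := hasDerivWithinAt_inner hτ hx ht
    ((h (EuclideanSpace.basisFun (Fin n) ℝ i)).1.diffFieldAt hm) hZ
  rw [(h _).2, inner_zero_left, zero_add] at h1
  exact h1

theorem IsParallelFrameAt.contDiffWithinAt_symm (h : IsParallelFrameAt m τ x φ t) (hm : m ≤ ∞)
    (hZ : SmoothFieldAt m τ x Z t) :
    ContDiffWithinAt ℝ m (fun s => (φ s).symm (Z s)) (Icc 0 τ) t := by
  have : IsContMDiffRiemannianBundle (𝓡 n) m (EuclideanSpace ℝ (Fin n))
      (fun p : M => TangentSpace (𝓡 n) p) := IsContMDiffRiemannianBundle.of_le hm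
  simp only [symm_apply_eq_sum]
  refine ContDiffWithinAt.sum fun i _ => ?_
  exact (ContMDiffWithinAt.inner_bundle (IB := 𝓡 n) (F := EuclideanSpace ℝ (Fin n))
    (E := fun p : M => TangentSpace (𝓡 n) p) (h (EuclideanSpace.basisFun (Fin n) ℝ i)).1
    hZ).contDiffWithinAt.smul contDiffWithinAt_const

theorem apply_eq_sum {V : Type*} [NormedAddCommGroup V] [InnerProductSpace ℝ V]
    (φ : EuclideanSpace ℝ (Fin n) ≃ₗᵢ[ℝ] V) (w : EuclideanSpace ℝ (Fin n)) :
    φ w = ∑ i, w i • φ (EuclideanSpace.basisFun (Fin n) ℝ i) := by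
  conv_lhs => rw [← (EuclideanSpace.basisFun (Fin n) ℝ).sum_repr w]
  simp [map_sum, map_smul]

theorem IsParallelFrameAt.diffFieldAt_apply (h : IsParallelFrameAt m τ x φ t) (hm : m ≠ 0)
    (hx : MDifferentiableWithinAt 𝓘(ℝ, ℝ) (𝓡 n) x (Icc 0 τ) t) (ht : t ∈ Icc 0 τ)
    {z : ℝ → EuclideanSpace ℝ (Fin n)} (hz : DifferentiableWithinAt ℝ z (Icc 0 τ) t) :
    DiffFieldAt τ x (fun s => φ s (z s)) t := by
  simp only [fun s => apply_eq_sum (φ s) (z s)]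
  exact DiffFieldAt.sum_smul Finset.univ hx ht (fun i _ => (differentiableWithinAt_piLp 2).1 hz i)
    fun i _ => (h _).1.diffFieldAt hm

theorem IsParallelFrameAt.smoothFieldAt_apply (h : IsParallelFrameAt m τ x φ t) (hm : m ≤ ∞)
    (hx : ContMDiffWithinAt 𝓘(ℝ, ℝ) (𝓡 n) m x (Icc 0 τ) t) (ht : t ∈ Icc 0 τ)
    {z : ℝ → EuclideanSpace ℝ (Fin n)} (hz : ContDiffWithinAt ℝ m z (Icc 0 τ) t) :
    SmoothFieldAt m τ x (fun s => φ s (z s)) t := by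
  simp only [fun s => apply_eq_sum (φ s) (z s)]
  exact SmoothFieldAt.sum_smul Finset.univ hm hx ht (fun i _ => (contDiffWithinAt_piLp 2).1 hz i)
    fun i _ => (h _).1

/-- In a parallel frame, the covariant derivative is the ordinary derivative of the components. -/
theorem IsParallelFrameAt.covDerivAlong_apply (h : IsParallelFrameAt m τ x φ t) (hm : m ≠ 0)
    (hτ : 0 < τ) (hx : MDifferentiableWithinAt 𝓘(ℝ, ℝ) (𝓡 n) x (Icc 0 τ) t) (ht : t ∈ Icc 0 τ)
    {z : ℝ → EuclideanSpace ℝ (Fin n)} (hz : DifferentiableWithinAt ℝ z (Icc 0 τ) t) :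
    covDerivAlong τ x (fun s => φ s (z s)) t = φ t (derivWithin z (Icc 0 τ) t) := by
  have h1 := h.hasDerivWithinAt_symm hm hτ hx ht (h.diffFieldAt_apply hm hx ht hz)
  simp only [LinearIsometryEquiv.symm_apply_apply] at h1
  rw [h1.derivWithin (uniqueDiffOn_Icc hτ t ht), LinearIsometryEquiv.apply_symm_apply]

theorem eq_of_hasDerivWithinAt_zero {E : Type*} [NormedAddCommGroup E] [NormedSpace ℝ E]
    {J : Set ℝ} (hJ : Convex ℝ J) {f : ℝ → E} (hf : ∀ s ∈ J, HasDerivWithinAt f 0 J s) {a b : ℝ}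
    (ha : a ∈ J) (hb : b ∈ J) : f a = f b := by
  have h := hJ.norm_image_sub_le_of_norm_hasDerivWithin_le (C := 0) hf (by simp) hb ha
  rwa [zero_mul, norm_le_zero_iff, sub_eq_zero] at h

theorem exists_isometryEquiv (p : M) :
    Nonempty (EuclideanSpace ℝ (Fin n) ≃ₗᵢ[ℝ] TangentSpace (𝓡 n) p) :=
  ⟨((stdOrthonormalBasis ℝ (TangentSpace (𝓡 n) p)).reindex
    (finCongr (fact_finrank_tangentSpace p).out)).repr.symm⟩

/-- Local existence of parallel orthonormal frames. -/
theorem exists_local_parallelFrame {k : ℕ} (hk : 1 ≤ k) (hτ : 0 < τ)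
    (hx : ContMDiffOn 𝓘(ℝ, ℝ) (𝓡 n) ((k + 1 : ℕ) : WithTop ℕ∞) x (Icc 0 τ))
    (ht : t ∈ Icc 0 τ) :
    ∃ φ : ∀ t, EuclideanSpace ℝ (Fin n) ≃ₗᵢ[ℝ] TangentSpace (𝓡 n) (x t),
      ∀ᶠ s in 𝓝[Icc 0 τ] t, IsParallelFrameAt k τ x φ s := by
  have hk0 : ((k : ℕ) : WithTop ℕ∞) ≠ 0 := by exact_mod_cast (by omega : k ≠ 0)
  have hk1 : ((k : ℕ) : WithTop ℕ∞) ≤ ∞ := by exact_mod_cast le_top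
  have hkk : ((k : ℕ) : WithTop ℕ∞) ≤ ((k + 1 : ℕ) : WithTop ℕ∞) := by
    exact_mod_cast Nat.le_succ k
  have hxd : ∀ s ∈ Icc 0 τ, MDifferentiableWithinAt 𝓘(ℝ, ℝ) (𝓡 n) x (Icc 0 τ) s := fun s hs =>
    (hx s hs).mdifferentiableWithinAt (by exact_mod_cast Nat.succ_ne_zero k)
  set p := x t with hp_def
  set S : Set ℝ := {s | s ∈ Icc 0 τ ∧ x s ∈ (chartTriv n p).baseSet} with hS_def
  have hS : S ∈ 𝓝[Icc 0 τ] t := by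
    filter_upwards [self_mem_nhdsWithin, eventually_mem_baseSet (n := n)
      (hxd t ht).continuousWithinAt (mem_baseSet_chartTriv (x t))] with s h1 h2
    exact ⟨h1, h2⟩
  have hL : ContDiffOn ℝ k (connectionForm (n := n) p τ x) S := fun s hs =>
    (contDiffWithinAt_connectionForm hk1 hτ (by exact_mod_cast hx) hs.1 hs.2).mono fun r hr => hr.1
  obtain ⟨a, b, hab, hta, hsub, hmem, Φ, hΦ0, hΦ⟩ := exists_fundamentalSolution hτ ht hS
    hL.continuousOn
  have hΦs := contDiffOn_of_linearODE hab (hL.mono fun s hs => (hsub hs).2) hΦ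
  have hint : {s | s ∈ Icc a b ∧ Icc a b ∈ 𝓝[Icc 0 τ] s} ∈ 𝓝[Icc 0 τ] t :=
    inter_mem hmem (eventually_eventually_nhdsWithin.2 hmem)
  obtain ⟨a', b', hab', hta', hsub', hmem', -⟩ := exists_Icc_mem_nhdsWithin hτ ht hint one_pos
  obtain ⟨ψ⟩ := exists_isometryEquiv (n := n) p
  set c : EuclideanSpace ℝ (Fin n) → EuclideanSpace ℝ (Fin n) := fun w =>
    (chartTriv n p).continuousLinearMapAt ℝ p (ψ w) with hc
  -- `Φ` is the parallel transport in the chart at `p`.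
  have hE : ∀ s ∈ Icc a' b', ∀ w,
      SmoothFieldAt k τ x (fun r => chartField p (Φ r (c w)) (x r)) s ∧
      covDerivAlong τ x (fun r => chartField p (Φ r (c w)) (x r)) s = 0 := by
    intro s hs w
    obtain ⟨hs0, hs1, hs2⟩ := hsub' hs
    have hsS : x s ∈ (chartTriv n p).baseSet := (hsub hs1).2.2
    constructor
    · rw [smoothFieldAt_iff hk1 ((hx s hs0).of_le hkk) hsS]
      have h1 : ContDiffWithinAt ℝ k (fun r => Φ r (c w)) (Icc 0 τ) s :=
        ((hΦs s hs1).mono_of_mem_nhdsWithin hs2).clm_apply contDiffWithinAt_const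
      refine h1.congr_of_eventuallyEq ?_ (snd_chartTriv_chartField p hsS _)
      filter_upwards [eventually_mem_baseSet (hxd s hs0).continuousWithinAt hsS] with r hr
      exact snd_chartTriv_chartField p hr _
    · refine covDerivAlong_eq_zero_of_hasDerivWithinAt hτ (hxd s hs0) hs0 hsS ?_
      have h1 := ((hΦ s hs1).mono_of_mem_nhdsWithin hs2).clm_apply
        (hasDerivWithinAt_const s (Icc 0 τ) (c w))
      simpa using h1
  -- The metric is parallel, so the frame stays orthonormal.
  have hinner : ∀ s ∈ Icc a' b', ∀ w w', ⟪chartField p (Φ s (c w)) (x s),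
      chartField p (Φ s (c w')) (x s)⟫_ℝ = ⟪w, w'⟫_ℝ := by
    intro s hs w w'
    have h1 : ∀ w, chartField p (Φ t (c w)) (x t) = ψ w := fun w => by
      rw [hΦ0]
      exact chartField_continuousLinearMapAt p (mem_baseSet_chartTriv p) (ψ w)
    have h2 := eq_of_hasDerivWithinAt_zero (convex_Icc a' b')
      (f := fun s => ⟪chartField p (Φ s (c w)) (x s), chartField p (Φ s (c w')) (x s)⟫_ℝ)
      (fun r hr => by
        have hr0 := (hsub' hr).1
        have h3 := hasDerivWithinAt_inner hτ (hxd r hr0) hr0 ((hE r hr w).1.diffFieldAt hk0)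
          ((hE r hr w').1.diffFieldAt hk0)
        rw [(hE r hr w).2, (hE r hr w').2, inner_zero_left, inner_zero_right, add_zero] at h3
        exact h3.mono fun q hq => (hsub' hq).1) hs hta'
    refine h2.trans ?_
    rw [h1, h1]
    exact ψ.inner_map_map w w'
  let li : ∀ s ∈ Icc a' b', EuclideanSpace ℝ (Fin n) →ₗᵢ[ℝ] TangentSpace (𝓡 n) (x s) :=
    fun s hs => LinearMap.isometryOfInner
      (((chartTriv n p).symmL ℝ (x s)).toLinearMap ∘ₗ (Φ s).toLinearMap ∘ₗ
        ((chartTriv n p).continuousLinearMapAt ℝ p).toLinearMap ∘ₗ ψ.toLinearEquiv.toLinearMap)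
      (hinner s hs)
  have hfr : ∀ s, finrank ℝ (EuclideanSpace ℝ (Fin n)) = finrank ℝ (TangentSpace (𝓡 n) (x s)) :=
    fun s => by rw [(fact_finrank_tangentSpace (x s)).out, finrank_euclideanSpace_fin]
  classical
  -- Away from `[a', b']` any isometry will do.
  let φ : ∀ s, EuclideanSpace ℝ (Fin n) ≃ₗᵢ[ℝ] TangentSpace (𝓡 n) (x s) := fun s =>
    if hs : s ∈ Icc a' b' then (li s hs).toLinearIsometryEquiv (hfr s)
    else (exists_isometryEquiv (x s)).some
  have hφ : ∀ s ∈ Icc a' b', ∀ w, φ s w = chartField p (Φ s (c w)) (x s) := by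
    intro s hs w
    simp only [φ, dif_pos hs]
    rfl
  refine ⟨φ, ?_⟩
  filter_upwards [eventually_eventually_nhdsWithin.2 hmem', hmem'] with s hs1 hs2 w
  have he : ∀ᶠ r in 𝓝[Icc 0 τ] s, φ r w = chartField p (Φ r (c w)) (x r) :=
    Filter.Eventually.mono hs1 fun r hr => hφ r hr w
  exact ⟨(hE s hs2 w).1.congr_of_eventuallyEq (hsub' hs2).1 he,
    (covDerivAlong_congr (hsub' hs2).1 he).trans (hE s hs2 w).2⟩

end ParallelFrame

/-! ### Global oriented frames -/

section GlobalFrame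

theorem orientation_map_trans {ι V V' V'' : Type*} [AddCommGroup V] [Module ℝ V] [AddCommGroup V']
    [Module ℝ V'] [AddCommGroup V''] [Module ℝ V''] (e : V ≃ₗ[ℝ] V') (f : V' ≃ₗ[ℝ] V'')
    (o : Orientation ℝ V ι) :
    Orientation.map ι (e.trans f) o = Orientation.map ι f (Orientation.map ι e o) := by
  induction o using Module.Ray.ind with | h g hg => rfl

variable {n : ℕ} {M : Type*} [TopologicalSpace M] [ChartedSpace (EuclideanSpace ℝ (Fin n)) M]
  [IsManifold (𝓡 n) ∞ M] [RiemannianBundle (fun p : M => TangentSpace (𝓡 n) p)]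
  [IsContMDiffRiemannianBundle (𝓡 n) ∞ (EuclideanSpace ℝ (Fin n))
    (fun p : M => TangentSpace (𝓡 n) p)]
  {τ t : ℝ} {x : ℝ → M}
  {φ ψ : ∀ t, EuclideanSpace ℝ (Fin n) ≃ₗᵢ[ℝ] TangentSpace (𝓡 n) (x t)}

/-- A parallel frame that is defined up to time `c` can be continued as long as a parallel frame
exists: there, the two frames differ by a constant isometry. -/
theorem exists_extend_parallelFrame {m : WithTop ℕ∞} (hm : m ≠ 0) (hτ : 0 < τ)
    (hx : MDifferentiableOn 𝓘(ℝ, ℝ) (𝓡 n) x (Icc 0 τ)) {c d : ℝ} (hc : c ∈ Icc 0 τ)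
    (hφ : ∀ s ∈ Icc 0 c, ∀ᶠ r in 𝓝[Icc 0 τ] s, IsParallelFrameAt m τ x φ r)
    (hψ : ∀ s ∈ Icc c d, ∀ᶠ r in 𝓝[Icc 0 τ] s, IsParallelFrameAt m τ x ψ r)
    (hcd : c ≤ d) (hd : d ≤ τ) :
    ∃ χ : ∀ t, EuclideanSpace ℝ (Fin n) ≃ₗᵢ[ℝ] TangentSpace (𝓡 n) (x t),
      ∀ s ∈ Icc 0 d, ∀ᶠ r in 𝓝[Icc 0 τ] s, IsParallelFrameAt m τ x χ r := by
  classical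
  let A : EuclideanSpace ℝ (Fin n) ≃ₗᵢ[ℝ] EuclideanSpace ℝ (Fin n) := (φ c).trans (ψ c).symm
  let χ : ∀ t, EuclideanSpace ℝ (Fin n) ≃ₗᵢ[ℝ] TangentSpace (𝓡 n) (x t) := fun s =>
    if s ≤ c then φ s else A.trans (ψ s)
  obtain ⟨a, b, hab, hcab, hsub, hmem, -⟩ := exists_Icc_mem_nhdsWithin hτ hc
    ((hφ c ⟨hc.1, le_rfl⟩).and (hψ c ⟨le_rfl, hcd⟩)) one_pos
  have hconst : ∀ s ∈ Icc a b, ∀ w, φ s w = A.trans (ψ s) w := by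
    intro s hs w
    have h1 := eq_of_hasDerivWithinAt_zero (convex_Icc a b) (f := fun s => (ψ s).symm (φ s w))
      (fun r hr => by
        obtain ⟨hr0, hr1, hr2⟩ := hsub hr
        have h2 := hr2.hasDerivWithinAt_symm hm hτ (hx r hr0) hr0 ((hr1 w).1.diffFieldAt hm)
        rw [(hr1 w).2, map_zero] at h2
        exact h2.mono fun q hq => (hsub hq).1) hs hcab
    rw [← (ψ s).apply_symm_apply (φ s w)]
    exact congrArg (ψ s) h1
  have hχ1 : ∀ s, s ≤ c ∨ s ∈ Icc a b → ∀ w, χ s w = φ s w := by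
    intro s hs w
    by_cases h : s ≤ c
    · simp only [χ, if_pos h]
    · simp only [χ, if_neg h, hconst s (hs.resolve_left h) w]
  have hχ2 : ∀ s, c < s → ∀ w, χ s w = A.trans (ψ s) w := by
    intro s hs w
    simp only [χ, if_neg hs.not_ge]
  refine ⟨χ, fun s hs => ?_⟩
  have hs0 : s ∈ Icc 0 τ := ⟨hs.1, hs.2.trans hd⟩
  rcases le_or_gt s c with hsc | hsc
  · have he : ∀ᶠ r in 𝓝[Icc 0 τ] s, ∀ w, χ r w = φ r w := by
      rcases hsc.lt_or_eq with h | h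
      · filter_upwards [nhdsWithin_le_nhds (Iio_mem_nhds h)] with r hr
        exact hχ1 r (Or.inl hr.le)
      · rw [h]
        filter_upwards [hmem] with r hr
        exact hχ1 r (Or.inr hr)
    filter_upwards [hφ s ⟨hs.1, hsc⟩, eventually_eventually_nhdsWithin.2 he,
      self_mem_nhdsWithin] with r h1 h2 h3
    exact h1.congr_of_eventuallyEq h3 h2
  · have he : ∀ᶠ r in 𝓝[Icc 0 τ] s, ∀ w, χ r w = A.trans (ψ r) w := by
      filter_upwards [nhdsWithin_le_nhds (Ioi_mem_nhds hsc)] with r hr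
      exact hχ2 r hr
    filter_upwards [hψ s ⟨hsc.le, hs.2⟩, eventually_eventually_nhdsWithin.2 he,
      self_mem_nhdsWithin] with r h1 h2 h3
    exact (h1.trans_const A).congr_of_eventuallyEq h3 h2

/-- A curve carries a parallel orthonormal frame on all of `[0, τ]`: the set of times up to which
one exists is open and closed. -/
theorem exists_parallelFrame {k : ℕ} (hk : 1 ≤ k) (hτ : 0 < τ)
    (hx : ContMDiffOn 𝓘(ℝ, ℝ) (𝓡 n) ((k + 1 : ℕ) : WithTop ℕ∞) x (Icc 0 τ)) :
    ∃ φ : ∀ t, EuclideanSpace ℝ (Fin n) ≃ₗᵢ[ℝ] TangentSpace (𝓡 n) (x t),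
      ∀ t ∈ Icc 0 τ, IsParallelFrameAt k τ x φ t := by
  have hk0 : ((k : ℕ) : WithTop ℕ∞) ≠ 0 := by exact_mod_cast (by omega : k ≠ 0)
  have hxd : MDifferentiableOn 𝓘(ℝ, ℝ) (𝓡 n) x (Icc 0 τ) := fun s hs =>
    (hx s hs).mdifferentiableWithinAt (by exact_mod_cast Nat.succ_ne_zero k)
  set P : ℝ → Prop := fun c =>
    ∃ φ : ∀ t, EuclideanSpace ℝ (Fin n) ≃ₗᵢ[ℝ] TangentSpace (𝓡 n) (x t),
      ∀ s ∈ Icc 0 c, ∀ᶠ r in 𝓝[Icc 0 τ] s, IsParallelFrameAt k τ x φ r with hP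
  have hanti : ∀ c d, c ≤ d → P d → P c := fun c d hcd ⟨φ, hφ⟩ =>
    ⟨φ, fun s hs => hφ s ⟨hs.1, hs.2.trans hcd⟩⟩
  have hlocal : ∀ t ∈ Icc 0 τ, ∀ᶠ s in 𝓝[Icc 0 τ] t, (P t ↔ P s) := by
    intro t ht
    obtain ⟨ψ, hψ⟩ := exists_local_parallelFrame hk hτ hx ht
    obtain ⟨a, b, -, htab, hsub, hmem, -⟩ := exists_Icc_mem_nhdsWithin hτ ht
      (eventually_eventually_nhdsWithin.2 hψ) one_pos
    have hext : ∀ c ∈ Icc a b, ∀ d ∈ Icc a b, c ≤ d → P c → P d := fun c hc d hd hcd ⟨φ, hφ⟩ =>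
      exists_extend_parallelFrame hk0 hτ hxd (hsub hc).1 hφ
        (fun s hs => (hsub ⟨hc.1.trans hs.1, hs.2.trans hd.2⟩).2) hcd (hsub hd).1.2
    filter_upwards [hmem] with s hs
    rcases le_total t s with h | h
    · exact ⟨hext t htab s hs h, hanti t s h⟩
    · exact ⟨hanti s t h, hext s hs t htab h⟩
  have h0 : P 0 := by
    obtain ⟨ψ, hψ⟩ := exists_local_parallelFrame hk hτ hx ⟨le_rfl, hτ.le⟩
    refine ⟨ψ, fun s hs => ?_⟩
    rw [Icc_self, mem_singleton_iff] at hs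
    rwa [hs]
  obtain ⟨φ, hφ⟩ := (isPreconnected_Icc.induction₂ (fun a b => (P a ↔ P b)) hlocal
    (fun _ _ _ _ _ _ h1 h2 => h1.trans h2) (fun _ _ _ _ h => h.symm)
    (left_mem_Icc.2 hτ.le) (right_mem_Icc.2 hτ.le)).1 h0
  exact ⟨φ, fun t ht => (hφ t ht).self_of_nhdsWithin ht⟩

/-- The orientation of the model space `ℝⁿ`. -/
def stdOrientation (n : ℕ) : Orientation ℝ (EuclideanSpace ℝ (Fin n)) (Fin n) :=
  (EuclideanSpace.basisFun (Fin n) ℝ).toBasis.orientation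

theorem card_fin_eq_finrank (n : ℕ) :
    Fintype.card (Fin n) = finrank ℝ (EuclideanSpace ℝ (Fin n)) := by simp

/-- Whether a continuous frame is positively oriented does not change near a given time: in a chart,
the determinant of the frame is continuous and does not vanish. -/
theorem eventually_orientation_iff (o : ManifoldOrientation n M)
    (hx : ContMDiffOn 𝓘(ℝ, ℝ) (𝓡 n) 0 x (Icc 0 τ))
    (ht : t ∈ Icc 0 τ)
    (hφ : ∀ w, SmoothFieldAt 0 τ x (fun s => φ s w) t) :
    ∀ᶠ s in 𝓝[Icc 0 τ] t,
      (Orientation.map (Fin n) (φ t).toLinearEquiv (stdOrientation n) = o.orient (x t) ↔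
      Orientation.map (Fin n) (φ s).toLinearEquiv (stdOrientation n) = o.orient (x s)) := by
  obtain ⟨oE, hoE⟩ := o.locally_constant (x t)
  have hp := mem_baseSet_chartTriv (n := n) (x t)
  -- The frame, read in the chart at `x t`.
  let C : ℝ → EuclideanSpace ℝ (Fin n) →L[ℝ] EuclideanSpace ℝ (Fin n) := fun s =>
    ∑ i, (EuclideanSpace.proj (𝕜 := ℝ) i : EuclideanSpace ℝ (Fin n) →L[ℝ] ℝ).smulRight
      (chartTriv n (x t) ⟨x s, φ s (EuclideanSpace.basisFun (Fin n) ℝ i)⟩).2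
  have hC : ContinuousWithinAt C (Icc 0 τ) t := by
    have h : ContDiffWithinAt ℝ 0 C (Icc 0 τ) t := by
      refine ContDiffWithinAt.sum fun i _ => contDiffWithinAt_const.smulRight ?_
      exact (smoothFieldAt_iff (by simp) (hx t ht) hp).1 (hφ _)
    exact h.continuousWithinAt
  have hdet : ContinuousWithinAt (fun s => (C s).det) (Icc 0 τ) t :=
    (ContinuousLinearMap.continuous_det.continuousAt).comp_continuousWithinAt hC
  have hCe : ∀ s (hs : x s ∈ (chartTriv n (x t)).baseSet), (C s : EuclideanSpace ℝ (Fin n) →ₗ[ℝ] _)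
      = ((φ s).toLinearEquiv.trans
        ((chartTriv n (x t)).continuousLinearEquivAt ℝ (x s) hs).toLinearEquiv :
        EuclideanSpace ℝ (Fin n) →ₗ[ℝ] EuclideanSpace ℝ (Fin n)) := by
    intro s hs
    ext1 w
    have h1 : (chartTriv n (x t)).continuousLinearMapAt ℝ (x s) (φ s w) = C s w := by
      rw [apply_eq_sum (φ s) w]
      simp only [C, sum_apply, ContinuousLinearMap.smulRight_apply, map_sum, map_smul]
      refine Finset.sum_congr rfl fun i _ => ?_
      rw [snd_chartTriv _ hs]
      rfl
    refine h1.symm.trans ?_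
    rw [← snd_chartTriv _ hs]
    rfl
  have hkey : ∀ s (hs : x s ∈ (chartTriv n (x t)).baseSet),
      (∀ hq : x s ∈ (chartTriv n (x t)).baseSet, Orientation.map (Fin n)
        ((chartTriv n (x t)).continuousLinearEquivAt ℝ (x s) hq).toLinearEquiv
        (o.orient (x s)) = oE) →
      (Orientation.map (Fin n) (φ s).toLinearEquiv (stdOrientation n) = o.orient (x s) ↔
        ((0 < (C s).det ∧ stdOrientation n = oE) ∨ ((C s).det < 0 ∧ -stdOrientation n = oE))) ∧
        (C s).det ≠ 0 := by
    intro s hs ho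
    have ho := ho hs
    set e := ((chartTriv n (x t)).continuousLinearEquivAt ℝ (x s) hs).toLinearEquiv with he
    have h2 : (C s).det = LinearMap.det (((φ s).toLinearEquiv.trans e :
        EuclideanSpace ℝ (Fin n) ≃ₗ[ℝ] EuclideanSpace ℝ (Fin n)) :
        EuclideanSpace ℝ (Fin n) →ₗ[ℝ] EuclideanSpace ℝ (Fin n)) := by
      rw [← hCe s hs]
    have hne : (C s).det ≠ 0 := by
      rw [h2, ← LinearEquiv.coe_det]
      exact Units.ne_zero _
    refine ⟨?_, hne⟩
    rw [← (Orientation.map (Fin n) e).injective.eq_iff, ho, ← orientation_map_trans]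
    rcases lt_or_gt_of_ne hne with h | h
    · rw [(Orientation.map_eq_neg_iff_det_neg _ _ (card_fin_eq_finrank n)).2 (h2 ▸ h)]
      simp [h, h.not_gt]
    · rw [(Orientation.map_eq_iff_det_pos _ _ (card_fin_eq_finrank n)).2 (h2 ▸ h)]
      simp [h, h.not_gt]
  have h0 := hkey t hp (hoE.self_of_nhds)
  have hsign : ∀ᶠ s in 𝓝[Icc 0 τ] t, (0 < (C t).det ↔ 0 < (C s).det) ∧
      ((C t).det < 0 ↔ (C s).det < 0) := by
    rcases lt_or_gt_of_ne h0.2 with h | h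
    · filter_upwards [hdet.eventually (Iio_mem_nhds h)] with s hs
      have hs : (C s).det < 0 := hs
      simp [h, hs, h.not_gt, hs.not_gt]
    · filter_upwards [hdet.eventually (Ioi_mem_nhds h)] with s hs
      have hs : 0 < (C s).det := hs
      simp [h, hs, h.not_gt, hs.not_gt]
  filter_upwards [hsign, eventually_mem_baseSet (hx t ht).continuousWithinAt hp,
    (hx t ht).continuousWithinAt.eventually hoE]
    with s h1 h2 h3
  rw [h0.1, (hkey s h2 h3).1, h1.1, h1.2]

/-- The reflection in a hyperplane that contains `W`. -/
theorem exists_isometry_det_neg {W : Submodule ℝ (EuclideanSpace ℝ (Fin n))}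
    (hW : W ≠ ⊤) : ∃ A : EuclideanSpace ℝ (Fin n) ≃ₗᵢ[ℝ] EuclideanSpace ℝ (Fin n),
      LinearMap.det (A.toLinearEquiv : EuclideanSpace ℝ (Fin n) →ₗ[ℝ] _) < 0 ∧
      ∀ w ∈ W, A w = w := by
  obtain ⟨v, hv, hv0⟩ := Submodule.exists_mem_ne_zero_of_ne_bot
    (fun h => hW (Submodule.orthogonal_eq_bot_iff.1 h))
  refine ⟨(ℝ ∙ v)ᗮ.reflection, ?_, fun w hw => ?_⟩
  · have h := (ℝ ∙ v)ᗮ.det_reflection (𝕜 := ℝ)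
    rw [Submodule.orthogonal_orthogonal, finrank_span_singleton hv0] at h
    have h' : LinearMap.det ((ℝ ∙ v)ᗮ.reflection.toLinearEquiv :
        EuclideanSpace ℝ (Fin n) →ₗ[ℝ] EuclideanSpace ℝ (Fin n)) = (-1) ^ 1 := h
    rw [h']
    norm_num
  · refine Submodule.reflection_mem_subspace_eq_self ?_
    rw [Submodule.mem_orthogonal_singleton_iff_inner_right]
    rw [real_inner_comm]
    exact hv w hw

/-- A curve in an oriented Riemannian manifold carries a parallel positively oriented orthonormal
frame. -/
theorem exists_oriented_parallelFrame (o : ManifoldOrientation n M) {k : ℕ} (hk : 1 ≤ k)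
    (hn : 1 ≤ n) (hτ : 0 < τ)
    (hx : ContMDiffOn 𝓘(ℝ, ℝ) (𝓡 n) ((k + 1 : ℕ) : WithTop ℕ∞) x (Icc 0 τ)) :
    ∃ φ : ∀ t, EuclideanSpace ℝ (Fin n) ≃ₗᵢ[ℝ] TangentSpace (𝓡 n) (x t),
      ∀ t ∈ Icc 0 τ, IsParallelFrameAt k τ x φ t ∧
        Orientation.map (Fin n) (φ t).toLinearEquiv (stdOrientation n) = o.orient (x t) := by
  obtain ⟨φ, hφ⟩ := exists_parallelFrame hk hτ hx
  have hglobal : ∀ (ψ : ∀ t, EuclideanSpace ℝ (Fin n) ≃ₗᵢ[ℝ] TangentSpace (𝓡 n) (x t)),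
      (∀ t ∈ Icc 0 τ, IsParallelFrameAt k τ x ψ t) → ∀ t ∈ Icc 0 τ,
      (Orientation.map (Fin n) (ψ 0).toLinearEquiv (stdOrientation n) = o.orient (x 0) ↔
      Orientation.map (Fin n) (ψ t).toLinearEquiv (stdOrientation n) = o.orient (x t)) := by
    intro ψ hψ t ht
    exact isPreconnected_Icc.induction₂ (fun a b =>
      (Orientation.map (Fin n) (ψ a).toLinearEquiv (stdOrientation n) = o.orient (x a) ↔
      Orientation.map (Fin n) (ψ b).toLinearEquiv (stdOrientation n) = o.orient (x b)))
      (fun t ht => eventually_orientation_iff o (hx.of_le (by simp)) ht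
        fun w => (hψ t ht w).1.of_le (by simp))
      (fun _ _ _ _ _ _ h1 h2 => h1.trans h2) (fun _ _ _ _ h => h.symm)
      (left_mem_Icc.2 hτ.le) ht
  by_cases h0 : Orientation.map (Fin n) (φ 0).toLinearEquiv (stdOrientation n) = o.orient (x 0)
  · exact ⟨φ, fun t ht => ⟨hφ t ht, (hglobal φ hφ t ht).1 h0⟩⟩
  · have : Nontrivial (EuclideanSpace ℝ (Fin n)) :=
      Module.nontrivial_of_finrank_pos (R := ℝ) (by simpa using (by omega : 0 < n))
    obtain ⟨A, hA, -⟩ := exists_isometry_det_neg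
      (W := (⊥ : Submodule ℝ (EuclideanSpace ℝ (Fin n)))) bot_ne_top
    have hψ : ∀ t ∈ Icc 0 τ, IsParallelFrameAt k τ x (fun s => A.trans (φ s)) t :=
      fun t ht => (hφ t ht).trans_const A
    refine ⟨fun s => A.trans (φ s), fun t ht => ⟨hψ t ht, (hglobal _ hψ t ht).1 ?_⟩⟩
    have h1 : Orientation.map (Fin n) (A.trans (φ 0)).toLinearEquiv (stdOrientation n) =
        Orientation.map (Fin n) (φ 0).toLinearEquiv
          (Orientation.map (Fin n) A.toLinearEquiv (stdOrientation n)) :=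
      orientation_map_trans A.toLinearEquiv (φ 0).toLinearEquiv (stdOrientation n)
    rw [h1, (Orientation.map_eq_neg_iff_det_neg _ _ (card_fin_eq_finrank n)).2 hA,
      Orientation.map_neg]
    exact (((o.orient (x 0)).eq_or_eq_neg _
      (by rw [(fact_finrank_tangentSpace (x 0)).out, Fintype.card_fin])).resolve_left
        (fun h => h0 h.symm)).symm

end GlobalFrame

/-! ### Frenet theory in a Euclidean space -/

section EuclideanFrenet

variable {E : Type*} [NormedAddCommGroup E] [InnerProductSpace ℝ E]

/-- For a triple `(v, w, κ)` of two curves in `E` and a function, the curve `w' + κ v`. -/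
def curveRemainder (S : Set ℝ) (d : (ℝ → E) × (ℝ → E) × (ℝ → ℝ)) (t : ℝ) : E :=
  derivWithin d.2.1 S t + d.2.2 t • d.1 t

/-- The Frenet data of a curve in a Euclidean space with velocity `u`: the analogue of `frenetData`,
with the covariant derivative replaced by the derivative. -/
def curveFrenetData (S : Set ℝ) (u : ℝ → E) : ℕ → (ℝ → E) × (ℝ → E) × (ℝ → ℝ)
  | 0 => (fun _ => 0, u, fun _ => 0)
  | j + 1 =>
    ((curveFrenetData S u j).2.1,
      fun t => ‖curveRemainder S (curveFrenetData S u j) t‖⁻¹ •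
        curveRemainder S (curveFrenetData S u j) t,
      fun t => ‖curveRemainder S (curveFrenetData S u j) t‖)

/-- The Frenet vectors of a curve with velocity `u`, numbered from `0`. -/
def frenetVector (S : Set ℝ) (u : ℝ → E) (j : ℕ) : ℝ → E := (curveFrenetData S u j).2.1

/-- The unsigned curvatures of a curve with velocity `u`; the first one has number `1`. -/
def curvature (S : Set ℝ) (u : ℝ → E) (j : ℕ) : ℝ → ℝ := (curveFrenetData S u j).2.2

variable {S : Set ℝ} {u : ℝ → E} {t : ℝ} {k : ℕ}

theorem frenetVector_zero : frenetVector S u 0 = u := rfl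

/-- The Frenet equation. It holds without a condition on the curvature, because where the curvature
vanishes, both sides do. -/
theorem curveRemainder_eq_smul (j : ℕ) :
    curveRemainder S (curveFrenetData S u j) t =
      curvature S u (j + 1) t • frenetVector S u (j + 1) t := by
  change _ = ‖curveRemainder S (curveFrenetData S u j) t‖ •
    ‖curveRemainder S (curveFrenetData S u j) t‖⁻¹ • curveRemainder S (curveFrenetData S u j) t
  by_cases h : curveRemainder S (curveFrenetData S u j) t = 0
  · simp [h]
  · rw [smul_inv_smul₀ (norm_ne_zero_iff.2 h)]

theorem derivWithin_frenetVector_zero :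
    derivWithin (frenetVector S u 0) S t = curvature S u 1 t • frenetVector S u 1 t := by
  rw [← curveRemainder_eq_smul]
  simp [curveRemainder, curveFrenetData, frenetVector]

theorem derivWithin_frenetVector_succ (j : ℕ) :
    derivWithin (frenetVector S u (j + 1)) S t =
      curvature S u (j + 2) t • frenetVector S u (j + 2) t -
        curvature S u (j + 1) t • frenetVector S u j t := by
  rw [← curveRemainder_eq_smul, curveRemainder]
  exact (add_sub_cancel_right _ _).symm

theorem norm_frenetVector_succ {j : ℕ} (h : curvature S u (j + 1) t ≠ 0) :
    ‖frenetVector S u (j + 1) t‖ = 1 := by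
  change ‖‖curveRemainder S (curveFrenetData S u j) t‖⁻¹ •
    curveRemainder S (curveFrenetData S u j) t‖ = 1
  rw [norm_smul, norm_inv, norm_norm]
  exact inv_mul_cancel₀ h

/-- The span of the Frenet vectors with numbers up to `j`. -/
def frenetSpan (S : Set ℝ) (u : ℝ → E) (j : ℕ) (t : ℝ) : Submodule ℝ E :=
  Submodule.span ℝ (Set.range fun i : Fin (j + 1) => frenetVector S u i t)

theorem frenetVector_mem_frenetSpan {i j : ℕ} (h : i ≤ j) :
    frenetVector S u i t ∈ frenetSpan S u j t :=
  Submodule.subset_span ⟨⟨i, by omega⟩, rfl⟩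

theorem frenetSpan_mono {i j : ℕ} (h : i ≤ j) : frenetSpan S u i t ≤ frenetSpan S u j t := by
  refine Submodule.span_le.2 ?_
  rintro _ ⟨l, rfl⟩
  exact frenetVector_mem_frenetSpan (by omega)

theorem finrank_frenetSpan_le (j : ℕ) : finrank ℝ (frenetSpan S u j t) ≤ j + 1 :=
  (finrank_range_le_card _).trans_eq (Fintype.card_fin _)

theorem derivWithin_frenetVector_mem {i j : ℕ} (h : i < j) :
    derivWithin (frenetVector S u i) S t ∈ frenetSpan S u j t := by
  rcases i with _ | i
  · rw [derivWithin_frenetVector_zero]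
    exact Submodule.smul_mem _ _ (frenetVector_mem_frenetSpan (by omega))
  · rw [derivWithin_frenetVector_succ]
    exact Submodule.sub_mem _ (Submodule.smul_mem _ _ (frenetVector_mem_frenetSpan (by omega)))
      (Submodule.smul_mem _ _ (frenetVector_mem_frenetSpan (by omega)))

/-- The conditions that make the Frenet vectors with numbers up to `j` of a `C^k` velocity `u`
well behaved: they and the curvatures are smooth, the vectors are orthonormal, and they span the
osculating spaces of the curve. -/
structure IsFrenetUpTo (S : Set ℝ) (u : ℝ → E) (k j : ℕ) : Prop where
  contDiffOn_frenetVector : ∀ i ≤ j, ∀ m : ℕ, i + m ≤ k → ContDiffOn ℝ m (frenetVector S u i) S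
  contDiffOn_curvature : ∀ i ≤ j, ∀ m : ℕ, i + m ≤ k → ContDiffOn ℝ m (curvature S u i) S
  inner_eq : ∀ i ≤ j, ∀ l ≤ j, ∀ t ∈ S,
    ⟪frenetVector S u i t, frenetVector S u l t⟫_ℝ = if i = l then 1 else 0
  curvature_ne_zero : ∀ i < j, ∀ t ∈ S, curvature S u (i + 1) t ≠ 0
  mem_frenetSpan : ∀ i ≤ j, ∀ t ∈ S, iteratedDerivWithin i u S t ∈ frenetSpan S u i t

theorem IsFrenetUpTo.hasDerivWithinAt {j i : ℕ} (h : IsFrenetUpTo S u k j) (hj : j < k)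
    (hi : i ≤ j) (ht : t ∈ S) :
    HasDerivWithinAt (frenetVector S u i) (derivWithin (frenetVector S u i) S t) S t :=
  ((h.contDiffOn_frenetVector i hi 1 (by omega)).differentiableOn
    (by simp) t ht).hasDerivWithinAt

/-- The vector `f_j' + κ_j f_{j-1}` is orthogonal to `f_0, …, f_j`: this follows by differentiating
the orthonormality relations. -/
theorem IsFrenetUpTo.inner_curveRemainder {j i : ℕ} (hS : UniqueDiffOn ℝ S)
    (h : IsFrenetUpTo S u k j) (hj : j < k) (hi : i ≤ j) (ht : t ∈ S) :
    ⟪curveRemainder S (curveFrenetData S u j) t, frenetVector S u i t⟫_ℝ = 0 := by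
  have h1 : ⟪frenetVector S u j t, derivWithin (frenetVector S u i) S t⟫_ℝ +
      ⟪derivWithin (frenetVector S u j) S t, frenetVector S u i t⟫_ℝ = 0 := by
    have h2 := (h.hasDerivWithinAt hj le_rfl ht).inner ℝ (h.hasDerivWithinAt hj hi ht)
    have h3 : HasDerivWithinAt
        (fun s => ⟪frenetVector S u j s, frenetVector S u i s⟫_ℝ) 0 S t :=
      (hasDerivWithinAt_const t S (if j = i then (1 : ℝ) else 0)).congr
        (fun s hs => h.inner_eq j le_rfl i hi s hs) (h.inner_eq j le_rfl i hi t ht)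
    exact (hS t ht).eq_deriv _ h2 h3
  have h4 : derivWithin (frenetVector S u j) S t + curvature S u j t • (curveFrenetData S u j).1 t =
      curveRemainder S (curveFrenetData S u j) t := rfl
  rw [← h4, inner_add_left, real_inner_smul_left]
  rcases hi.lt_or_eq with hij | rfl
  · obtain ⟨j, rfl⟩ : ∃ l, j = l + 1 := ⟨j - 1, by omega⟩
    have h5 : (curveFrenetData S u (j + 1)).1 = frenetVector S u j := rfl
    rw [h5, h.inner_eq j (by omega) i hi t ht]
    have h6 : ⟪frenetVector S u (j + 1) t, derivWithin (frenetVector S u i) S t⟫_ℝ =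
        curvature S u (j + 1) t * if j = i then 1 else 0 := by
      rcases i with _ | i
      · rw [derivWithin_frenetVector_zero, real_inner_smul_right,
          h.inner_eq _ le_rfl 1 (by omega) t ht]
        by_cases hj0 : j = 0
        · subst hj0; simp
        · simp [hj0]
      · rw [derivWithin_frenetVector_succ, inner_sub_right, real_inner_smul_right,
          real_inner_smul_right, h.inner_eq _ le_rfl _ (by omega) t ht,
          h.inner_eq _ le_rfl _ (by omega) t ht]
        rw [if_neg (by omega : ¬ j + 1 = i)]
        by_cases hj0 : j = i + 1
        · subst hj0; simp
        · rw [if_neg (by omega), if_neg hj0]; simp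
    linarith
  · rw [real_inner_comm] at h1
    have h5 : ⟪(curveFrenetData S u i).1 t, frenetVector S u i t⟫_ℝ = 0 := by
      rcases i with _ | i
      · exact inner_zero_left _
      · have h6 : (curveFrenetData S u (i + 1)).1 = frenetVector S u i := rfl
        rw [h6, h.inner_eq i (by omega) (i + 1) le_rfl t ht, if_neg (by omega)]
    rw [h5]
    linarith

/-- An element of the span of the orthonormal Frenet vectors is the sum of its components. -/
theorem IsFrenetUpTo.eq_sum {j i : ℕ} (h : IsFrenetUpTo S u k j) (hi : i ≤ j) (ht : t ∈ S) {w : E}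
    (hw : w ∈ frenetSpan S u i t) :
    w = ∑ l : Fin (i + 1), ⟪frenetVector S u l t, w⟫_ℝ • frenetVector S u l t := by
  have ho : Orthonormal ℝ (fun l : Fin (i + 1) => frenetVector S u l t) := by
    rw [orthonormal_iff_ite]
    intro a b
    rw [h.inner_eq a (by omega) b (by omega) t ht]
    simp [Fin.ext_iff]
  induction hw using Submodule.span_induction with
  | mem w hw =>
    obtain ⟨a, rfl⟩ := hw
    beta_reduce
    simp_rw [orthonormal_iff_ite.1 ho]
    simp
  | zero => simp
  | add v w _ _ hv hw =>
    simp_rw [inner_add_right, add_smul, Finset.sum_add_distrib]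
    rw [← hv, ← hw]
  | smul c v _ hv =>
    simp_rw [real_inner_smul_right, mul_smul, ← Finset.smul_sum]
    rw [← hv]

/-- Differentiating the expansion of a derivative of `u` in the Frenet vectors leads to the span of
one more Frenet vector. -/
theorem IsFrenetUpTo.iteratedDerivWithin_succ_mem {j : ℕ} (hS : UniqueDiffOn ℝ S)
    (hu : ContDiffOn ℝ k u S) (h : IsFrenetUpTo S u k j) (hj : j < k) (ht : t ∈ S) :
    iteratedDerivWithin (j + 1) u S t ∈ frenetSpan S u (j + 1) t := by
  have hd : DifferentiableWithinAt ℝ (iteratedDerivWithin j u S) S t :=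
    hu.differentiableOn_iteratedDerivWithin (by exact_mod_cast hj) hS t ht
  have h1 : HasDerivWithinAt (iteratedDerivWithin j u S) (∑ l : Fin (j + 1),
      (⟪frenetVector S u l t, iteratedDerivWithin j u S t⟫_ℝ •
          derivWithin (frenetVector S u l) S t +
        (⟪frenetVector S u l t, derivWithin (iteratedDerivWithin j u S) S t⟫_ℝ +
          ⟪derivWithin (frenetVector S u l) S t, iteratedDerivWithin j u S t⟫_ℝ) •
          frenetVector S u l t)) S t := by
    refine HasDerivWithinAt.congr (HasDerivWithinAt.fun_sum fun l _ =>
      ((h.hasDerivWithinAt hj (by omega) ht).inner ℝ hd.hasDerivWithinAt).fun_smul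
        (h.hasDerivWithinAt hj (by omega) ht)) (fun s hs => ?_) ?_
    · exact h.eq_sum le_rfl hs (h.mem_frenetSpan j le_rfl s hs)
    · exact h.eq_sum le_rfl ht (h.mem_frenetSpan j le_rfl t ht)
  rw [iteratedDerivWithin_succ, h1.derivWithin (hS t ht)]
  exact Submodule.sum_mem _ fun l _ => Submodule.add_mem _
    (Submodule.smul_mem _ _ (derivWithin_frenetVector_mem (by omega)))
    (Submodule.smul_mem _ _ (frenetVector_mem_frenetSpan (by omega)))

theorem isFrenetUpTo_zero (hu : ContDiffOn ℝ k u S) (hnorm : ∀ t ∈ S, ‖u t‖ = 1) :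
    IsFrenetUpTo S u k 0 where
  contDiffOn_frenetVector i hi m hm := by
    obtain rfl : i = 0 := by omega
    exact hu.of_le (by exact_mod_cast (by omega : m ≤ k))
  contDiffOn_curvature i hi m hm := by
    obtain rfl : i = 0 := by omega
    exact contDiffOn_const
  inner_eq i hi l hl t ht := by
    obtain rfl : i = 0 := by omega
    obtain rfl : l = 0 := by omega
    rw [frenetVector_zero, real_inner_self_eq_norm_sq, hnorm t ht]
    simp
  curvature_ne_zero i hi := by omega
  mem_frenetSpan i hi t ht := by
    obtain rfl : i = 0 := by omega
    exact frenetVector_mem_frenetSpan le_rfl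

/-- The Frenet vectors of a regular curve are well behaved: if the next curvature vanished at some
time, then the osculating space of the next order would be spanned by too few vectors. -/
theorem IsFrenetUpTo.succ {j : ℕ} (hS : UniqueDiffOn ℝ S) (hu : ContDiffOn ℝ k u S)
    (hreg : ∀ t ∈ S, LinearIndependent ℝ (fun i : Fin k => iteratedDerivWithin i u S t))
    (h : IsFrenetUpTo S u k j) (hj : j + 1 < k) : IsFrenetUpTo S u k (j + 1) := by
  have hjk : j < k := by omega
  have hmem : ∀ i ≤ j + 1, ∀ t ∈ S, iteratedDerivWithin i u S t ∈ frenetSpan S u i t := by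
    intro i hi t ht
    rcases hi.lt_or_eq with hi | rfl
    · exact h.mem_frenetSpan i (by omega) t ht
    · exact h.iteratedDerivWithin_succ_mem hS hu hjk ht
  have hne : ∀ t ∈ S, curvature S u (j + 1) t ≠ 0 := by
    intro t ht h0
    have h0' : curveRemainder S (curveFrenetData S u j) t = 0 := by
      rw [curveRemainder_eq_smul, h0, zero_smul]
    have hv : frenetVector S u (j + 1) t = 0 := by
      change ‖curveRemainder S (curveFrenetData S u j) t‖⁻¹ •
        curveRemainder S (curveFrenetData S u j) t = 0
      rw [h0', smul_zero]
    have hle : frenetSpan S u (j + 1) t ≤ frenetSpan S u j t := by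
      refine Submodule.span_le.2 ?_
      rintro _ ⟨⟨i, hi⟩, rfl⟩
      rcases (Nat.lt_succ_iff.1 hi).lt_or_eq with hi | rfl
      · exact frenetVector_mem_frenetSpan (Nat.lt_succ_iff.1 hi)
      · simp only [hv]
        exact Submodule.zero_mem _
    have hli := (hreg t ht).comp (Fin.castLE hj) (Fin.castLE_injective hj)
    have h2 := finrank_span_eq_card hli
    have hle2 : Submodule.span ℝ (Set.range
        ((fun i : Fin k => iteratedDerivWithin i u S t) ∘ Fin.castLE hj)) ≤
        frenetSpan S u j t := by
      refine Submodule.span_le.2 ?_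
      rintro _ ⟨i, rfl⟩
      exact hle (frenetSpan_mono (by simpa using Nat.lt_succ_iff.1 i.2) (hmem i (by omega) t ht))
    have : FiniteDimensional ℝ (frenetSpan S u j t) :=
      FiniteDimensional.span_of_finite ℝ (Set.finite_range _)
    have h3 := Submodule.finrank_mono hle2
    have h4 := finrank_frenetSpan_le (S := S) (u := u) (t := t) j
    rw [h2, Fintype.card_fin] at h3
    omega
  have hrem : ∀ m : ℕ, j + 1 + m ≤ k →
      ContDiffOn ℝ m (curveRemainder S (curveFrenetData S u j)) S := by
    intro m hm
    refine ContDiffOn.add ((h.contDiffOn_frenetVector j le_rfl (m + 1) (by omega)).derivWithin hS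
      (by norm_cast)) ((h.contDiffOn_curvature j le_rfl m (by omega)).smul ?_)
    rcases j with _ | j
    · exact contDiffOn_const
    · exact h.contDiffOn_frenetVector j (by omega) m (by omega)
  have hcurv : ∀ m : ℕ, j + 1 + m ≤ k → ContDiffOn ℝ m (curvature S u (j + 1)) S := fun m hm =>
    (hrem m hm).norm ℝ fun t ht => norm_ne_zero_iff.1 (hne t ht)
  have horth : ∀ i ≤ j, ∀ t ∈ S, ⟪frenetVector S u (j + 1) t, frenetVector S u i t⟫_ℝ = 0 := by
    intro i hi t ht
    have h1 := h.inner_curveRemainder hS hjk hi ht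
    rw [curveRemainder_eq_smul, real_inner_smul_left] at h1
    exact (mul_eq_zero.1 h1).resolve_left (hne t ht)
  refine ⟨?_, ?_, ?_, ?_, hmem⟩
  · intro i hi m hm
    rcases hi.lt_or_eq with hi | rfl
    · exact h.contDiffOn_frenetVector i (by omega) m hm
    · exact ((hcurv m hm).inv hne).smul (hrem m hm)
  · intro i hi m hm
    rcases hi.lt_or_eq with hi | rfl
    · exact h.contDiffOn_curvature i (by omega) m hm
    · exact hcurv m hm
  · intro i hi l hl t ht
    rcases hi.lt_or_eq with hi | rfl <;> rcases hl.lt_or_eq with hl | rfl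
    · exact h.inner_eq i (by omega) l (by omega) t ht
    · rw [real_inner_comm, horth i (by omega) t ht, if_neg (by omega)]
    · rw [horth l (by omega) t ht, if_neg (by omega)]
    · rw [real_inner_self_eq_norm_sq, norm_frenetVector_succ (hne t ht)]
      simp
  · intro i hi t ht
    rcases (Nat.lt_succ_iff.1 hi).lt_or_eq with hi | rfl
    · exact h.curvature_ne_zero i hi t ht
    · exact hne t ht

theorem isFrenetUpTo (hS : UniqueDiffOn ℝ S) (hu : ContDiffOn ℝ k u S)
    (hnorm : ∀ t ∈ S, ‖u t‖ = 1)
    (hreg : ∀ t ∈ S, LinearIndependent ℝ (fun i : Fin k => iteratedDerivWithin i u S t)) :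
    ∀ j < k, IsFrenetUpTo S u k j
  | 0, _ => isFrenetUpTo_zero hu hnorm
  | j + 1, hj => (isFrenetUpTo hS hu hnorm hreg j (by omega)).succ hS hu hreg hj

theorem derivWithin_mem_of_forall_mem {W : Submodule ℝ E} (hW : IsClosed (W : Set E)) {f : ℝ → E}
    (hf : ∀ s ∈ S, f s ∈ W) (t : ℝ) : derivWithin f S t ∈ W := by
  have h := range_derivWithin_subset_closure_span_image f (s := S) (t := S)
    (by rw [inter_self]; exact subset_closure) (mem_range_self t)
  refine closure_minimal ?_ hW h
  refine Submodule.span_le.2 ?_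
  rintro _ ⟨s, hs, rfl⟩
  exact hf s hs

/-- The Frenet vectors stay in any closed subspace that contains the velocity. -/
theorem frenetVector_mem {W : Submodule ℝ E} (hW : IsClosed (W : Set E)) (hu : ∀ s ∈ S, u s ∈ W)
    (j : ℕ) : ∀ s ∈ S, frenetVector S u j s ∈ W := by
  have h : ∀ j, (∀ s ∈ S, (curveFrenetData S u j).1 s ∈ W) ∧
      ∀ s ∈ S, frenetVector S u j s ∈ W := by
    intro j
    induction j with
    | zero => exact ⟨fun s _ => W.zero_mem, hu⟩
    | succ j ih =>
      exact ⟨ih.2, fun s hs => W.smul_mem _ (W.add_mem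
        (derivWithin_mem_of_forall_mem hW ih.2 s) (W.smul_mem _ (ih.1 s hs)))⟩
  exact (h j).2

/-- If the velocity stays in a subspace of dimension `j + 1`, then the curvature after `j` nonzero
ones vanishes. -/
theorem IsFrenetUpTo.curvature_succ_eq_zero {j : ℕ} (hS : UniqueDiffOn ℝ S)
    (h : IsFrenetUpTo S u k j) (hj : j < k) {W : Submodule ℝ E} [FiniteDimensional ℝ W]
    (hu : ∀ s ∈ S, u s ∈ W) (hW : finrank ℝ W ≤ j + 1) (ht : t ∈ S) :
    curvature S u (j + 1) t = 0 := by
  have hWc : IsClosed (W : Set E) := W.closed_of_finiteDimensional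
  have hspan : frenetSpan S u j t = W := by
    refine Submodule.eq_of_le_of_finrank_le ?_ ?_
    · refine Submodule.span_le.2 ?_
      rintro _ ⟨i, rfl⟩
      exact frenetVector_mem hWc hu i t ht
    · have ho : Orthonormal ℝ (fun l : Fin (j + 1) => frenetVector S u l t) := by
        rw [orthonormal_iff_ite]
        intro a b
        rw [h.inner_eq a (by omega) b (by omega) t ht]
        simp [Fin.ext_iff]
      rw [frenetSpan, finrank_span_eq_card ho.linearIndependent, Fintype.card_fin]
      exact hW
  have hmem : curveRemainder S (curveFrenetData S u j) t ∈ frenetSpan S u j t := by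
    rw [curveRemainder_eq_smul, hspan]
    exact W.smul_mem _ (frenetVector_mem hWc hu _ t ht)
  have h0 : curveRemainder S (curveFrenetData S u j) t = 0 := by
    rw [h.eq_sum le_rfl ht hmem]
    refine Finset.sum_eq_zero fun l _ => ?_
    rw [real_inner_comm, h.inner_curveRemainder hS hj (by omega) ht, zero_smul]
  exact norm_eq_zero.2 h0

/-- Two curves with the same curvatures whose Frenet vectors agree at one time up to an isometry
differ by this isometry: the sum of the squared distances of corresponding Frenet vectors is
constant, because the matrix of the Frenet equations is antisymmetric. -/
theorem eq_of_curvature_eq {E' : Type*} [NormedAddCommGroup E'] [InnerProductSpace ℝ E']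
    (hconv : Convex ℝ S) {u' : ℝ → E'} (A : E ≃ₗᵢ[ℝ] E') {j : ℕ}
    (hj : j < k) (h : IsFrenetUpTo S u k j) (h' : IsFrenetUpTo S u' k j)
    (hκ : ∀ i ≤ j, ∀ t ∈ S, curvature S u i t = curvature S u' i t)
    (h0 : ∀ t ∈ S, curvature S u (j + 1) t = 0) (h0' : ∀ t ∈ S, curvature S u' (j + 1) t = 0)
    {a : ℝ} (ha : a ∈ S) (hA : ∀ i ≤ j, A (frenetVector S u i a) = frenetVector S u' i a)
    (ht : t ∈ S) : A (u t) = u' t := by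
  let D : ℕ → ℝ → E' := fun i s => A (frenetVector S u i s) - frenetVector S u' i s
  -- The sum of the `⟪D i, D i⟫ / 2` has the derivative `∑ (c (i + 1) - c i)`, which telescopes.
  let c : ℝ → ℕ → ℝ := fun s i => Nat.casesOn i 0
    fun i => curvature S u (i + 1) s * ⟪D (i + 1) s, D i s⟫_ℝ
  have hD : ∀ i ≤ j, ∀ s ∈ S, HasDerivWithinAt (D i)
      (A (derivWithin (frenetVector S u i) S s) - derivWithin (frenetVector S u' i) S s) S s :=
    fun i hi s hs => ((A.toContinuousLinearEquiv.hasFDerivAt.comp_hasDerivWithinAt s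
      (h.hasDerivWithinAt hj hi hs)).sub (h'.hasDerivWithinAt hj hi hs))
  have hκ' : ∀ i ≤ j + 1, ∀ s ∈ S, curvature S u i s = curvature S u' i s := by
    intro i hi s hs
    rcases hi.lt_or_eq with hi | rfl
    · exact hκ i (by omega) s hs
    · rw [h0 s hs, h0' s hs]
  have hc : ∀ i ≤ j, ∀ s ∈ S, ⟪D i s, A (derivWithin (frenetVector S u i) S s) -
      derivWithin (frenetVector S u' i) S s⟫_ℝ = c s (i + 1) - c s i := by
    intro i hi s hs
    rcases i with _ | i
    · have h1 : A (derivWithin (frenetVector S u 0) S s) - derivWithin (frenetVector S u' 0) S s =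
          curvature S u 1 s • D 1 s := by
        rw [derivWithin_frenetVector_zero, derivWithin_frenetVector_zero,
          ← hκ' 1 (by omega) s hs, map_smul, ← smul_sub]
      rw [h1, real_inner_smul_right, real_inner_comm]
      simp [c]
    · have h1 : A (derivWithin (frenetVector S u (i + 1)) S s) -
          derivWithin (frenetVector S u' (i + 1)) S s =
          curvature S u (i + 2) s • D (i + 2) s - curvature S u (i + 1) s • D i s := by
        rw [derivWithin_frenetVector_succ, derivWithin_frenetVector_succ,
          ← hκ' (i + 2) (by omega) s hs, ← hκ' (i + 1) (by omega) s hs, map_sub, map_smul,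
          map_smul]
        simp only [D, smul_sub]
        abel
      rw [h1, inner_sub_right, real_inner_smul_right, real_inner_smul_right,
        real_inner_comm (D (i + 2) s)]
  have hsum : ∀ s ∈ S, HasDerivWithinAt (fun s => ∑ i ∈ Finset.range (j + 1), ⟪D i s, D i s⟫_ℝ)
      0 S s := by
    intro s hs
    have h1 := HasDerivWithinAt.fun_sum (u := Finset.range (j + 1)) fun i hi =>
      (hD i (by simpa [Nat.lt_succ_iff] using hi) s hs).inner ℝ
        (hD i (by simpa [Nat.lt_succ_iff] using hi) s hs)
    have h2 : ∀ i ∈ Finset.range (j + 1),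
        ⟪D i s, A (derivWithin (frenetVector S u i) S s) -
          derivWithin (frenetVector S u' i) S s⟫_ℝ +
        ⟪A (derivWithin (frenetVector S u i) S s) -
          derivWithin (frenetVector S u' i) S s, D i s⟫_ℝ = 2 * (c s (i + 1) - c s i) := by
      intro i hi
      rw [real_inner_comm (D i s), hc i (by simpa [Nat.lt_succ_iff] using hi) s hs]
      ring
    refine h1.congr_deriv ?_
    rw [Finset.sum_congr rfl h2, ← Finset.mul_sum, Finset.sum_range_sub]
    simp [c, h0 s hs]
  have h1 := eq_of_hasDerivWithinAt_zero hconv hsum ht ha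
  have h2 : ∑ i ∈ Finset.range (j + 1), ⟪D i a, D i a⟫_ℝ = 0 := by
    refine Finset.sum_eq_zero fun i hi => ?_
    have h3 : D i a = 0 := sub_eq_zero.2 (hA i (by simpa [Nat.lt_succ_iff] using hi))
    rw [h3, inner_zero_left]
  have h3 := (Finset.sum_eq_zero_iff_of_nonneg fun i _ => real_inner_self_nonneg).1
    (h1.trans h2) 0 (by simp)
  exact sub_eq_zero.1 (inner_self_eq_zero.1 h3)

/-- Isometries preserve the Frenet data. -/
theorem curveFrenetData_comp {E' : Type*} [NormedAddCommGroup E'] [InnerProductSpace ℝ E']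
    (A : E ≃ₗᵢ[ℝ] E') {u' : ℝ → E'} (hA : ∀ t ∈ S, u' t = A (u t)) (j : ℕ) :
    (∀ t ∈ S, (curveFrenetData S u' j).1 t = A ((curveFrenetData S u j).1 t)) ∧
    (∀ t ∈ S, frenetVector S u' j t = A (frenetVector S u j t)) ∧
    (∀ t ∈ S, curvature S u' j t = curvature S u j t) ∧
    (∀ t ∈ S, curveRemainder S (curveFrenetData S u' j) t =
      A (curveRemainder S (curveFrenetData S u j) t)) := by
  have hrem : ∀ j, (∀ t ∈ S, (curveFrenetData S u' j).1 t = A ((curveFrenetData S u j).1 t)) →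
      (∀ t ∈ S, frenetVector S u' j t = A (frenetVector S u j t)) →
      (∀ t ∈ S, curvature S u' j t = curvature S u j t) →
      (∀ t ∈ S, curveRemainder S (curveFrenetData S u' j) t =
        A (curveRemainder S (curveFrenetData S u j) t)) := by
    intro j h1 h2 h3 t ht
    have h4 : derivWithin (frenetVector S u' j) S t = A (derivWithin (frenetVector S u j) S t) := by
      rw [derivWithin_congr h2 (h2 t ht)]
      by_cases hu : UniqueDiffWithinAt ℝ S t
      · exact congrArg (fun L : ℝ →L[ℝ] E' => L 1)
          (A.toContinuousLinearEquiv.comp_fderivWithin (f := frenetVector S u j) hu)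
      · rw [derivWithin_zero_of_not_uniqueDiffWithinAt hu,
          derivWithin_zero_of_not_uniqueDiffWithinAt hu, map_zero]
    change derivWithin (frenetVector S u' j) S t +
      curvature S u' j t • (curveFrenetData S u' j).1 t = A (derivWithin (frenetVector S u j) S t +
      curvature S u j t • (curveFrenetData S u j).1 t)
    rw [h4, h3 t ht, h1 t ht, map_add, map_smul]
  induction j with
  | zero =>
    have h1 : ∀ t ∈ S, (curveFrenetData S u' 0).1 t = A ((curveFrenetData S u 0).1 t) :=
      fun t _ => (map_zero A).symm
    have h3 : ∀ t ∈ S, curvature S u' 0 t = curvature S u 0 t := fun t _ => rfl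
    exact ⟨h1, hA, h3, hrem 0 h1 hA h3⟩
  | succ j ih =>
    obtain ⟨-, h2, -, h4⟩ := ih
    have h6 : ∀ t ∈ S, curvature S u' (j + 1) t = curvature S u (j + 1) t := by
      intro t ht
      change ‖curveRemainder S (curveFrenetData S u' j) t‖ = ‖curveRemainder S _ t‖
      rw [h4 t ht, A.norm_map]
    have h5 : ∀ t ∈ S, frenetVector S u' (j + 1) t = A (frenetVector S u (j + 1) t) := by
      intro t ht
      change ‖curveRemainder S (curveFrenetData S u' j) t‖⁻¹ •
        curveRemainder S (curveFrenetData S u' j) t = A (‖curveRemainder S _ t‖⁻¹ •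
          curveRemainder S _ t)
      rw [h4 t ht, A.norm_map, map_smul]
    exact ⟨h2, h5, h6, hrem (j + 1) h2 h5 h6⟩

end EuclideanFrenet

/-! ### Congruence of curves in a Euclidean space -/

section Congruence

variable {n : ℕ} {S : Set ℝ} {u u' : ℝ → EuclideanSpace ℝ (Fin n)} {t : ℝ} {k : ℕ}

instance fact_finrank_euclideanSpace :
    Fact (finrank ℝ (EuclideanSpace ℝ (Fin n)) = n) :=
  ⟨finrank_euclideanSpace_fin⟩

/-- The geodesic curvatures of a curve in `ℝⁿ` with velocity `u`; the last one is signed. -/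
def signedCurvature (S : Set ℝ) (u : ℝ → EuclideanSpace ℝ (Fin n)) (j : ℕ) (t : ℝ) : ℝ :=
  if j + 1 = n then (stdOrientation n).volumeForm (fun i : Fin n =>
    if i.val + 1 < n then frenetVector S u i t
    else curveRemainder S (curveFrenetData S u (j - 1)) t)
  else curvature S u j t

/-- The last curvature is the unsigned one times the sign of the orientation of the Frenet frame. -/
theorem signedCurvature_last {j : ℕ} (hj : 1 ≤ j) (hn : j + 1 = n) :
    signedCurvature S u j t =
      curvature S u j t *
        (stdOrientation n).volumeForm (fun i : Fin n => frenetVector S u i t) := by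
  let l : Fin n := ⟨j, by omega⟩
  have h1 : (fun i : Fin n => if i.val + 1 < n then frenetVector S u i t
      else curveRemainder S (curveFrenetData S u (j - 1)) t) =
      Function.update (fun i : Fin n => frenetVector S u i t) l
        (curvature S u j t • frenetVector S u l t) := by
    funext i
    by_cases hi : i = l
    · rw [hi, Function.update_self, if_neg (by simp [l, hn]), curveRemainder_eq_smul,
        Nat.sub_add_cancel hj]
    · have : i.val ≠ j := fun h => hi (Fin.ext h)
      rw [Function.update_of_ne hi, if_pos (by omega)]
  rw [signedCurvature, if_pos hn, h1, AlternatingMap.map_update_smul, Function.update_eq_self,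
    smul_eq_mul]

theorem IsFrenetUpTo.exists_orthonormalBasis {j : ℕ} (h : IsFrenetUpTo S u k j) (ht : t ∈ S) :
    ∃ b : OrthonormalBasis (Fin n) ℝ (EuclideanSpace ℝ (Fin n)),
      ∀ i : Fin n, i.val ≤ j → b i = frenetVector S u i t := by
  have ho : Orthonormal ℝ (({i | i.val ≤ j} : Set (Fin n)).domRestrict
      fun i : Fin n => frenetVector S u i t) := by
    rw [orthonormal_iff_ite]
    rintro ⟨a, ha⟩ ⟨b, hb⟩
    simp only [Set.domRestrict_apply, h.inner_eq a ha b hb t ht, Subtype.mk.injEq, Fin.ext_iff]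
  exact ho.exists_orthonormalBasis_extension_of_card_eq (card_fin_eq_finrank n).symm

theorem IsFrenetUpTo.abs_volumeForm {j : ℕ} (h : IsFrenetUpTo S u k j) (hn : j + 1 = n)
    (ht : t ∈ S) :
    |(stdOrientation n).volumeForm (fun i : Fin n => frenetVector S u i t)| = 1 := by
  obtain ⟨b, hb⟩ := h.exists_orthonormalBasis ht
  rw [← (stdOrientation n).abs_volumeForm_apply_of_orthonormal b]
  congr 2
  funext i
  exact (hb i (by omega)).symm

/-- An isometry of `ℝⁿ` of negative determinant changes the sign of the volume form. -/
theorem volumeForm_comp_of_det_neg (A : EuclideanSpace ℝ (Fin n) ≃ₗᵢ[ℝ] EuclideanSpace ℝ (Fin n))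
    (hA : LinearMap.det (A.toLinearEquiv : EuclideanSpace ℝ (Fin n) →ₗ[ℝ] _) < 0)
    (v : Fin n → EuclideanSpace ℝ (Fin n)) :
    (stdOrientation n).volumeForm (A ∘ v) = -(stdOrientation n).volumeForm v := by
  have h1 := (stdOrientation n).volumeForm_map A (A ∘ v)
  rw [(Orientation.map_eq_neg_iff_det_neg _ _ (card_fin_eq_finrank n)).2 hA,
    Orientation.volumeForm_neg_orientation] at h1
  have h2 : A.symm ∘ A ∘ v = v := by
    funext i
    exact A.symm_apply_apply _
  rw [h2] at h1
  rw [← h1]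
  simp

theorem signedCurvature_comp (A : EuclideanSpace ℝ (Fin n) ≃ₗᵢ[ℝ] EuclideanSpace ℝ (Fin n))
    (hA : 0 < LinearMap.det (A.toLinearEquiv : EuclideanSpace ℝ (Fin n) →ₗ[ℝ] _))
    (hu : ∀ t ∈ S, u' t = A (u t)) (j : ℕ) (ht : t ∈ S) :
    signedCurvature S u' j t = signedCurvature S u j t := by
  have h := fun j => curveFrenetData_comp A hu j
  unfold signedCurvature
  split_ifs with hj
  · refine Eq.trans ?_ ((stdOrientation n).volumeForm_comp_linearIsometryEquiv A hA _)
    congr 1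
    funext i
    simp only [Function.comp_apply]
    split_ifs
    · exact (h i).2.1 t ht
    · exact (h (j - 1)).2.2.2 t ht
  · exact (h j).2.2.1 t ht

/-- The isometries of `ℝⁿ` act transitively on the Frenet frames, and those that preserve the
orientation do so whenever the frames have the same orientation or are incomplete. -/
theorem exists_isometry_frenetVector {j : ℕ} (h : IsFrenetUpTo S u k j)
    (h' : IsFrenetUpTo S u' k j) (ht : t ∈ S)
    (hvol : j + 1 = n → (stdOrientation n).volumeForm (fun i : Fin n => frenetVector S u i t) =
      (stdOrientation n).volumeForm (fun i : Fin n => frenetVector S u' i t)) (hj : j < n) :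
    ∃ A : EuclideanSpace ℝ (Fin n) ≃ₗᵢ[ℝ] EuclideanSpace ℝ (Fin n),
      0 < LinearMap.det (A.toLinearEquiv : EuclideanSpace ℝ (Fin n) →ₗ[ℝ] _) ∧
      ∀ i ≤ j, A (frenetVector S u i t) = frenetVector S u' i t := by
  obtain ⟨b, hb⟩ := h.exists_orthonormalBasis ht
  obtain ⟨b', hb'⟩ := h'.exists_orthonormalBasis ht
  let A : EuclideanSpace ℝ (Fin n) ≃ₗᵢ[ℝ] EuclideanSpace ℝ (Fin n) := b.equiv b' (Equiv.refl _)
  have hA : ∀ i ≤ j, A (frenetVector S u i t) = frenetVector S u' i t := by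
    intro i hi
    have h1 := hb ⟨i, by omega⟩ hi
    have h2 := hb' ⟨i, by omega⟩ hi
    simp only at h1 h2
    rw [← h1, ← h2]
    exact b.equiv_apply_basis b' (Equiv.refl _) _
  have hdet : LinearMap.det (A.toLinearEquiv : EuclideanSpace ℝ (Fin n) →ₗ[ℝ] _) ≠ 0 := by
    rw [← LinearEquiv.coe_det]
    exact Units.ne_zero _
  rcases hdet.lt_or_gt with hneg | hpos
  · rcases (by omega : j + 1 = n ∨ j + 1 < n) with hn | hn
    · exfalso
      have h1 := volumeForm_comp_of_det_neg A hneg fun i : Fin n => frenetVector S u i t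
      have h2 : (A ∘ fun i : Fin n => frenetVector S u i t) =
          fun i : Fin n => frenetVector S u' i t := by
        funext i
        exact hA i (by omega)
      rw [h2, ← hvol hn] at h1
      have h3 := h.abs_volumeForm hn ht
      rw [self_eq_neg.1 h1, abs_zero] at h3
      exact zero_ne_one h3
    -- An incomplete frame is fixed by a reflection, which corrects the sign of the determinant.
    · have hW : frenetSpan S u' j t ≠ ⊤ := by
        intro htop
        have h1 := finrank_frenetSpan_le (S := S) (u := u') (t := t) j
        rw [htop, finrank_top, ← card_fin_eq_finrank, Fintype.card_fin] at h1
        omega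
      obtain ⟨B, hB, hBW⟩ := exists_isometry_det_neg hW
      refine ⟨A.trans B, ?_, fun i hi => ?_⟩
      · have h1 : ((A.trans B).toLinearEquiv :
            EuclideanSpace ℝ (Fin n) →ₗ[ℝ] EuclideanSpace ℝ (Fin n)) =
            (B.toLinearEquiv : EuclideanSpace ℝ (Fin n) →ₗ[ℝ] EuclideanSpace ℝ (Fin n)) ∘ₗ
            (A.toLinearEquiv : EuclideanSpace ℝ (Fin n) →ₗ[ℝ] EuclideanSpace ℝ (Fin n)) := rfl
        rw [h1, LinearMap.det_comp]
        exact mul_pos_of_neg_of_neg hB hneg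
      · change B (A _) = _
        rw [hA i hi]
        exact hBW _ (frenetVector_mem_frenetSpan hi)
  · exact ⟨A, hpos, hA⟩

/-- The congruence theorem for curves in `ℝⁿ` that span a subspace of dimension `k`: such a curve is
determined, up to an orientation-preserving isometry, by its curvatures. -/
theorem exists_isometry_iff_signedCurvature_eq (hS : UniqueDiffOn ℝ S) (hconv : Convex ℝ S)
    (hne : S.Nonempty) (hn : 2 ≤ n) (hk : 1 ≤ k)
    (hu : ContDiffOn ℝ k u S) (hu' : ContDiffOn ℝ k u' S)
    (hnorm : ∀ t ∈ S, ‖u t‖ = 1) (hnorm' : ∀ t ∈ S, ‖u' t‖ = 1)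
    (hreg : ∀ t ∈ S, LinearIndependent ℝ (fun i : Fin k => iteratedDerivWithin i u S t))
    (hreg' : ∀ t ∈ S, LinearIndependent ℝ (fun i : Fin k => iteratedDerivWithin i u' S t))
    (hrank : finrank ℝ (Submodule.span ℝ (u '' S)) = k) :
    (∃ A : EuclideanSpace ℝ (Fin n) ≃ₗᵢ[ℝ] EuclideanSpace ℝ (Fin n),
      0 < LinearMap.det (A.toLinearEquiv : EuclideanSpace ℝ (Fin n) →ₗ[ℝ] _) ∧
      ∀ t ∈ S, u' t = A (u t)) ↔
    finrank ℝ (Submodule.span ℝ (u' '' S)) = k ∧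
      ∀ j, 1 ≤ j → j + 1 ≤ k → ∀ t ∈ S, signedCurvature S u j t = signedCurvature S u' j t := by
  constructor
  · rintro ⟨A, hA, hAu⟩
    refine ⟨?_, fun j _ _ t ht => (signedCurvature_comp A hA hAu j ht).symm⟩
    have h1 : u' '' S = A.toLinearEquiv.toLinearMap '' (u '' S) := by
      rw [Set.image_image]
      exact Set.image_congr hAu
    rw [h1, Submodule.span_image, ← hrank]
    exact LinearEquiv.finrank_map_eq _ _
  · rintro ⟨hrank', hκ⟩
    obtain ⟨j, rfl⟩ : ∃ j, k = j + 1 := ⟨k - 1, by omega⟩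
    obtain ⟨a, ha⟩ := hne
    have h := isFrenetUpTo hS hu hnorm hreg j (by omega)
    have h' := isFrenetUpTo hS hu' hnorm' hreg' j (by omega)
    have hjn : j < n := by
      have h1 := (hreg a ha).fintype_card_le_finrank
      rw [← card_fin_eq_finrank, Fintype.card_fin, Fintype.card_fin] at h1
      omega
    have hκ' : ∀ i ≤ j, ∀ t ∈ S, curvature S u i t = curvature S u' i t := by
      intro i hi t ht
      rcases Nat.eq_zero_or_pos i with rfl | hi0
      · rfl
      · have h1 := hκ i hi0 (by omega) t ht
        by_cases hin : i + 1 = n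
        · obtain rfl : i = j := by omega
          rw [signedCurvature_last hi0 hin, signedCurvature_last hi0 hin] at h1
          have h2 := congrArg abs h1
          rw [abs_mul, abs_mul, h.abs_volumeForm hin ht, h'.abs_volumeForm hin ht, mul_one,
            mul_one] at h2
          have h3 : ∀ v : ℝ → EuclideanSpace ℝ (Fin n), 0 ≤ curvature S v i t := by
            obtain ⟨i, rfl⟩ : ∃ l, i = l + 1 := ⟨i - 1, by omega⟩
            exact fun v => norm_nonneg _
          rwa [abs_of_nonneg (h3 u), abs_of_nonneg (h3 u')] at h2
        · rwa [signedCurvature, signedCurvature, if_neg hin, if_neg hin] at h1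
    have h0 := fun t ht => h.curvature_succ_eq_zero hS (by omega) (t := t)
      (fun s hs => Submodule.subset_span (mem_image_of_mem u hs)) hrank.le ht
    have h0' := fun t ht => h'.curvature_succ_eq_zero hS (by omega) (t := t)
      (fun s hs => Submodule.subset_span (mem_image_of_mem u' hs)) hrank'.le ht
    have hvol : j + 1 = n → (stdOrientation n).volumeForm (fun i : Fin n => frenetVector S u i a) =
        (stdOrientation n).volumeForm (fun i : Fin n => frenetVector S u' i a) := by
      intro hjn
      -- As `2 ≤ n`, the last signed curvature is among the given ones, and its absolute value does
      -- not vanish.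
      have h1 := hκ j (by omega) le_rfl a ha
      rw [signedCurvature_last (by omega) hjn, signedCurvature_last (by omega) hjn,
        ← hκ' j le_rfl a ha] at h1
      have h2 := h.curvature_ne_zero (j - 1) (by omega) a ha
      rw [Nat.sub_add_cancel (by omega)] at h2
      exact mul_left_cancel₀ h2 h1
    obtain ⟨A, hA, hAf⟩ := exists_isometry_frenetVector h h' ha hvol hjn
    exact ⟨A, hA, fun t ht => (eq_of_curvature_eq hconv A (by omega) h h' hκ' h0 h0' ha hAf
      ht).symm⟩

end Congruence

/-! ### Curves read in a parallel frame -/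

section Transfer

variable {n : ℕ} {M : Type*} [TopologicalSpace M] [ChartedSpace (EuclideanSpace ℝ (Fin n)) M]
  [IsManifold (𝓡 n) ∞ M] [RiemannianBundle (fun p : M => TangentSpace (𝓡 n) p)]
  [IsContMDiffRiemannianBundle (𝓡 n) ∞ (EuclideanSpace ℝ (Fin n))
    (fun p : M => TangentSpace (𝓡 n) p)]
  {τ t : ℝ} {x : ℝ → M} {k : ℕ}
  {φ : ∀ t, EuclideanSpace ℝ (Fin n) ≃ₗᵢ[ℝ] TangentSpace (𝓡 n) (x t)}

/-- The velocity of `x`, read in the frame `φ` along `x`. If the frame is parallel, then this is the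
velocity of the anti-development of `x`. -/
def frameVelocity (τ : ℝ) (x : ℝ → M)
    (φ : ∀ t, EuclideanSpace ℝ (Fin n) ≃ₗᵢ[ℝ] TangentSpace (𝓡 n) (x t)) (t : ℝ) :
    EuclideanSpace ℝ (Fin n) :=
  (φ t).symm (velocity n τ x t)

theorem apply_frameVelocity (t : ℝ) : φ t (frameVelocity τ x φ t) = velocity n τ x t :=
  (φ t).apply_symm_apply _

theorem norm_frameVelocity (t : ℝ) : ‖frameVelocity τ x φ t‖ = ‖velocity n τ x t‖ :=
  (φ t).symm.norm_map _

theorem contDiffOn_frameVelocity (hτ : 0 < τ)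
    (hx : ContMDiffOn 𝓘(ℝ, ℝ) (𝓡 n) ((k + 1 : ℕ) : WithTop ℕ∞) x (Icc 0 τ))
    (hφ : ∀ t ∈ Icc 0 τ, IsParallelFrameAt k τ x φ t) :
    ContDiffOn ℝ k (frameVelocity τ x φ) (Icc 0 τ) := fun t ht =>
  (hφ t ht).contDiffWithinAt_symm (by exact_mod_cast le_top)
    (smoothFieldAt_velocity (by norm_cast) hτ hx ht)

theorem covDerivAlong_eq_of_eqOn (hk : 1 ≤ k) (hτ : 0 < τ)
    (hx : MDifferentiableOn 𝓘(ℝ, ℝ) (𝓡 n) x (Icc 0 τ))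
    (hφ : ∀ t ∈ Icc 0 τ, IsParallelFrameAt k τ x φ t) {Z : ∀ t, TangentSpace (𝓡 n) (x t)}
    {z : ℝ → EuclideanSpace ℝ (Fin n)} (hZ : ∀ s ∈ Icc 0 τ, Z s = φ s (z s)) (ht : t ∈ Icc 0 τ)
    (hz : DifferentiableWithinAt ℝ z (Icc 0 τ) t) :
    covDerivAlong τ x Z t = φ t (derivWithin z (Icc 0 τ) t) :=
  (covDerivAlong_congr ht (eventually_mem_nhdsWithin.mono fun s hs => hZ s hs)).trans
    ((hφ t ht).covDerivAlong_apply (by exact_mod_cast (by omega : k ≠ 0)) hτ (hx t ht) ht hz)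

theorem iterCovDeriv_eq (hk : 1 ≤ k) (hτ : 0 < τ)
    (hx : ContMDiffOn 𝓘(ℝ, ℝ) (𝓡 n) ((k + 1 : ℕ) : WithTop ℕ∞) x (Icc 0 τ))
    (hφ : ∀ t ∈ Icc 0 τ, IsParallelFrameAt k τ x φ t) {j : ℕ} (hj : j ≤ k) :
    ∀ t ∈ Icc 0 τ, iterCovDeriv n τ x j t =
      φ t (iteratedDerivWithin j (frameVelocity τ x φ) (Icc 0 τ) t) := by
  have hxd : MDifferentiableOn 𝓘(ℝ, ℝ) (𝓡 n) x (Icc 0 τ) := fun s hs =>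
    (hx s hs).mdifferentiableWithinAt (by exact_mod_cast Nat.succ_ne_zero k)
  induction j with
  | zero =>
    intro t ht
    rw [iteratedDerivWithin_zero]
    exact (apply_frameVelocity t).symm
  | succ j ih =>
    intro t ht
    rw [iteratedDerivWithin_succ]
    exact covDerivAlong_eq_of_eqOn hk hτ hxd hφ (ih (by omega)) ht
      ((contDiffOn_frameVelocity hτ hx hφ).differentiableOn_iteratedDerivWithin
        (by exact_mod_cast hj) (uniqueDiffOn_Icc hτ) t ht)

theorem linearIndependent_iteratedDerivWithin (hk : 1 ≤ k) (hτ : 0 < τ)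
    (hx : ContMDiffOn 𝓘(ℝ, ℝ) (𝓡 n) ((k + 1 : ℕ) : WithTop ℕ∞) x (Icc 0 τ))
    (hφ : ∀ t ∈ Icc 0 τ, IsParallelFrameAt k τ x φ t) (hreg : IsRegularCurve n τ k x) :
    ∀ t ∈ Icc 0 τ, LinearIndependent ℝ
      (fun i : Fin k => iteratedDerivWithin i (frameVelocity τ x φ) (Icc 0 τ) t) := by
  intro t ht
  have h1 : (fun i : Fin k => iterCovDeriv n τ x i t) = (φ t).toLinearEquiv.toLinearMap ∘
      fun i : Fin k => iteratedDerivWithin i (frameVelocity τ x φ) (Icc 0 τ) t := by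
    funext i
    exact iterCovDeriv_eq hk hτ hx hφ i.2.le t ht
  have h2 := hreg t ht
  rw [h1] at h2
  exact LinearIndependent.of_comp _ h2

/-- The Frenet data of `x` are those of the curve in `ℝⁿ` that is read in a parallel frame. -/
theorem frenetData_eq (hk : 1 ≤ k) (hτ : 0 < τ)
    (hx : ContMDiffOn 𝓘(ℝ, ℝ) (𝓡 n) ((k + 1 : ℕ) : WithTop ℕ∞) x (Icc 0 τ))
    (hφ : ∀ t ∈ Icc 0 τ, IsParallelFrameAt k τ x φ t)
    (harc : IsArcLength n τ x) (hreg : IsRegularCurve n τ k x) {j : ℕ} (hj : j < k) :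
    (∀ t ∈ Icc 0 τ, (frenetData n τ x j).1 t =
      φ t ((curveFrenetData (Icc 0 τ) (frameVelocity τ x φ) j).1 t)) ∧
    (∀ t ∈ Icc 0 τ, (frenetData n τ x j).2.1 t =
      φ t (frenetVector (Icc 0 τ) (frameVelocity τ x φ) j t)) ∧
    (∀ t ∈ Icc 0 τ, (frenetData n τ x j).2.2 t =
      curvature (Icc 0 τ) (frameVelocity τ x φ) j t) ∧
    (∀ t ∈ Icc 0 τ, frenetRemainder τ x (frenetData n τ x j) t =
      φ t (curveRemainder (Icc 0 τ) (curveFrenetData (Icc 0 τ) (frameVelocity τ x φ) j) t)) := by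
  have hxd : MDifferentiableOn 𝓘(ℝ, ℝ) (𝓡 n) x (Icc 0 τ) := fun s hs =>
    (hx s hs).mdifferentiableWithinAt (by exact_mod_cast Nat.succ_ne_zero k)
  have hrem : ∀ j < k, (∀ t ∈ Icc 0 τ, (frenetData n τ x j).1 t =
        φ t ((curveFrenetData (Icc 0 τ) (frameVelocity τ x φ) j).1 t)) →
      (∀ t ∈ Icc 0 τ, (frenetData n τ x j).2.1 t =
        φ t (frenetVector (Icc 0 τ) (frameVelocity τ x φ) j t)) →
      (∀ t ∈ Icc 0 τ, (frenetData n τ x j).2.2 t =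
        curvature (Icc 0 τ) (frameVelocity τ x φ) j t) →
      (∀ t ∈ Icc 0 τ, frenetRemainder τ x (frenetData n τ x j) t =
        φ t (curveRemainder (Icc 0 τ)
          (curveFrenetData (Icc 0 τ) (frameVelocity τ x φ) j) t)) := by
    intro j hj h1 h2 h3 t ht
    have h := isFrenetUpTo (uniqueDiffOn_Icc hτ) (contDiffOn_frameVelocity hτ hx hφ)
      (fun t ht => (norm_frameVelocity t).trans (harc t ht))
      (linearIndependent_iteratedDerivWithin hk hτ hx hφ hreg) j hj
    have h4 := covDerivAlong_eq_of_eqOn hk hτ hxd hφ h2 ht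
      (h.hasDerivWithinAt hj le_rfl ht).differentiableWithinAt
    rw [frenetRemainder, h4, h3 t ht, h1 t ht, ← map_smul, ← map_add]
    rfl
  induction j with
  | zero =>
    have h1 : ∀ t ∈ Icc 0 τ, (frenetData n τ x 0).1 t =
        φ t ((curveFrenetData (Icc 0 τ) (frameVelocity τ x φ) 0).1 t) :=
      fun t _ => (map_zero (φ t)).symm
    have h2 : ∀ t ∈ Icc 0 τ, (frenetData n τ x 0).2.1 t =
        φ t (frenetVector (Icc 0 τ) (frameVelocity τ x φ) 0 t) :=
      fun t _ => (apply_frameVelocity t).symm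
    have h3 : ∀ t ∈ Icc 0 τ, (frenetData n τ x 0).2.2 t =
        curvature (Icc 0 τ) (frameVelocity τ x φ) 0 t := fun t _ => rfl
    exact ⟨h1, h2, h3, hrem 0 hj h1 h2 h3⟩
  | succ j ih =>
    obtain ⟨-, h2, -, h4⟩ := ih (by omega)
    have h6 : ∀ t ∈ Icc 0 τ, (frenetData n τ x (j + 1)).2.2 t =
        curvature (Icc 0 τ) (frameVelocity τ x φ) (j + 1) t := by
      intro t ht
      change ‖frenetRemainder τ x (frenetData n τ x j) t‖ = ‖curveRemainder _ _ t‖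
      rw [h4 t ht, (φ t).norm_map]
    have h5 : ∀ t ∈ Icc 0 τ, (frenetData n τ x (j + 1)).2.1 t =
        φ t (frenetVector (Icc 0 τ) (frameVelocity τ x φ) (j + 1) t) := by
      intro t ht
      change ‖frenetRemainder τ x (frenetData n τ x j) t‖⁻¹ •
        frenetRemainder τ x (frenetData n τ x j) t = φ t (‖curveRemainder _ _ t‖⁻¹ •
          curveRemainder _ _ t)
      rw [h4 t ht, (φ t).norm_map, map_smul]
    exact ⟨h2, h5, h6, hrem (j + 1) hj h2 h5 h6⟩

/-- The defining property of the last Frenet vector. -/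
theorem inner_lastFrenet (hn : 1 ≤ n) (o : ManifoldOrientation n M)
    (w : TangentSpace (𝓡 n) (x t)) :
    ⟪lastFrenet o τ x t, w⟫_ℝ = (o.orient (x t)).volumeForm (fun j : Fin n =>
      if j.val + 1 < n then (frenetData n τ x (j.val + 1)).1 t else w) := by
  let l : Fin n := ⟨n - 1, by omega⟩
  let v : Fin n → TangentSpace (𝓡 n) (x t) := fun j => (frenetData n τ x (j.val + 1)).1 t
  have h1 : ∀ w : TangentSpace (𝓡 n) (x t), (fun j : Fin n =>
      if j.val + 1 < n then (frenetData n τ x (j.val + 1)).1 t else w) =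
      Function.update v l w := by
    intro w
    funext j
    by_cases hj : j = l
    · rw [hj, Function.update_self, if_neg (by simp only [l]; omega)]
    · have : j.val ≠ n - 1 := fun h => hj (Fin.ext h)
      rw [Function.update_of_ne hj, if_pos (by omega)]
  simp only [lastFrenet, h1, sum_inner, real_inner_smul_left]
  conv_rhs => rw [← (stdOrthonormalBasis ℝ (TangentSpace (𝓡 n) (x t))).sum_repr' w]
  rw [AlternatingMap.map_update_sum]
  refine Finset.sum_congr rfl fun i _ => ?_
  rw [AlternatingMap.map_update_smul, smul_eq_mul, mul_comm]

/-- The geodesic curvatures of `x` are those of the curve in `ℝⁿ` that is read in a parallel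
positively oriented frame. -/
theorem geodesicCurvature_eq (hτ : 0 < τ)
    (hx : ContMDiffOn 𝓘(ℝ, ℝ) (𝓡 n) ((k + 1 : ℕ) : WithTop ℕ∞) x (Icc 0 τ))
    (hφ : ∀ t ∈ Icc 0 τ, IsParallelFrameAt k τ x φ t)
    (harc : IsArcLength n τ x) (hreg : IsRegularCurve n τ k x) (o : ManifoldOrientation n M)
    (ht : t ∈ Icc 0 τ)
    (ho : Orientation.map (Fin n) (φ t).toLinearEquiv (stdOrientation n) = o.orient (x t))
    {j : ℕ} (hj1 : 1 ≤ j) (hj : j + 1 ≤ k) :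
    geodesicCurvature o τ x j t =
      signedCurvature (Icc 0 τ) (frameVelocity τ x φ) j t := by
  have h := fun j (hj : j < k) => frenetData_eq (by omega) hτ hx hφ harc hreg (j := j) hj
  unfold geodesicCurvature signedCurvature
  split_ifs with hjn
  · rw [inner_lastFrenet (by omega), ← ho, Orientation.volumeForm_map]
    congr 1
    funext i
    simp only [Function.comp_apply]
    split_ifs with hi
    · exact (φ t).symm_apply_eq.2 ((h i (by omega)).2.1 t ht)
    · exact (φ t).symm_apply_eq.2 ((h (j - 1) (by omega)).2.2.2 t ht)
  · exact (h j (by omega)).2.2.1 t ht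

theorem isParallelField_apply (hk : 1 ≤ k) (hφ : ∀ t ∈ Icc 0 τ, IsParallelFrameAt k τ x φ t)
    (w : EuclideanSpace ℝ (Fin n)) : IsParallelField τ x (fun s => φ s w) := fun t ht =>
  ⟨(hφ t ht w).1.diffFieldAt (by exact_mod_cast (by omega : k ≠ 0)), (hφ t ht w).2⟩

theorem IsParallelField.symm_apply_eq (hk : 1 ≤ k) (hτ : 0 < τ)
    (hx : MDifferentiableOn 𝓘(ℝ, ℝ) (𝓡 n) x (Icc 0 τ))
    (hφ : ∀ t ∈ Icc 0 τ, IsParallelFrameAt k τ x φ t) {Z : ∀ t, TangentSpace (𝓡 n) (x t)}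
    (hZ : IsParallelField τ x Z) {s : ℝ} (hs : s ∈ Icc 0 τ) (ht : t ∈ Icc 0 τ) :
    (φ s).symm (Z s) = (φ t).symm (Z t) :=
  eq_of_hasDerivWithinAt_zero (convex_Icc 0 τ) (f := fun s => (φ s).symm (Z s))
    (fun r hr => by
      have h1 := (hφ r hr).hasDerivWithinAt_symm (by exact_mod_cast (by omega : k ≠ 0)) hτ
        (hx r hr) hr (hZ r hr).1
      rwa [(hZ r hr).2, map_zero] at h1) hs ht

/-- In a parallel frame, the minimal parallel distribution that contains the velocity is the
constant subspace spanned by the velocities at all times. -/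
theorem minimalParallelDistribution_eq (hk : 1 ≤ k) (hτ : 0 < τ)
    (hx : MDifferentiableOn 𝓘(ℝ, ℝ) (𝓡 n) x (Icc 0 τ))
    (hφ : ∀ t ∈ Icc 0 τ, IsParallelFrameAt k τ x φ t) (ht : t ∈ Icc 0 τ) :
    minimalParallelDistribution n τ x t =
      (Submodule.span ℝ (frameVelocity τ x φ '' Icc 0 τ)).map
        (φ t).toLinearEquiv.toLinearMap := by
  set W := Submodule.span ℝ (frameVelocity τ x φ '' Icc 0 τ)
  refine le_antisymm ?_ ?_
  · have h1 : IsParallelDistribution τ x (fun t => W.map (φ t).toLinearEquiv.toLinearMap) := by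
      rintro Z hZ s hs t ht ⟨w, hw, hws⟩
      refine ⟨w, hw, ?_⟩
      have h2 : (φ s).symm (Z s) = w := (φ s).symm_apply_eq.2 hws.symm
      rw [hZ.symm_apply_eq hk hτ hx hφ hs ht] at h2
      exact ((φ t).symm_apply_eq.1 h2).symm
    have h2 : ContainsVelocity τ x (fun t => W.map (φ t).toLinearEquiv.toLinearMap) :=
      fun s hs => ⟨_, Submodule.subset_span (mem_image_of_mem _ hs),
        apply_frameVelocity s⟩
    exact (isLeast_minimalParallelDistribution τ x).2 ⟨h1, h2⟩ t
  · rw [Submodule.map_span, Submodule.span_le]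
    rintro _ ⟨_, ⟨s, hs, rfl⟩, rfl⟩
    obtain ⟨h1, h2⟩ := (isLeast_minimalParallelDistribution (n := n) τ x).1
    refine h1 _ (isParallelField_apply hk hφ (frameVelocity τ x φ s)) s hs t ht ?_
    rw [apply_frameVelocity]
    exact h2 s hs

theorem hasRank_minimalParallelDistribution_iff (hk : 1 ≤ k) (hτ : 0 < τ)
    (hx : MDifferentiableOn 𝓘(ℝ, ℝ) (𝓡 n) x (Icc 0 τ))
    (hφ : ∀ t ∈ Icc 0 τ, IsParallelFrameAt k τ x φ t) (r : ℕ) :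
    HasRank τ r (minimalParallelDistribution n τ x) ↔
      finrank ℝ (Submodule.span ℝ (frameVelocity τ x φ '' Icc 0 τ)) = r := by
  have h : ∀ t ∈ Icc 0 τ, finrank ℝ (minimalParallelDistribution n τ x t) =
      finrank ℝ (Submodule.span ℝ (frameVelocity τ x φ '' Icc 0 τ)) := by
    intro t ht
    rw [minimalParallelDistribution_eq hk hτ hx hφ ht]
    exact LinearEquiv.finrank_map_eq _ _
  constructor
  · intro h1
    rw [← h 0 ⟨le_rfl, hτ.le⟩]
    exact h1 0 ⟨le_rfl, hτ.le⟩
  · intro h1 t ht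
    rw [h t ht, h1]

end Transfer

/-! ### Local absolute continuity -/

section AbsoluteContinuity

variable {E : Type*} [NormedAddCommGroup E] [NormedSpace ℝ E] {τ t₀ : ℝ} {f g : ℝ → E}

/-- The function `f` is absolutely continuous on all small intervals in `[0, τ]` near `t₀`. -/
def LocallyACAt (τ t₀ : ℝ) (f : ℝ → E) : Prop :=
  ∀ᶠ N in (𝓝[Icc 0 τ] t₀).smallSets, ∀ a b, Icc a b ⊆ N → a ≤ b →
    AbsolutelyContinuousOnInterval f a b

theorem locallyACAt_of_mem {N : Set ℝ} (hN : N ∈ 𝓝[Icc 0 τ] t₀)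
    (h : ∀ a b, Icc a b ⊆ N → a ≤ b → AbsolutelyContinuousOnInterval f a b) :
    LocallyACAt τ t₀ f :=
  eventually_smallSets.2 ⟨N, hN, fun _ hL a b hab => h a b (hab.trans hL)⟩

theorem IsACNear.locallyACAt {n : ℕ} {S : Set ℝ} {f : ℝ → EuclideanSpace ℝ (Fin n)}
    (h : IsACNear τ t₀ S f) : LocallyACAt τ t₀ f := by
  obtain ⟨a, b, hmem, -, hf⟩ := h
  refine locallyACAt_of_mem hmem fun c d hcd hle => hf.mono ?_
  rw [uIcc_of_le hle]
  exact hcd.trans Icc_subset_uIcc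

theorem LocallyACAt.exists_Icc (h : LocallyACAt τ t₀ f) (hτ : 0 < τ) (ht₀ : t₀ ∈ Icc 0 τ)
    {S : Set ℝ} (hS : S ∈ 𝓝[Icc 0 τ] t₀) :
    ∃ a b, a < b ∧ t₀ ∈ Icc a b ∧ Icc a b ⊆ Icc 0 τ ∩ S ∧ Icc a b ∈ 𝓝[Icc 0 τ] t₀ ∧
      AbsolutelyContinuousOnInterval f a b := by
  obtain ⟨N, hN, hf⟩ := eventually_smallSets.1 h
  obtain ⟨a, b, hab, hmem, hsub, hnhds, -⟩ :=
    exists_Icc_mem_nhdsWithin hτ ht₀ (inter_mem hN hS) one_pos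
  exact ⟨a, b, hab, hmem, fun s hs => ⟨(hsub hs).1, (hsub hs).2.2⟩, hnhds,
    hf N Subset.rfl a b (fun s hs => (hsub hs).2.1) hab.le⟩

theorem LocallyACAt.isACNear {n : ℕ} {S : Set ℝ} {f : ℝ → EuclideanSpace ℝ (Fin n)}
    (h : LocallyACAt τ t₀ f) (hτ : 0 < τ) (ht₀ : t₀ ∈ Icc 0 τ) (hS : S ∈ 𝓝[Icc 0 τ] t₀) :
    IsACNear τ t₀ S f := by
  obtain ⟨a, b, -, -, hsub, hnhds, hf⟩ := h.exists_Icc hτ ht₀ hS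
  exact ⟨a, b, hnhds, hsub, hf⟩

theorem ContDiffWithinAt.locallyACAt (h : ContDiffWithinAt ℝ 1 f (Icc 0 τ) t₀)
    (ht₀ : t₀ ∈ Icc 0 τ) : LocallyACAt τ t₀ f := by
  obtain ⟨N, hN, -, hf⟩ := h.contDiffOn le_rfl (by simp)
  rw [insert_eq_of_mem ht₀] at hN
  refine locallyACAt_of_mem hN fun a b hab hle => ContDiffOn.absolutelyContinuousOnInterval ?_
  rw [uIcc_of_le hle]
  exact hf.mono hab

theorem LocallyACAt.fun_smul {c : ℝ → ℝ} (hc : LocallyACAt τ t₀ c) (hf : LocallyACAt τ t₀ f) :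
    LocallyACAt τ t₀ (fun s => c s • f s) :=
  (hc.and hf).mono fun _ h a b hab hle => (h.1 a b hab hle).fun_smul (h.2 a b hab hle)

theorem LocallyACAt.fun_sum {ι : Type*} (I : Finset ι) {F : ι → ℝ → E}
    (h : ∀ i ∈ I, LocallyACAt τ t₀ (F i)) : LocallyACAt τ t₀ (fun s => ∑ i ∈ I, F i s) := by
  classical
  induction I using Finset.induction_on with
  | empty =>
    refine locallyACAt_of_mem univ_mem fun a b _ _ =>
      ContDiffOn.absolutelyContinuousOnInterval ?_
    simpa using contDiffOn_const
  | insert i I hi ih =>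
    simp only [Finset.sum_insert hi]
    refine ((h i (by simp)).and (ih fun l hl => h l (by simp [hl]))).mono
      fun _ h a b hab hle => (h.1 a b hab hle).fun_add (h.2 a b hab hle)

theorem LocallyACAt.continuousLinearMap_comp {E' : Type*} [NormedAddCommGroup E']
    [NormedSpace ℝ E'] (h : LocallyACAt τ t₀ f) (L : E →L[ℝ] E') :
    LocallyACAt τ t₀ (fun s => L (f s)) := by
  refine h.mono fun N hN a b hab hle => ?_
  have hf := hN a b hab hle
  rw [absolutelyContinuousOnInterval_iff] at hf ⊢
  intro ε hε
  obtain ⟨δ, hδ, hf⟩ := hf (ε / (‖L‖ + 1)) (by positivity)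
  refine ⟨δ, hδ, fun I hI hlt => ?_⟩
  have h1 := hf I hI hlt
  rw [lt_div_iff₀ (by positivity)] at h1
  refine lt_of_le_of_lt ?_ h1
  rw [Finset.sum_mul]
  refine Finset.sum_le_sum fun i _ => ?_
  rw [dist_eq_norm, dist_eq_norm, ← map_sub, mul_comm]
  refine (L.le_opNorm _).trans ?_
  gcongr
  linarith

theorem LocallyACAt.congr_of_eventuallyEq (h : LocallyACAt τ t₀ f)
    (he : ∀ᶠ s in 𝓝[Icc 0 τ] t₀, g s = f s) : LocallyACAt τ t₀ g := by
  obtain ⟨N, hN, hf⟩ := eventually_smallSets.1 h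
  refine locallyACAt_of_mem (inter_mem hN he) fun a b hab hle => ?_
  have h1 := hf N Subset.rfl a b (hab.trans inter_subset_left) hle
  rw [absolutelyContinuousOnInterval_iff] at h1 ⊢
  intro ε hε
  obtain ⟨δ, hδ, h1⟩ := h1 ε hε
  refine ⟨δ, hδ, fun I hI hlt => ?_⟩
  refine lt_of_eq_of_lt (Finset.sum_congr rfl fun i hi => ?_) (h1 I hI hlt)
  have h2 := hI.1 i hi
  rw [uIcc_of_le hle] at h2
  have h3 : ∀ r ∈ Icc a b, g r = f r := fun r hr => (hab hr).2
  rw [h3 _ h2.1, h3 _ h2.2]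

/-- A property that holds almost everywhere near every point of `[0, τ]` holds almost everywhere
on `[0, τ]`. -/
theorem ae_restrict_Icc_of_forall_exists {P : ℝ → Prop}
    (h : ∀ t₀ ∈ Icc 0 τ, ∃ N ∈ 𝓝[Icc 0 τ] t₀, ∀ᵐ t, t ∈ N → P t) :
    ∀ᵐ t ∂volume.restrict (Icc 0 τ), P t := by
  rw [ae_restrict_iff' measurableSet_Icc, ae_iff]
  refine measure_null_of_locally_null _ fun t₀ ht₀ => ?_
  have ht₀ : t₀ ∈ Icc 0 τ := by
    by_contra h0
    exact ht₀ fun h1 => absurd h1 h0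
  obtain ⟨N, hN, hP⟩ := h t₀ ht₀
  refine ⟨N ∩ {t | ¬ (t ∈ Icc 0 τ → P t)}, ?_, ?_⟩
  · refine inter_mem (nhdsWithin_mono t₀ (fun s hs => ?_) hN) self_mem_nhdsWithin
    by_contra hs'
    exact hs fun h => absurd h hs'
  · refine measure_mono_null (fun s hs => ?_) (ae_iff.1 hP)
    exact fun h => hs.2 fun _ => h hs.1

/-- Absolutely continuous functions are differentiable almost everywhere. -/
theorem AbsolutelyContinuousOnInterval.ae_differentiableAt_of_finiteDimensional
    [FiniteDimensional ℝ E] {a b : ℝ} (h : AbsolutelyContinuousOnInterval f a b) (hab : a ≤ b) :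
    ∀ᵐ t, t ∈ Icc a b → DifferentiableAt ℝ f t := by
  have h1 := h.boundedVariationOn.locallyBoundedVariationOn.ae_differentiableWithinAt_of_mem
  rw [uIcc_of_le hab] at h1
  filter_upwards [h1, Measure.ae_ne volume a, Measure.ae_ne volume b] with t h2 h3 h4 h5
  exact (h2 h5).differentiableAt (Icc_mem_nhds (h5.1.lt_of_ne' h3) (h5.2.lt_of_ne h4))

/-- An absolutely continuous function whose derivative vanishes almost everywhere is constant. -/
theorem eq_of_ae_derivWithin_eq_zero [FiniteDimensional ℝ E] (hτ : 0 < τ)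
    (hf : ∀ t₀ ∈ Icc 0 τ, LocallyACAt τ t₀ f)
    (h : ∀ᵐ t ∂volume.restrict (Icc 0 τ), DifferentiableWithinAt ℝ f (Icc 0 τ) t →
      derivWithin f (Icc 0 τ) t = 0) {s t : ℝ} (hs : s ∈ Icc 0 τ) (ht : t ∈ Icc 0 τ) :
    f s = f t := by
  refine isPreconnected_Icc.induction₂ (fun s t => f s = f t) (fun t₀ ht₀ => ?_)
    (fun _ _ _ _ _ _ h1 h2 => h1.trans h2) (fun _ _ _ _ h => h.symm) hs ht
  obtain ⟨a, b, hab, hmem, hsub, hnhds, hac⟩ := (hf t₀ ht₀).exists_Icc hτ ht₀ univ_mem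
  rw [ae_restrict_iff' measurableSet_Icc] at h
  obtain ⟨C, hC⟩ := hac.const_of_ae_hasDerivAt_zero (by
    rw [uIcc_of_le hab.le]
    filter_upwards [h, hac.ae_differentiableAt_of_finiteDimensional hab.le,
      Measure.ae_ne volume a, Measure.ae_ne volume b] with r h1 h2 h3 h4 h5
    have hr : Icc 0 τ ∈ 𝓝 r := mem_of_superset
      (Icc_mem_nhds (h5.1.lt_of_ne' h3) (h5.2.lt_of_ne h4)) fun q hq => (hsub hq).1
    have h6 := h1 (hsub h5).1 (h2 h5).differentiableWithinAt
    rw [derivWithin_of_mem_nhds hr] at h6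
    rw [← h6]
    exact (h2 h5).hasDerivAt)
  rw [uIcc_of_le hab.le] at hC
  filter_upwards [hnhds] with r hr
  rw [hC r hr, hC t₀ hmem]

end AbsoluteContinuity

/-! ### Rollings read in parallel frames -/

section RollingCriterion

variable {n : ℕ} {M : Type*} [TopologicalSpace M] [ChartedSpace (EuclideanSpace ℝ (Fin n)) M]
  [IsManifold (𝓡 n) ∞ M] {τ t : ℝ} {x : ℝ → M} {k : ℕ}

theorem isACCurve_of_contMDiffOn (hτ : 0 < τ) (hx : ContMDiffOn 𝓘(ℝ, ℝ) (𝓡 n) 1 x (Icc 0 τ)) :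
    IsACCurve n τ x := by
  intro t₀ ht₀
  have h1 := ((contMDiffWithinAt_iff_target).1 (hx t₀ ht₀)).2.contDiffWithinAt
  exact (ContDiffWithinAt.locallyACAt h1 ht₀).isACNear hτ ht₀
    ((hx t₀ ht₀).continuousWithinAt (extChartAt_source_mem_nhds (x t₀)))

theorem isACField_of_smoothFieldAt (hτ : 0 < τ)
    (hx : ContMDiffOn 𝓘(ℝ, ℝ) (𝓡 n) 1 x (Icc 0 τ)) {Z : ∀ t, TangentSpace (𝓡 n) (x t)}
    (hZ : ∀ t ∈ Icc 0 τ, SmoothFieldAt 1 τ x Z t) : IsACField τ x Z := by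
  intro t₀ ht₀
  have hp := mem_baseSet_chartTriv (n := n) (x t₀)
  exact (((smoothFieldAt_iff (by exact_mod_cast le_top) (hx t₀ ht₀) hp).1
    (hZ t₀ ht₀)).locallyACAt ht₀).isACNear hτ ht₀
    ((hx t₀ ht₀).continuousWithinAt ((chartTriv n (x t₀)).open_baseSet.mem_nhds hp))

theorem IsACField.ae_diffFieldAt (hτ : 0 < τ)
    (hx : MDifferentiableOn 𝓘(ℝ, ℝ) (𝓡 n) x (Icc 0 τ)) {Z : ∀ t, TangentSpace (𝓡 n) (x t)}
    (hZ : IsACField τ x Z) : ∀ᵐ t ∂volume.restrict (Icc 0 τ), DiffFieldAt τ x Z t := by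
  refine ae_restrict_Icc_of_forall_exists fun t₀ ht₀ => ?_
  have hp := mem_baseSet_chartTriv (n := n) (x t₀)
  obtain ⟨a, b, hab, -, hsub, hnhds, hac⟩ := (hZ t₀ ht₀).locallyACAt.exists_Icc hτ ht₀
    ((hx t₀ ht₀).continuousWithinAt ((chartTriv n (x t₀)).open_baseSet.mem_nhds hp))
  refine ⟨_, hnhds, ?_⟩
  filter_upwards [hac.ae_differentiableAt_of_finiteDimensional hab.le] with t h1 h2
  exact (diffFieldAt_iff (hx t (hsub h2).1) (hsub h2).2).2 (h1 h2).differentiableWithinAt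

variable [RiemannianBundle (fun p : M => TangentSpace (𝓡 n) p)]
  [IsContMDiffRiemannianBundle (𝓡 n) ∞ (EuclideanSpace ℝ (Fin n))
    (fun p : M => TangentSpace (𝓡 n) p)]
  {M' : Type*} [TopologicalSpace M'] [ChartedSpace (EuclideanSpace ℝ (Fin n)) M']
  [IsManifold (𝓡 n) ∞ M'] [RiemannianBundle (fun p : M' => TangentSpace (𝓡 n) p)]
  [IsContMDiffRiemannianBundle (𝓡 n) ∞ (EuclideanSpace ℝ (Fin n))
    (fun p : M' => TangentSpace (𝓡 n) p)]
  {x' : ℝ → M'}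
  {φ : ∀ t, EuclideanSpace ℝ (Fin n) ≃ₗᵢ[ℝ] TangentSpace (𝓡 n) (x t)}
  {φ' : ∀ t, EuclideanSpace ℝ (Fin n) ≃ₗᵢ[ℝ] TangentSpace (𝓡 n) (x' t)}
  {q : ∀ t, TangentSpace (𝓡 n) (x t) ≃ₗᵢ[ℝ] TangentSpace (𝓡 n) (x' t)}
  {o : ManifoldOrientation n M} {o' : ManifoldOrientation n M'}

/-- Read in parallel frames along the two curves, a constant isometry that maps the velocity of one
curve to that of the other is a rolling. -/
theorem isRolling_of_frameVelocity_eq (hk : 1 ≤ k) (hτ : 0 < τ)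
    (hx : ContMDiffOn 𝓘(ℝ, ℝ) (𝓡 n) ((k + 1 : ℕ) : WithTop ℕ∞) x (Icc 0 τ))
    (hx' : ContMDiffOn 𝓘(ℝ, ℝ) (𝓡 n) ((k + 1 : ℕ) : WithTop ℕ∞) x' (Icc 0 τ))
    (hφ : ∀ t ∈ Icc 0 τ, IsParallelFrameAt k τ x φ t ∧
      Orientation.map (Fin n) (φ t).toLinearEquiv (stdOrientation n) = o.orient (x t))
    (hφ' : ∀ t ∈ Icc 0 τ, IsParallelFrameAt k τ x' φ' t ∧
      Orientation.map (Fin n) (φ' t).toLinearEquiv (stdOrientation n) = o'.orient (x' t))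
    {A : EuclideanSpace ℝ (Fin n) ≃ₗᵢ[ℝ] EuclideanSpace ℝ (Fin n)}
    (hdet : 0 < LinearMap.det (A.toLinearEquiv : EuclideanSpace ℝ (Fin n) →ₗ[ℝ] _))
    (hA : ∀ t ∈ Icc 0 τ, frameVelocity τ x' φ' t = A (frameVelocity τ x φ t)) :
    IsRolling o o' τ x x' (fun t => (φ t).symm.trans (A.trans (φ' t))) := by
  have hk0 : ((k : ℕ) : WithTop ℕ∞) ≠ 0 := by exact_mod_cast (by omega : k ≠ 0)
  have hk1 : (1 : WithTop ℕ∞) ≤ ((k : ℕ) : WithTop ℕ∞) := by exact_mod_cast hk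
  have hkt : ((k : ℕ) : WithTop ℕ∞) ≤ ∞ := by exact_mod_cast le_top
  have hkk : ((k : ℕ) : WithTop ℕ∞) ≤ ((k + 1 : ℕ) : WithTop ℕ∞) := by
    exact_mod_cast Nat.le_succ k
  have hxk := hx.of_le hkk
  have hxk' := hx'.of_le hkk
  have hxd : MDifferentiableOn 𝓘(ℝ, ℝ) (𝓡 n) x (Icc 0 τ) := fun s hs =>
    (hxk s hs).mdifferentiableWithinAt hk0
  have hxd' : MDifferentiableOn 𝓘(ℝ, ℝ) (𝓡 n) x' (Icc 0 τ) := fun s hs =>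
    (hxk' s hs).mdifferentiableWithinAt hk0
  refine ⟨fun t ht => ?_, isACCurve_of_contMDiffOn hτ (hxk.of_le hk1),
    isACCurve_of_contMDiffOn hτ (hxk'.of_le hk1), fun t₀ ht₀ e => ?_, ?_, fun Z hZ => ?_⟩
  · rw [← (hφ t ht).2, ← (hφ' t ht).2, ← orientation_map_trans]
    have h1 : (φ t).toLinearEquiv.trans ((φ t).symm.trans (A.trans (φ' t))).toLinearEquiv =
        A.toLinearEquiv.trans (φ' t).toLinearEquiv := by
      ext1 w
      exact congrArg (fun w => φ' t (A w)) ((φ t).symm_apply_apply w)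
    rw [h1, orientation_map_trans,
      (Orientation.map_eq_iff_det_pos _ _ (card_fin_eq_finrank n)).2 hdet]
  · have hp := mem_baseSet_chartTriv (n := n) (x t₀)
    have hp' := mem_baseSet_chartTriv (n := n) (x' t₀)
    have h1 : SmoothFieldAt k τ x (fun s => chartField (x t₀) e (x s)) t₀ :=
      smoothFieldAt_comp (hxk t₀ ht₀) ((contMDiffAt_chartField (x t₀) hp e).of_le hkt)
    have h2 := (hφ t₀ ht₀).1.contDiffWithinAt_symm hkt h1
    have h3 := (hφ' t₀ ht₀).1.smoothFieldAt_apply hkt (hxk' t₀ ht₀) ht₀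
      (A.toContinuousLinearEquiv.contDiff.comp_contDiffWithinAt h2)
    have h4 := (smoothFieldAt_iff hkt (hxk' t₀ ht₀) hp').1 h3
    exact ((h4.of_le hk1).locallyACAt ht₀).isACNear hτ ht₀ (inter_mem
      ((hx t₀ ht₀).continuousWithinAt ((chartTriv n (x t₀)).open_baseSet.mem_nhds hp))
      ((hx' t₀ ht₀).continuousWithinAt ((chartTriv n (x' t₀)).open_baseSet.mem_nhds hp')))
  · refine ae_restrict_of_forall_mem measurableSet_Icc fun t ht => ?_
    exact (apply_frameVelocity (φ := φ') t).symm.trans (congrArg (φ' t) (hA t ht))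
  · filter_upwards [hZ.ae_diffFieldAt hτ hxd, self_mem_ae_restrict measurableSet_Icc] with t h1 ht
    have h2 := (hφ t ht).1.hasDerivWithinAt_symm hk0 hτ (hxd t ht) ht h1
    have h3 := A.toContinuousLinearEquiv.hasFDerivAt.comp_hasDerivWithinAt t h2
    have h4 := (hφ' t ht).1.covDerivAlong_apply hk0 hτ (hxd' t ht) ht h3.differentiableWithinAt
    rw [h3.derivWithin (uniqueDiffOn_Icc hτ t ht)] at h4
    exact h4.symm

/-- Read in parallel frames, the components of a rolling are absolutely continuous. -/
theorem IsRolling.locallyACAt (h : IsRolling o o' τ x x' q) (hk : 1 ≤ k)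
    (hx : ContMDiffOn 𝓘(ℝ, ℝ) (𝓡 n) k x (Icc 0 τ))
    (hx' : ContMDiffOn 𝓘(ℝ, ℝ) (𝓡 n) k x' (Icc 0 τ))
    (hφ : ∀ t ∈ Icc 0 τ, IsParallelFrameAt k τ x φ t)
    (hφ' : ∀ t ∈ Icc 0 τ, IsParallelFrameAt k τ x' φ' t) (w : EuclideanSpace ℝ (Fin n)) {t₀ : ℝ}
    (ht₀ : t₀ ∈ Icc 0 τ) : LocallyACAt τ t₀ (fun t => (φ' t).symm (q t (φ t w))) := by
  have hk1 : (1 : WithTop ℕ∞) ≤ ((k : ℕ) : WithTop ℕ∞) := by exact_mod_cast hk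
  have hkt : ((k : ℕ) : WithTop ℕ∞) ≤ ∞ := by exact_mod_cast le_top
  have hp := mem_baseSet_chartTriv (n := n) (x t₀)
  have hp' := mem_baseSet_chartTriv (n := n) (x' t₀)
  -- Expand `φ t w` and `q t` in the coordinate frames of the charts at `x t₀` and `x' t₀`; the
  -- coefficients `c`, `Q` and the frame `d` are absolutely continuous near `t₀`.
  let b := EuclideanSpace.basisFun (Fin n) ℝ
  let c : ℝ → EuclideanSpace ℝ (Fin n) := fun t => (chartTriv n (x t₀) ⟨x t, φ t w⟩).2
  let Q : Fin n → ℝ → EuclideanSpace ℝ (Fin n) := fun i t =>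
    (chartTriv n (x' t₀) ⟨x' t, q t (chartField (x t₀) (b i) (x t))⟩).2
  let d : Fin n → ℝ → EuclideanSpace ℝ (Fin n) := fun j t =>
    (φ' t).symm (chartField (x' t₀) (b j) (x' t))
  have hc : LocallyACAt τ t₀ c :=
    (((smoothFieldAt_iff hkt (hx t₀ ht₀) hp).1 (hφ t₀ ht₀ w).1).of_le hk1).locallyACAt ht₀
  have hQ : ∀ i, LocallyACAt τ t₀ (Q i) := fun i => (h.ac t₀ ht₀ (b i)).locallyACAt
  have hd : ∀ j, LocallyACAt τ t₀ (d j) := fun j =>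
    (((hφ' t₀ ht₀).contDiffWithinAt_symm hkt (smoothFieldAt_comp (hx' t₀ ht₀)
      ((contMDiffAt_chartField (x' t₀) hp' (b j)).of_le hkt))).of_le hk1).locallyACAt ht₀
  have hcoord : ∀ {f : ℝ → EuclideanSpace ℝ (Fin n)}, LocallyACAt τ t₀ f → ∀ i,
      LocallyACAt τ t₀ (fun t => f t i) := fun hf i =>
    hf.continuousLinearMap_comp (EuclideanSpace.proj (𝕜 := ℝ) i)
  refine (LocallyACAt.fun_sum Finset.univ fun i _ => (hcoord hc i).fun_smul
    (LocallyACAt.fun_sum Finset.univ fun j _ =>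
      (hcoord (hQ i) j).fun_smul (hd j))).congr_of_eventuallyEq ?_
  filter_upwards [(hx t₀ ht₀).continuousWithinAt ((chartTriv n (x t₀)).open_baseSet.mem_nhds hp),
    (hx' t₀ ht₀).continuousWithinAt ((chartTriv n (x' t₀)).open_baseSet.mem_nhds hp')] with t h1 h2
  have h3 : φ t w = ∑ i, c t i • chartField (x t₀) (b i) (x t) := eq_sum_chartField _ h1 _
  have h4 : ∀ i, q t (chartField (x t₀) (b i) (x t)) =
      ∑ j, Q i t j • chartField (x' t₀) (b j) (x' t) := fun i => eq_sum_chartField _ h2 _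
  rw [h3, map_sum, map_sum]
  refine Finset.sum_congr rfl fun i _ => ?_
  rw [map_smul, map_smul, h4 i, map_sum]
  simp only [map_smul, d]

/-- Read in parallel frames, a rolling is constant: the no-twist condition says that its derivative
vanishes almost everywhere. -/
theorem IsRolling.symm_apply_eq (h : IsRolling o o' τ x x' q) (hk : 1 ≤ k) (hτ : 0 < τ)
    (hx : ContMDiffOn 𝓘(ℝ, ℝ) (𝓡 n) k x (Icc 0 τ))
    (hx' : ContMDiffOn 𝓘(ℝ, ℝ) (𝓡 n) k x' (Icc 0 τ))
    (hφ : ∀ t ∈ Icc 0 τ, IsParallelFrameAt k τ x φ t)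
    (hφ' : ∀ t ∈ Icc 0 τ, IsParallelFrameAt k τ x' φ' t) (w : EuclideanSpace ℝ (Fin n)) {s : ℝ}
    (hs : s ∈ Icc 0 τ) (ht : t ∈ Icc 0 τ) :
    (φ' s).symm (q s (φ s w)) = (φ' t).symm (q t (φ t w)) := by
  have hk0 : ((k : ℕ) : WithTop ℕ∞) ≠ 0 := by exact_mod_cast (by omega : k ≠ 0)
  have hk1 : (1 : WithTop ℕ∞) ≤ ((k : ℕ) : WithTop ℕ∞) := by exact_mod_cast hk
  refine eq_of_ae_derivWithin_eq_zero hτ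
    (fun t₀ ht₀ => h.locallyACAt hk hx hx' hφ hφ' w ht₀) ?_ hs ht
  have h1 : IsACField τ x (fun s => φ s w) :=
    isACField_of_smoothFieldAt hτ (hx.of_le hk1) fun t ht => (hφ t ht w).1.of_le hk1
  filter_upwards [h.no_twist _ h1, self_mem_ae_restrict measurableSet_Icc] with t h2 ht h3
  have h4 := (hφ' t ht).covDerivAlong_apply hk0 hτ ((hx' t ht).mdifferentiableWithinAt hk0) ht h3
  simp only [LinearIsometryEquiv.apply_symm_apply] at h4
  rw [(hφ t ht w).2, map_zero] at h2
  exact (φ' t).map_eq_zero_iff.1 (h4.symm.trans h2.symm)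

/-- A rolling exists if and only if the velocities of the two curves, read in parallel positively
oriented orthonormal frames, differ by a constant orientation-preserving isometry. -/
theorem exists_isRolling_iff (hk : 1 ≤ k) (hτ : 0 < τ)
    (hx : ContMDiffOn 𝓘(ℝ, ℝ) (𝓡 n) ((k + 1 : ℕ) : WithTop ℕ∞) x (Icc 0 τ))
    (hx' : ContMDiffOn 𝓘(ℝ, ℝ) (𝓡 n) ((k + 1 : ℕ) : WithTop ℕ∞) x' (Icc 0 τ))
    (hφ : ∀ t ∈ Icc 0 τ, IsParallelFrameAt k τ x φ t ∧
      Orientation.map (Fin n) (φ t).toLinearEquiv (stdOrientation n) = o.orient (x t))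
    (hφ' : ∀ t ∈ Icc 0 τ, IsParallelFrameAt k τ x' φ' t ∧
      Orientation.map (Fin n) (φ' t).toLinearEquiv (stdOrientation n) = o'.orient (x' t)) :
    (∃ q : ∀ t, TangentSpace (𝓡 n) (x t) ≃ₗᵢ[ℝ] TangentSpace (𝓡 n) (x' t),
      IsRolling o o' τ x x' q) ↔
    ∃ A : EuclideanSpace ℝ (Fin n) ≃ₗᵢ[ℝ] EuclideanSpace ℝ (Fin n),
      0 < LinearMap.det (A.toLinearEquiv : EuclideanSpace ℝ (Fin n) →ₗ[ℝ] _) ∧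
      ∀ t ∈ Icc 0 τ, frameVelocity τ x' φ' t = A (frameVelocity τ x φ t) := by
  refine ⟨?_, fun ⟨A, hdet, hA⟩ => ⟨_, isRolling_of_frameVelocity_eq hk hτ hx hx' hφ hφ' hdet hA⟩⟩
  rintro ⟨q, h⟩
  have hkk : ((k : ℕ) : WithTop ℕ∞) ≤ ((k + 1 : ℕ) : WithTop ℕ∞) := by
    exact_mod_cast Nat.le_succ k
  have h0 : (0 : ℝ) ∈ Icc 0 τ := ⟨le_rfl, hτ.le⟩
  let A : EuclideanSpace ℝ (Fin n) ≃ₗᵢ[ℝ] EuclideanSpace ℝ (Fin n) :=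
    (φ 0).trans ((q 0).trans (φ' 0).symm)
  have hq : ∀ t ∈ Icc 0 τ, ∀ w, A w = (φ' t).symm (q t (φ t w)) := fun t ht w =>
    h.symm_apply_eq hk hτ (hx.of_le hkk) (hx'.of_le hkk) (fun t ht => (hφ t ht).1)
      (fun t ht => (hφ' t ht).1) w h0 ht
  refine ⟨A, ?_, ?_⟩
  · rw [← Orientation.map_eq_iff_det_pos (stdOrientation n) A.toLinearEquiv
      (card_fin_eq_finrank n)]
    refine (Orientation.map (Fin n) (φ' 0).toLinearEquiv).injective ?_
    rw [(hφ' 0 h0).2, ← h.orientation 0 h0, ← (hφ 0 h0).2, ← orientation_map_trans,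
      ← orientation_map_trans]
    congr 2
    ext1 w
    exact (φ' 0).apply_symm_apply _
  · refine Measure.eqOn_Icc_of_ae_eq volume hτ.ne ?_
      (contDiffOn_frameVelocity hτ hx' fun t ht => (hφ' t ht).1).continuousOn
      (A.continuous.comp_continuousOn
        (contDiffOn_frameVelocity hτ hx fun t ht => (hφ t ht).1).continuousOn)
    filter_upwards [h.no_slip, self_mem_ae_restrict measurableSet_Icc] with t h1 ht
    change (φ' t).symm (velocity n τ x' t) = A (frameVelocity τ x φ t)
    rw [hq t ht, apply_frameVelocity, h1]

end RollingCriterion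

end

theorem proposition3p5 {n : ℕ} (hn : 2 ≤ n) {M M' : Type*}
    [TopologicalSpace M] [T2Space M] [SecondCountableTopology M] [ConnectedSpace M]
    [ChartedSpace (EuclideanSpace ℝ (Fin n)) M] [IsManifold (𝓡 n) ∞ M]
    [RiemannianBundle (fun p : M => TangentSpace (𝓡 n) p)]
    [IsContMDiffRiemannianBundle (𝓡 n) ∞ (EuclideanSpace ℝ (Fin n))
      (fun p : M => TangentSpace (𝓡 n) p)]
    [TopologicalSpace M'] [T2Space M'] [SecondCountableTopology M'] [ConnectedSpace M']
    [ChartedSpace (EuclideanSpace ℝ (Fin n)) M'] [IsManifold (𝓡 n) ∞ M']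
    [RiemannianBundle (fun p : M' => TangentSpace (𝓡 n) p)]
    [IsContMDiffRiemannianBundle (𝓡 n) ∞ (EuclideanSpace ℝ (Fin n))
      (fun p : M' => TangentSpace (𝓡 n) p)]
    (o : ManifoldOrientation n M) (o' : ManifoldOrientation n M')
    {τ : ℝ} (hτ : 0 < τ) (k : ℕ) (x : ℝ → M) (x' : ℝ → M')
    (hx : ContMDiffOn 𝓘(ℝ, ℝ) (𝓡 n) ((k + 1 : ℕ) : WithTop ℕ∞) x (Icc 0 τ))
    (hx' : ContMDiffOn 𝓘(ℝ, ℝ) (𝓡 n) ((k + 1 : ℕ) : WithTop ℕ∞) x' (Icc 0 τ))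
    (hx_arc : IsArcLength n τ x) (hx'_arc : IsArcLength n τ x')
    (hx_reg : IsRegularCurve n τ k x) (hx'_reg : IsRegularCurve n τ k x')
    (hV : HasRank τ k (minimalParallelDistribution n τ x)) :
    (∃ q : ∀ t, TangentSpace (𝓡 n) (x t) ≃ₗᵢ[ℝ] TangentSpace (𝓡 n) (x' t),
        IsRolling o o' τ x x' q) ↔
      HasRank τ k (minimalParallelDistribution n τ x') ∧
        ∀ j : ℕ, 1 ≤ j → j + 1 ≤ k → ∀ t ∈ Icc 0 τ,
          geodesicCurvature o τ x j t = geodesicCurvature o' τ x' j t := by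
  have hxd : MDifferentiableOn 𝓘(ℝ, ℝ) (𝓡 n) x (Icc 0 τ) := fun s hs =>
    (hx s hs).mdifferentiableWithinAt (by exact_mod_cast Nat.succ_ne_zero k)
  have hxd' : MDifferentiableOn 𝓘(ℝ, ℝ) (𝓡 n) x' (Icc 0 τ) := fun s hs =>
    (hx' s hs).mdifferentiableWithinAt (by exact_mod_cast Nat.succ_ne_zero k)
  -- The minimal parallel distribution contains the initial velocity, a unit vector, so its
  -- rank is positive.
  have hk : 1 ≤ k := by
    have h0 : (0 : ℝ) ∈ Icc 0 τ := ⟨le_rfl, hτ.le⟩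
    by_contra hk
    have h1 : finrank ℝ (minimalParallelDistribution n τ x 0) = 0 := by
      rw [hV 0 h0]
      omega
    have h2 := (isLeast_minimalParallelDistribution (n := n) τ x).1.2 0 h0
    rw [Submodule.finrank_eq_zero.1 h1, Submodule.mem_bot] at h2
    have h3 := hx_arc 0 h0
    rw [h2, norm_zero] at h3
    exact zero_ne_one h3
  obtain ⟨φ, hφ⟩ := exists_oriented_parallelFrame o hk (by omega) hτ hx
  obtain ⟨φ', hφ'⟩ := exists_oriented_parallelFrame o' hk (by omega) hτ hx'
  have hp := fun t ht => (hφ t ht).1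
  have hp' := fun t ht => (hφ' t ht).1
  rw [exists_isRolling_iff hk hτ hx hx' hφ hφ',
    hasRank_minimalParallelDistribution_iff hk hτ hxd' hp',
    exists_isometry_iff_signedCurvature_eq (uniqueDiffOn_Icc hτ) (convex_Icc 0 τ)
      ⟨0, le_rfl, hτ.le⟩ hn hk (contDiffOn_frameVelocity hτ hx hp)
      (contDiffOn_frameVelocity hτ hx' hp')
      (fun t ht => (norm_frameVelocity t).trans (hx_arc t ht))
      (fun t ht => (norm_frameVelocity t).trans (hx'_arc t ht))
      (linearIndependent_iteratedDerivWithin hk hτ hx hp hx_reg)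
      (linearIndependent_iteratedDerivWithin hk hτ hx' hp' hx'_reg)
      ((hasRank_minimalParallelDistribution_iff hk hτ hxd hp k).1 hV)]
  refine and_congr_right fun _ => ?_
  refine forall_congr' fun j => forall_congr' fun hj1 => forall_congr' fun hj =>
    forall_congr' fun t => forall_congr' fun ht => ?_
  rw [geodesicCurvature_eq hτ hx hp hx_arc hx_reg o ht (hφ t ht).2 hj1 hj,
    geodesicCurvature_eq hτ hx' hp' hx'_arc hx'_reg o' ht (hφ' t ht).2 hj1 hj]
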